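/- All logarithms are to base $2$. For $c\in\mathbb N=\{0,1,2,\dots\}$ let $\log^{\circ c}$ be the $c$-fold iterate of the logarithm, where we put $\log^{\circ c} r=0$ if the iteration leaves the domain of $\log$ or reaches a negative value. **Theorem.** For every constant $c\in\mathbb{N}$ there are a deterministic algorithm $A_c$ and a polynomial $Q_c\in\mathbb R[x,y,z]$ such that for every function $\varepsilon:\mathbb N\to\mathbb R$ with $\varepsilon(d)\to0$ there is a function $\delta:\mathbb N\to\mathbb R$ with $\delta(d)\to 0$ as $d\to\infty$ for which the following holds. For all sufficiently large $d\in\mathbb N$, all $m,N\in\mathbb N$ and all integers $r\ge 1$ with $$\log^{\circ c} r\le d^{\varepsilon(d)},$$ given $r,m,d,N$, the coefficient vector (of length $d^m$) of any polynomial $f\in(\mathbb Z/r\mathbb Z)[x_1,\dots,x_m]$ of degree less than $d$ in each variable, and any points $\mathbf a_1,\dots,\mathbf a_N\in(\mathbb Z/r\mathbb Z)^m$, the algorithm $A_c$ outputs $f(\mathbf a_1),\dots,f(\mathbf a_N)$ in time at most $$(d^m+N)^{1+\delta(d)}\cdot Q_c(m,d,\log r).$$ Elements of $\mathbb Z/r\mathbb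 Z$ are represented by their residues in $\{0,\dots,r-1\}$. Time is measured in bit operations on a random access machine whose registers and memory cells hold natural numbers and whose instructions are charged according to the bit lengths of the numbers and addresses involved: linearly for addition, subtraction, comparison and memory access, and by the product of the bit lengths for multiplication and for division with remainder. -/

import Mathlib

open Filter Topology

/-! A random access machine with logarithmic (bit) cost, presented as a small structured
programming language.  A store consists of registers and of memory banks; every register and every
memory cell holds a natural number.  A program is a fixed finite text, so it mentions only finitely
many registers and banks, while cells inside a bank are addressed by computed values.  Every
operation is charged at least the bit length of all the numbers and addresses that it touches, and
multiplication and division are charged the product of the bit lengths (schoolbook arithmetic). -/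

namespace RAM

/-- A store: the contents of the registers, and of the cells of the memory banks
(`mem b i` is cell `i` of bank `b`). -/
structure Store where
  reg : ℕ → ℕ
  mem : ℕ → ℕ → ℕ

/-- The arithmetic operations on natural numbers (`sub` is truncated subtraction, `div` and `mod`
are quotient and remainder). -/
inductive Op where
  | add : Op
  | sub : Op
  | mul : Op
  | div : Op
  | mod : Op

/-- The value of an operation. -/
def Op.apply : Op → ℕ → ℕ → ℕ
  | .add, a, b => a + b
  | .sub, a, b => a - b
  | .mul, a, b => a * b
  | .div, a, b => a / b
  | .mod, a, b => a % b

/-- The number of bit operations charged for an operation; `Nat.size` is the bit length. -/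
def Op.cost : Op → ℕ → ℕ → ℕ
  | .add, a, b => 1 + Nat.size a + Nat.size b
  | .sub, a, b => 1 + Nat.size a + Nat.size b
  | .mul, a, b => (1 + Nat.size a) * (1 + Nat.size b)
  | .div, a, b => (1 + Nat.size a) * (1 + Nat.size b)
  | .mod, a, b => (1 + Nat.size a) * (1 + Nat.size b)

/-- Expressions: literals, registers, a cell of a fixed bank at a computed address, operations. -/
inductive Expr where
  | lit : ℕ → Expr
  | reg : ℕ → Expr
  | read : ℕ → Expr → Expr
  | op : Op → Expr → Expr → Expr

/-- The value of an expression. -/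
def Expr.val (s : Store) : Expr → ℕ
  | .lit n => n
  | .reg x => s.reg x
  | .read b e => s.mem b (e.val s)
  | .op o e₁ e₂ => o.apply (e₁.val s) (e₂.val s)

/-- The cost of evaluating an expression; it is at least the bit length of the value. -/
def Expr.cost (s : Store) : Expr → ℕ
  | .lit n => 1 + Nat.size n
  | .reg x => 1 + Nat.size (s.reg x)
  | .read b e => e.cost s + (1 + Nat.size (e.val s) + Nat.size (s.mem b (e.val s)))
  | .op o e₁ e₂ => e₁.cost s + e₂.cost s + o.cost (e₁.val s) (e₂.val s)

/-- Programs. -/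
inductive Prog where
  | skip : Prog
  /-- `set x e`: store the value of `e` in register `x`. -/
  | set : ℕ → Expr → Prog
  /-- `write b i e`: store the value of `e` in cell `i` of bank `b`. -/
  | write : ℕ → Expr → Expr → Prog
  | seq : Prog → Prog → Prog
  /-- `cond e P Q`: run `P` if `e` is nonzero and `Q` otherwise. -/
  | cond : Expr → Prog → Prog → Prog
  /-- `loop e P`: run `P` as long as `e` is nonzero. -/
  | loop : Expr → Prog → Prog

/-- Storing `v` in register `x`. -/
def Store.setReg (s : Store) (x v : ℕ) : Store :=
  { s with reg := Function.update s.reg x v }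

/-- Storing `v` in cell `i` of bank `b`. -/
def Store.setMem (s : Store) (b i v : ℕ) : Store :=
  { s with mem := Function.update s.mem b (Function.update (s.mem b) i v) }

/-- `Runs P s s' T`: started in the store `s`, the program `P` halts in the store `s'`, at a total
cost of exactly `T`. -/
inductive Runs : Prog → Store → Store → ℕ → Prop where
  | skip (s : Store) : Runs .skip s s 1
  | set (s : Store) (x : ℕ) (e : Expr) :
      Runs (.set x e) s (s.setReg x (e.val s)) (1 + e.cost s)
  | write (s : Store) (b : ℕ) (i e : Expr) :
      Runs (.write b i e) s (s.setMem b (i.val s) (e.val s)) (1 + i.cost s + e.cost s)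
  | seq {P Q : Prog} {s s' s'' : Store} {T U : ℕ} (hP : Runs P s s' T) (hQ : Runs Q s' s'' U) :
      Runs (.seq P Q) s s'' (T + U)
  | cond_true {e : Expr} {P Q : Prog} {s s' : Store} {T : ℕ} (he : e.val s ≠ 0)
      (hP : Runs P s s' T) : Runs (.cond e P Q) s s' (1 + e.cost s + T)
  | cond_false {e : Expr} {P Q : Prog} {s s' : Store} {T : ℕ} (he : e.val s = 0)
      (hQ : Runs Q s s' T) : Runs (.cond e P Q) s s' (1 + e.cost s + T)
  | loop_done {e : Expr} {P : Prog} {s : Store} (he : e.val s = 0) :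
      Runs (.loop e P) s s (1 + e.cost s)
  | loop_step {e : Expr} {P : Prog} {s s' s'' : Store} {T U : ℕ} (he : e.val s ≠ 0)
      (hP : Runs P s s' T) (hL : Runs (.loop e P) s' s'' U) :
      Runs (.loop e P) s s'' (1 + e.cost s + T + U)

/-- The machine is deterministic: the final store and the cost are functions of the program and of
the initial store. -/
theorem Runs.deterministic {P : Prog} {s s₁ s₂ : Store} {T₁ T₂ : ℕ}
    (h₁ : Runs P s s₁ T₁) (h₂ : Runs P s s₂ T₂) : s₁ = s₂ ∧ T₁ = T₂ := by
  induction h₁ generalizing s₂ T₂ with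
  | skip s => cases h₂; exact ⟨rfl, rfl⟩
  | set s x e => cases h₂; exact ⟨rfl, rfl⟩
  | write s b i e => cases h₂; exact ⟨rfl, rfl⟩
  | seq hP hQ ihP ihQ =>
    cases h₂ with
    | seq hP' hQ' =>
      obtain ⟨rfl, rfl⟩ := ihP hP'
      obtain ⟨rfl, rfl⟩ := ihQ hQ'
      exact ⟨rfl, rfl⟩
  | cond_true he hP ih =>
    cases h₂ with
    | cond_true _ hP' =>
      obtain ⟨rfl, rfl⟩ := ih hP'
      exact ⟨rfl, rfl⟩
    | cond_false he' _ => exact absurd he' he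
  | cond_false he hQ ih =>
    cases h₂ with
    | cond_true he' _ => exact absurd he he'
    | cond_false _ hQ' =>
      obtain ⟨rfl, rfl⟩ := ih hQ'
      exact ⟨rfl, rfl⟩
  | loop_done he =>
    cases h₂ with
    | loop_done _ => exact ⟨rfl, rfl⟩
    | loop_step he' _ _ => exact absurd he he'
  | loop_step he hP hL ihP ihL =>
    cases h₂ with
    | loop_done he' => exact absurd he' he
    | loop_step _ hP' hL' =>
      obtain ⟨rfl, rfl⟩ := ihP hP'
      obtain ⟨rfl, rfl⟩ := ihL hL'
      exact ⟨rfl, rfl⟩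

end RAM

/-! Multivariate multipoint evaluation over `ℤ/rℤ` as a computational problem.  An element of
`ℤ/rℤ` is represented by its residue in `{0, …, r - 1}`, in one memory cell. -/

namespace MultipointEval

/-- The exponent vector whose `i`-th entry is the `i`-th base-`d` digit of `k`.  For `k < d ^ m`
this enumerates all the monomials of degree less than `d` in each of `m` variables. -/
noncomputable def exponent (d m k : ℕ) : Fin m →₀ ℕ :=
  Finsupp.equivFunOnFinite.symm fun i => k / d ^ (i : ℕ) % d

/-- The input store.  Registers 0, 1, 2, 3 hold `r`, `m`, `d`, `N`; bank 0 holds the coefficient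
vector of `f` (`d ^ m` cells); bank 1 holds the coordinates of the points, one point after the
other (`N * m` cells); everything else is zero. -/
noncomputable def input (r m d N : ℕ) (f : MvPolynomial (Fin m) (ZMod r))
    (a : Fin N → Fin m → ZMod r) : RAM.Store where
  reg x :=
    match x with
    | 0 => r
    | 1 => m
    | 2 => d
    | 3 => N
    | _ => 0
  mem b k :=
    match b with
    | 0 => if k < d ^ m then (f.coeff (exponent d m k)).val else 0
    | 1 =>
      if h : k < N * m then
        (a (finProdFinEquiv.symm ⟨k, h⟩).1 (finProdFinEquiv.symm ⟨k, h⟩).2).val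
      else 0
    | _ => 0

/-- `Solves P r m d N f a T`: on the input `(r, m, d, N, f, a)` the program `P` halts at cost at
most `T`, and then the first `N` cells of bank 2 hold the values of `f` at the points
`a 0, …, a (N - 1)`. -/
def Solves (P : RAM.Prog) (r m d N : ℕ) (f : MvPolynomial (Fin m) (ZMod r))
    (a : Fin N → Fin m → ZMod r) (T : ℝ) : Prop :=
  ∃ (s : RAM.Store) (t : ℕ), RAM.Runs P (input r m d N f a) s t ∧ (t : ℝ) ≤ T ∧
    ∀ i : Fin N, s.mem 2 i = (MvPolynomial.eval (a i) f).val

/-- The `c`-fold iterated base-2 logarithm.  Negative values are replaced by `0`, so that it is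
defined (and equal to `0`) also once the iteration has left the domain of the logarithm. -/
noncomputable def iterLog (c : ℕ) (x : ℝ) : ℝ :=
  (fun y : ℝ => max 0 (Real.logb 2 y))^[c] x

end MultipointEval

/-!
Multivariate multipoint evaluation over `ℤ/rℤ` by repeated Chinese remaindering.

The residues are read as natural numbers, the polynomial is evaluated exactly over `ℕ`, and the
values are reduced modulo `r` at the end (`MultipointEval.eval_val`). The size of the problem is
governed by a bound `B` for the coordinates: the coefficients are less than `B ^ (m + 1)`, so the
values are at most `evBound d m B = d ^ m * B ^ (m + 1 + d * m)`.

A round of reduction (`RAM.levelP_spec`) computes the values modulo `q ^ (m + 1)` for the primes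
`q = 2, 3, 5, …` and recovers them by the Chinese remainder theorem (`crt_digit`, one base `q` digit
at a time). Modulo `q ^ (m + 1)`, write a point as `a + y`, where `a` consists of the residues of the
coordinates modulo `q`, and `y` is divisible by `q`. In the Taylor expansion around `a` only the
Hasse derivatives of order at most `m` survive (`sum_hasse_modEq`), and there are at most `4 ^ m` of
them (`card_digSum_le`). The remaining problem is to evaluate these derivatives, with coefficients
less than `q ^ (m + 1)`, at points with coordinates less than `q`: it is of the same kind, with `q`
in place of `B`. By Chebyshev's bound the primes needed are at most a constant times
`d * (log B + 1)` (`RAM.exists_prime_bound`), so that a round replaces `B` by its logarithm, up to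
the factor `d`, at the price of a factor `4 ^ m` times a polynomial in `m`, `d` and `log r`.

After `c` rounds starting from `B = r` the coordinates are at most a constant times
`d * (log d + 1) * (log^{∘c} r + 1)`, which is `d ^ (1 + o(1))` (`MultipointEval.coordBound_le`). Then
the values at all points of the grid `{0, …, B - 1} ^ m` are tabulated, one variable at a time
(`table_succ`, `RAM.gridP_spec`), and the required values are looked up. The tables have at most
`max d B ^ m = (d ^ m) ^ (1 + o(1))` entries, and `4 ^ (c * m) = (d ^ m) ^ o(1)`, because `c` is
fixed and `d` tends to infinity. The total is `RAM.exists_solves_mainP`.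

Running times are handled by the predicate `RAM.WP`. As long as all numbers in the store are at most
`U`, one step of a fixed program costs at most a constant times the square of `Nat.size U + 1`. It is
therefore enough to count steps and to bound the numbers by one `U = 2 ^ E`; here `E` is polynomial
in `m`, `d` and `log r`, apart from the length of `N`, which is absorbed by `N ^ o(1)`.

The conventions for the programs are as follows. Registers 0, …, 4 hold `r`, `m`, `d`, `N` and
`d ^ m`. A subroutine has an offset `o`, and works on the registers from `o + 10` and the banks from
`o`; a subroutine that it calls for smaller coordinates has offset `o + 50`.

* Register `o + 10` holds the bound `B` for the coordinates, `o + 11` the bound for the values,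
  `o + 12` the modulus for which the values are known, `o + 13` the current candidate `q` for a prime,
  `o + 14` its least prime factor, `o + 15` the power `q ^ (m + 1)` or the size of a table, `o + 16` a multi-index
  or the number of a variable, and `o + 17` the digit sum of the multi-index or a place value in a
  table. The following registers are counters and scratch space.
* Bank `o` holds the coefficients, `o + 1` the coordinates of the points, `o + 2` the values, `o + 3`
  the values modulo `q ^ (m + 1)` or a table, and `o + 4` the next table.
-/

/-! ### Reasoning about programs -/

namespace RAM

-- Expressions are written with the usual symbols for the operations.
instance : Add Expr := ⟨Expr.op .add⟩
instance : Sub Expr := ⟨Expr.op .sub⟩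
instance : Mul Expr := ⟨Expr.op .mul⟩
instance : Div Expr := ⟨Expr.op .div⟩
instance : Mod Expr := ⟨Expr.op .mod⟩
instance (n : ℕ) : OfNat Expr n := ⟨Expr.lit n⟩

@[simp] theorem val_add (s : Store) (a b : Expr) : (a + b).val s = a.val s + b.val s := rfl
@[simp] theorem val_sub (s : Store) (a b : Expr) : (a - b).val s = a.val s - b.val s := rfl
@[simp] theorem val_mul (s : Store) (a b : Expr) : (a * b).val s = a.val s * b.val s := rfl
@[simp] theorem val_div (s : Store) (a b : Expr) : (a / b).val s = a.val s / b.val s := rfl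
@[simp] theorem val_mod (s : Store) (a b : Expr) : (a % b).val s = a.val s % b.val s := rfl
@[simp] theorem val_zero (s : Store) : (0 : Expr).val s = 0 := rfl
@[simp] theorem val_one (s : Store) : (1 : Expr).val s = 1 := rfl
@[simp] theorem val_two (s : Store) : (2 : Expr).val s = 2 := rfl
@[simp] theorem val_reg (s : Store) (x : ℕ) : (Expr.reg x).val s = s.reg x := rfl
@[simp] theorem val_read (s : Store) (b : ℕ) (e : Expr) :
    (Expr.read b e).val s = s.mem b (e.val s) := rfl

@[simp] theorem setReg_reg (s : Store) (x v y : ℕ) :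
    (s.setReg x v).reg y = if y = x then v else s.reg y := by
  simp [Store.setReg, Function.update_apply]
@[simp] theorem setReg_mem (s : Store) (x v : ℕ) : (s.setReg x v).mem = s.mem := rfl
@[simp] theorem setMem_mem (s : Store) (b i v b' i' : ℕ) :
    (s.setMem b i v).mem b' i' = if b' = b ∧ i' = i then v else s.mem b' i' := by
  simp only [Store.setMem, Function.update_apply]
  split_ifs <;> simp_all

/-- Every register and every memory cell holds a number which is at most `U`. -/
def Store.Bd (s : Store) (U : ℕ) : Prop :=
  (∀ x, s.reg x ≤ U) ∧ ∀ b i, s.mem b i ≤ U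

/-- A weight depending only on the text of an expression: in a store bounded by `U` the cost of
the expression is at most its weight times the square of `Nat.size U + 1`. -/
def Expr.wt : Expr → ℕ
  | .lit n => 1 + Nat.size n
  | .reg _ => 2
  | .read _ e => 2 * e.wt + 2
  | .op _ a b => a.wt + b.wt + (1 + a.wt) * (1 + b.wt)

theorem size_apply_le (o : Op) (a b : ℕ) : Nat.size (o.apply a b) ≤ Nat.size a + Nat.size b + 1 := by
  have ha := Nat.lt_size_self a
  have hb := Nat.lt_size_self b
  have h1 : 1 ≤ 2 ^ Nat.size a := Nat.one_le_two_pow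
  have h2 : 1 ≤ 2 ^ Nat.size b := Nat.one_le_two_pow
  rw [Nat.size_le, pow_succ, pow_add]
  cases o <;> simp only [Op.apply]
  · nlinarith
  · have := Nat.sub_le a b
    nlinarith
  · nlinarith
  · have := Nat.div_le_self a b
    nlinarith
  · have := Nat.mod_le a b
    nlinarith

theorem op_cost_le (o : Op) (a b : ℕ) : o.cost a b ≤ (1 + Nat.size a) * (1 + Nat.size b) := by
  cases o <;> simp only [Op.cost] <;> nlinarith

/-- Values are allowed to be as long as the weight permits, and costs are quadratic in the lengths
because of multiplication. -/
theorem Expr.size_and_cost_le {s : Store} {U : ℕ} (hs : s.Bd U) (e : Expr) :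
    Nat.size (e.val s) ≤ e.wt * (Nat.size U + 1) ∧ e.cost s ≤ e.wt * (Nat.size U + 1) ^ 2 := by
  generalize hl : Nat.size U = l
  have size_le : ∀ v ≤ U, Nat.size v ≤ l := fun v hv => hl ▸ Nat.size_le_size hv
  induction e with
  | lit n =>
    simp only [Expr.val, Expr.wt, Expr.cost]
    constructor
    · nlinarith [Nat.zero_le (n.size * l)]
    · exact Nat.le_mul_of_pos_right _ (by positivity)
  | reg x =>
    have := size_le _ (hs.1 x)
    simp only [Expr.val, Expr.wt, Expr.cost]; constructor <;> nlinarith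
  | read b e ih =>
    have := size_le _ (hs.2 b (e.val s))
    simp only [Expr.val, Expr.wt, Expr.cost]; constructor <;> nlinarith [ih.1, ih.2]
  | op o a b iha ihb =>
    have h1 := size_apply_le o (a.val s) (b.val s)
    have h2 := op_cost_le o (a.val s) (b.val s)
    simp only [Expr.val, Expr.wt, Expr.cost]
    constructor
    · nlinarith [iha.1, ihb.1, Nat.zero_le (a.wt * b.wt * (l + 1))]
    · have h3 : (1 + Nat.size (a.val s)) * (1 + Nat.size (b.val s)) ≤
          ((1 + a.wt) * (l + 1)) * ((1 + b.wt) * (l + 1)) :=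
        Nat.mul_le_mul (by nlinarith [iha.1]) (by nlinarith [ihb.1])
      nlinarith [iha.2, ihb.2]

/-- The weight of a program: one step of the program costs at most the weight times the square of
`Nat.size U + 1`, as long as the store is bounded by `U`. -/
def Prog.wt : Prog → ℕ
  | .skip => 1
  | .set _ e => 1 + e.wt
  | .write _ i e => 1 + i.wt + e.wt
  | .seq P Q => P.wt + Q.wt
  | .cond e P Q => 1 + e.wt + P.wt + Q.wt
  | .loop e P => 1 + e.wt + P.wt

/-- The registers that a program may write to. -/
@[simp] def Prog.wr : Prog → ℕ → Prop
  | .skip, _ => False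
  | .set x _, y => y = x
  | .write _ _ _, _ => False
  | .seq P Q, y => P.wr y ∨ Q.wr y
  | .cond _ P Q, y => P.wr y ∨ Q.wr y
  | .loop _ P, y => P.wr y

/-- The memory banks that a program may write to. -/
@[simp] def Prog.wb : Prog → ℕ → Prop
  | .skip, _ => False
  | .set _ _, _ => False
  | .write b _ _, y => y = b
  | .seq P Q, y => P.wb y ∨ Q.wb y
  | .cond _ P Q, y => P.wb y ∨ Q.wb y
  | .loop _ P, y => P.wb y

/-- The two stores agree on everything that the program does not write to. -/
def Prog.Fr (P : Prog) (s s' : Store) : Prop :=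
  (∀ x, ¬ P.wr x → s'.reg x = s.reg x) ∧ ∀ b, ¬ P.wb b → s'.mem b = s.mem b

theorem Prog.Fr.refl (P : Prog) (s : Store) : P.Fr s s := ⟨fun _ _ => rfl, fun _ _ => rfl⟩

theorem Prog.Fr.trans {P : Prog} {s s' s'' : Store} (h : P.Fr s s') (h' : P.Fr s' s'') :
    P.Fr s s'' :=
  ⟨fun x hx => (h'.1 x hx).trans (h.1 x hx), fun x hx => (h'.2 x hx).trans (h.2 x hx)⟩

theorem Prog.Fr.mono {P Q : Prog} {s s' : Store} (h : P.Fr s s')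
    (hr : ∀ x, P.wr x → Q.wr x) (hb : ∀ x, P.wb x → Q.wb x) : Q.Fr s s' :=
  ⟨fun x hx => h.1 x fun h' => hx (hr x h'), fun x hx => h.2 x fun h' => hx (hb x h')⟩

theorem Runs.fr {P : Prog} {s s' : Store} {t : ℕ} (h : Runs P s s' t) : P.Fr s s' := by
  induction h with
  | skip s => exact .refl _ _
  | set s x e => exact ⟨fun y hy => by simp_all, fun _ _ => rfl⟩
  | write s b i e => exact ⟨fun _ _ => rfl, fun c hc => by ext j; simp_all⟩
  | seq _ _ h1 h2 =>
    exact (h1.mono (fun _ => Or.inl) fun _ => Or.inl).trans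
      (h2.mono (fun _ => Or.inr) fun _ => Or.inr)
  | cond_true _ _ h => exact h.mono (fun _ => Or.inl) fun _ => Or.inl
  | cond_false _ _ h => exact h.mono (fun _ => Or.inr) fun _ => Or.inr
  | loop_done _ => exact .refl _ _
  | loop_step _ _ _ h1 h2 => exact Prog.Fr.trans (P := .loop _ _) h1 h2

/-- `WP U P s Q n`: if the store `s` is bounded by `U`, then `P` started in `s` takes at most `n`
steps, each of them charged the largest price possible for `P` in stores bounded by `U`; the final
store is bounded by `U` and satisfies `Q`. -/
def WP (U : ℕ) (P : Prog) (s : Store) (Q : Store → Prop) (n : ℕ) : Prop :=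
  s.Bd U → ∃ s' t, Runs P s s' t ∧ t ≤ n * (P.wt * (Nat.size U + 1) ^ 2) ∧ s'.Bd U ∧ Q s'

variable {U n n' n₁ n₂ : ℕ} {P R : Prog} {s : Store} {Q Q' Q₁ : Store → Prop}

/-- In the conclusion of the rules for `WP` one may use that the program leaves everything
unchanged that it does not write to. -/
theorem WP.mono (h : WP U P s Q n) (hn : n ≤ n')
    (hQ : ∀ s', s'.Bd U → P.Fr s s' → Q s' → Q' s') : WP U P s Q' n' := by
  intro hs
  obtain ⟨s', t, h1, h2, h3, h4⟩ := h hs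
  exact ⟨s', t, h1, h2.trans (Nat.mul_le_mul_right _ hn), h3, hQ s' h3 h1.fr h4⟩

theorem WP.le (h : WP U P s Q n) (hn : n ≤ n') : WP U P s Q n' := h.mono hn fun _ _ _ h => h

theorem WP.of_bd (h : s.Bd U → WP U P s Q n) : WP U P s Q n := fun hs => h hs hs

theorem WP.skip (h : Q s) : WP U .skip s Q 1 := fun hs =>
  ⟨s, 1, .skip s, by simp only [Prog.wt]; nlinarith [Nat.zero_le (Nat.size U)], hs, h⟩

theorem Store.Bd.setReg (hs : s.Bd U) {x v : ℕ} (hv : v ≤ U) : (s.setReg x v).Bd U := by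
  refine ⟨fun y => ?_, hs.2⟩
  rw [setReg_reg]
  split_ifs
  exacts [hv, hs.1 y]

theorem Store.Bd.setMem (hs : s.Bd U) {b i v : ℕ} (hv : v ≤ U) : (s.setMem b i v).Bd U := by
  refine ⟨hs.1, fun b' i' => ?_⟩
  rw [setMem_mem]
  split_ifs
  exacts [hv, hs.2 _ _]

theorem WP.set {x : ℕ} {e : Expr} (hv : e.val s ≤ U) (h : Q (s.setReg x (e.val s))) :
    WP U (.set x e) s Q 1 := by
  intro hs
  refine ⟨_, _, .set s x e, ?_, hs.setReg hv, h⟩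
  have := (e.size_and_cost_le hs).2
  simp only [Prog.wt]
  nlinarith [Nat.zero_le (Nat.size U)]

theorem WP.write {b : ℕ} {i e : Expr} (hv : e.val s ≤ U)
    (h : Q (s.setMem b (i.val s) (e.val s))) : WP U (.write b i e) s Q 1 := by
  intro hs
  refine ⟨_, _, .write s b i e, ?_, hs.setMem hv, h⟩
  have := (e.size_and_cost_le hs).2
  have := (i.size_and_cost_le hs).2
  simp only [Prog.wt]
  nlinarith [Nat.zero_le (Nat.size U)]

theorem WP.seq (h₁ : WP U P s Q₁ n₁)
    (h₂ : ∀ s', s'.Bd U → P.Fr s s' → Q₁ s' → WP U R s' Q n₂) :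
    WP U (.seq P R) s Q (n₁ + n₂) := by
  intro hs
  obtain ⟨s', t, a1, a2, a3, a4⟩ := h₁ hs
  obtain ⟨s'', t', b1, b2, b3, b4⟩ := h₂ s' a3 a1.fr a4 a3
  refine ⟨s'', t + t', .seq a1 b1, ?_, b3, b4⟩
  simp only [Prog.wt]
  generalize (Nat.size U + 1) ^ 2 = k at *
  nlinarith [Nat.zero_le (n₁ * (R.wt * k)), Nat.zero_le (n₂ * (P.wt * k))]

theorem WP.set_seq {x : ℕ} {e : Expr} (hv : e.val s ≤ U)
    (h : WP U R (s.setReg x (e.val s)) Q n) : WP U (.seq (.set x e) R) s Q (1 + n) :=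
  WP.seq (Q₁ := fun s' => s' = s.setReg x (e.val s)) (WP.set hv rfl) fun _ _ _ h' => h' ▸ h

theorem WP.cond {e : Expr} (hP : e.val s ≠ 0 → WP U P s Q n) (hR : e.val s = 0 → WP U R s Q n) :
    WP U (.cond e P R) s Q (1 + n) := by
  intro hs
  have hc := (e.size_and_cost_le hs).2
  have hk : 1 ≤ (Nat.size U + 1) ^ 2 := Nat.one_le_pow _ _ (by omega)
  simp only [Prog.wt]
  by_cases he : e.val s = 0
  · obtain ⟨s', t, a1, a2, a3, a4⟩ := hR he hs
    refine ⟨s', _, .cond_false he a1, ?_, a3, a4⟩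
    generalize (Nat.size U + 1) ^ 2 = k at *
    nlinarith [Nat.zero_le (n * ((1 + e.wt + P.wt) * k)), Nat.zero_le ((P.wt + R.wt) * k)]
  · obtain ⟨s', t, a1, a2, a3, a4⟩ := hP he hs
    refine ⟨s', _, .cond_true he a1, ?_, a3, a4⟩
    generalize (Nat.size U + 1) ^ 2 = k at *
    nlinarith [Nat.zero_le (n * ((1 + e.wt + R.wt) * k)), Nat.zero_le ((P.wt + R.wt) * k)]

/-- The rule for loops. The invariant `I k` carries an upper bound `k` on the number of
iterations that remain, and `K k` is the number of steps of the iteration that starts with `I k`. -/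
theorem WP.loop_sum {e : Expr} (I : ℕ → Store → Prop) (K : ℕ → ℕ) (fuel : ℕ) (h0 : I fuel s)
    (hstep : ∀ k s', s'.Bd U → (Prog.loop e P).Fr s s' → I k s' → e.val s' ≠ 0 →
      ∃ k', k = k' + 1 ∧ WP U P s' (I k') (K k'))
    (hdone : ∀ k s', s'.Bd U → (Prog.loop e P).Fr s s' → I k s' → e.val s' = 0 → Q s') :
    WP U (.loop e P) s Q (∑ k ∈ Finset.range fuel, (K k + 1) + 1) := by
  suffices H : ∀ k s', (Prog.loop e P).Fr s s' → I k s' →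
      WP U (.loop e P) s' Q (∑ k ∈ Finset.range k, (K k + 1) + 1) from H fuel s (.refl _ _) h0
  intro k
  induction k with
  | zero =>
    intro s' hf hI hs
    have he : e.val s' = 0 := by
      by_contra he
      obtain ⟨k', hk', -⟩ := hstep 0 s' hs hf hI he
      omega
    refine ⟨s', _, .loop_done he, ?_, hs, hdone _ _ hs hf hI he⟩
    have hc := (e.size_and_cost_le hs).2
    have hk : 1 ≤ (Nat.size U + 1) ^ 2 := Nat.one_le_pow _ _ (by omega)
    simp only [Prog.wt, Finset.sum_range_zero]
    nlinarith
  | succ k ih =>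
    intro s' hf hI hs
    have hc := (e.size_and_cost_le hs).2
    have hk : 1 ≤ (Nat.size U + 1) ^ 2 := Nat.one_le_pow _ _ (by omega)
    by_cases he : e.val s' = 0
    · refine ⟨s', _, .loop_done he, ?_, hs, hdone _ _ hs hf hI he⟩
      simp only [Prog.wt]
      generalize (Nat.size U + 1) ^ 2 = κ at *
      generalize ∑ k ∈ Finset.range (k + 1), (K k + 1) = S at *
      nlinarith [Nat.zero_le (S * ((1 + e.wt + P.wt) * κ)), Nat.zero_le (P.wt * κ)]
    · obtain ⟨k', hk', hW⟩ := hstep _ s' hs hf hI he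
      obtain rfl : k = k' := by omega
      obtain ⟨s'', t, a1, a2, a3, a4⟩ := hW hs
      obtain ⟨s₃, t', b1, b2, b3, b4⟩ := ih s'' (hf.trans (Prog.Fr.mono (Q := .loop e P) a1.fr
        (fun _ h => h) fun _ h => h)) a4 a3
      refine ⟨s₃, _, .loop_step he a1 b1, ?_, b3, b4⟩
      rw [Finset.sum_range_succ]
      simp only [Prog.wt] at *
      generalize (Nat.size U + 1) ^ 2 = κ at *
      generalize ∑ k ∈ Finset.range k, (K k + 1) = S at *
      nlinarith [Nat.zero_le (K k * ((1 + e.wt) * κ)), Nat.zero_le (P.wt * κ)]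

theorem WP.loop {e : Expr} (I : ℕ → Store → Prop) (K : ℕ) (fuel : ℕ) (h0 : I fuel s)
    (hstep : ∀ k s', s'.Bd U → (Prog.loop e P).Fr s s' → I k s' → e.val s' ≠ 0 →
      ∃ k', k = k' + 1 ∧ WP U P s' (I k') K)
    (hdone : ∀ k s', s'.Bd U → (Prog.loop e P).Fr s s' → I k s' → e.val s' = 0 → Q s') :
    WP U (.loop e P) s Q (fuel * (K + 1) + 1) :=
  (WP.loop_sum I (fun _ => K) fuel h0 hstep hdone).le (by simp)

/-- `forP i n P` runs `P` for the values `0, 1, …` of the register `i` that are less than `n`. -/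
def forP (i : ℕ) (n : Expr) (P : Prog) : Prog :=
  .seq (.set i 0) (.loop (n - .reg i) (.seq P (.set i (.reg i + 1))))

@[simp] theorem forP_wr (i : ℕ) (e : Expr) (P : Prog) (x : ℕ) :
    (forP i e P).wr x ↔ x = i ∨ P.wr x := by
  simp only [forP, Prog.wr]; tauto

@[simp] theorem forP_wb (i : ℕ) (e : Expr) (P : Prog) (x : ℕ) :
    (forP i e P).wb x ↔ P.wb x := by
  simp only [forP, Prog.wb]; tauto

/-- The rule for counting loops: `I k` holds before the iteration with counter value `k`. As the
counter is written to by the loop itself, `I` must not depend on it. -/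
theorem WP.for_sum {i : ℕ} {e : Expr} (I : ℕ → Store → Prop) (cnt : ℕ) (K : ℕ → ℕ)
    (hi : ¬ P.wr i) (hcnt : cnt ≤ U)
    (he : ∀ s', (forP i e P).Fr s s' → e.val s' = cnt)
    (hI : ∀ k s' v, I k s' → I k (s'.setReg i v)) (h0 : I 0 s)
    (hstep : ∀ k s', k < cnt → s'.Bd U → (forP i e P).Fr s s' → s'.reg i = k → I k s' →
      WP U P s' (I (k + 1)) (K k))
    (hQ : ∀ s', s'.Bd U → (forP i e P).Fr s s' → I cnt s' → Q s') :
    WP U (forP i e P) s Q (∑ k ∈ Finset.range cnt, (K k + 2) + 2) := by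
  have hfs : ∀ s', (Prog.loop (e - .reg i) (.seq P (.set i (.reg i + 1)))).Fr (s.setReg i 0) s' →
      (forP i e P).Fr s s' := fun s' h =>
    ⟨fun x hx => by
      rw [h.1 x (by simp at hx ⊢; tauto), setReg_reg, if_neg (by simp at hx; tauto)],
     fun b hb => by rw [h.2 b (by simp at hb ⊢; tauto), setReg_mem]⟩
  refine WP.le (WP.set_seq (by simp) (n := ∑ k ∈ Finset.range cnt, (K (cnt - 1 - k) + 1 + 1) + 1)
    (WP.loop_sum (fun k s' => k ≤ cnt ∧ s'.reg i = cnt - k ∧ I (cnt - k) s')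
      (fun k => K (cnt - 1 - k) + 1) cnt ?_ ?_ ?_)) ?_
  · simpa using hI 0 s 0 h0
  · rintro k s' hs hf ⟨hk, hki, hIk⟩ hne
    rw [val_sub, he s' (hfs s' hf), val_reg, hki] at hne
    obtain ⟨k', rfl⟩ : ∃ k', k = k' + 1 := ⟨k - 1, by omega⟩
    have e1 : cnt - (k' + 1) = cnt - 1 - k' := by omega
    refine ⟨k', rfl, WP.seq (hstep _ s' (by omega) hs (hfs s' hf) (e1 ▸ hki) (e1 ▸ hIk)) ?_⟩
    intro s'' hs'' hf'' hI''
    have e2 : s''.reg i = cnt - 1 - k' := by rw [hf''.1 i hi, hki, e1]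
    refine WP.set ?_ ⟨by omega, ?_, ?_⟩
    · simp only [val_add, val_reg, e2, val_one]; omega
    · simp only [val_add, val_reg, e2, val_one, setReg_reg, if_true]; omega
    · have : cnt - k' = cnt - 1 - k' + 1 := by omega
      rw [this]
      exact hI _ _ _ hI''
  · rintro k s' hs hf ⟨hk, hki, hIk⟩ hne
    rw [val_sub, he s' (hfs s' hf), val_reg, hki] at hne
    have : k = 0 := by omega
    subst this
    exact hQ s' hs (hfs s' hf) hIk
  · rw [Finset.sum_range_reflect (fun k => K k + 1 + 1)]
    simp only [add_assoc, one_add_one_eq_two]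
    omega

theorem WP.for {i : ℕ} {e : Expr} (I : ℕ → Store → Prop) (cnt : ℕ) (K : ℕ)
    (hi : ¬ P.wr i) (hcnt : cnt ≤ U)
    (he : ∀ s', (forP i e P).Fr s s' → e.val s' = cnt)
    (hI : ∀ k s' v, I k s' → I k (s'.setReg i v)) (h0 : I 0 s)
    (hstep : ∀ k s', k < cnt → s'.Bd U → (forP i e P).Fr s s' → s'.reg i = k → I k s' →
      WP U P s' (I (k + 1)) K)
    (hQ : ∀ s', s'.Bd U → (forP i e P).Fr s s' → I cnt s' → Q s') :
    WP U (forP i e P) s Q (cnt * (K + 2) + 2) :=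
  (WP.for_sum I cnt (fun _ => K) hi hcnt he hI h0 hstep hQ).le (by simp)

end RAM

/-! ### Evaluation of polynomials with natural number coefficients -/

namespace MultipointEval

open Finset

/-- The `j`-th digit of `k` in base `d`. -/
def dig (d k j : ℕ) : ℕ := k / d ^ j % d

/-- The value at the point `A` of the polynomial in `m` variables, of degree less than `d` in each
of them, whose coefficients are listed by `F` in the order of `exponent`. -/
def ev (d m : ℕ) (F A : ℕ → ℕ) : ℕ :=
  ∑ k ∈ range (d ^ m), F k * ∏ j ∈ range m, A j ^ dig d k j

/-- The product of the powers of the `y j` with the digits of `i` as exponents. -/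
def mon (d m i : ℕ) (y : ℕ → ℕ) : ℕ := ∏ j ∈ range m, y j ^ dig d i j

/-- The sum of the `m` lowest digits of `k` in base `d`. -/
def digSum (d m k : ℕ) : ℕ := ∑ j ∈ range m, dig d k j

/-- The binomial coefficient by which the coefficient of `x ^ (u + v)` is multiplied in the `v`-th
Hasse derivative, and `0` where `u + v` is not a possible degree. -/
def tayDig (d u v : ℕ) : ℕ := if u + v < d then (u + v).choose v else 0

/-- The coefficient of the monomial with index `k + i` is multiplied by `tayCoef d m i k` in the
Hasse derivative with multi-index `i`. If adding `k` and `i` produces a carry, it is `0`. -/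
def tayCoef (d m i k : ℕ) : ℕ := ∏ j ∈ range m, tayDig d (dig d k j) (dig d i j)

/-- The coefficients of the Hasse derivative with multi-index `i`. -/
def hasse (d m i : ℕ) (F : ℕ → ℕ) (k : ℕ) : ℕ := tayCoef d m i k * F (k + i)

theorem dig_add_mul_of_lt {d j m : ℕ} (k u : ℕ) (hj : j < m) :
    dig d (k + d ^ m * u) j = dig d k j := by
  rcases Nat.eq_zero_or_pos d with rfl | hd
  · have : 0 < m := by omega
    simp [dig, this.ne']
  · obtain ⟨e, rfl⟩ : ∃ e, m = j + 1 + e := ⟨m - j - 1, by omega⟩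
    have : k + d ^ (j + 1 + e) * u = k + d ^ j * (d * (d ^ e * u)) := by ring
    rw [dig, dig, this, Nat.add_mul_div_left _ _ (by positivity), Nat.add_mul_mod_self_left]

theorem dig_add_mul_self {d k m u : ℕ} (hk : k < d ^ m) (hu : u < d) :
    dig d (k + d ^ m * u) m = u := by
  rw [dig, Nat.add_mul_div_left _ _ (by omega), Nat.div_eq_of_lt hk, zero_add, Nat.mod_eq_of_lt hu]

theorem dig_lt {d : ℕ} (hd : 0 < d) (k j : ℕ) : dig d k j < d := Nat.mod_lt _ hd

theorem sum_range_mul {M : Type*} [AddCommMonoid M] (f : ℕ → M) (a n : ℕ) :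
    ∑ k ∈ range (a * n), f k = ∑ u ∈ range n, ∑ k ∈ range a, f (k + a * u) := by
  induction n with
  | zero => simp
  | succ n ih =>
    rw [mul_add_one, sum_range_add, ih, sum_range_succ]
    simp only [add_comm]

theorem ev_zero (d : ℕ) (F A : ℕ → ℕ) : ev d 0 F A = F 0 := by simp [ev]

theorem ev_succ (d m : ℕ) (F A : ℕ → ℕ) :
    ev d (m + 1) F A = ∑ u ∈ range d, ev d m (fun k => F (k + d ^ m * u)) A * A m ^ u := by
  rw [ev, pow_succ, sum_range_mul]
  refine sum_congr rfl fun u hu => ?_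
  rw [ev, sum_mul]
  refine sum_congr rfl fun k hk => ?_
  rw [prod_range_succ, dig_add_mul_self (mem_range.1 hk) (mem_range.1 hu), mul_assoc]
  congr 2
  exact prod_congr rfl fun j hj => by rw [dig_add_mul_of_lt _ _ (mem_range.1 hj)]

theorem ev_congr {d m : ℕ} {F F' A A' : ℕ → ℕ} (hF : ∀ k < d ^ m, F k = F' k)
    (hA : ∀ j < m, A j = A' j) : ev d m F A = ev d m F' A' :=
  sum_congr rfl fun k hk => by
    rw [hF k (mem_range.1 hk), prod_congr rfl fun j hj => by rw [hA j (mem_range.1 hj)]]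

theorem ev_modEq {d m E : ℕ} {F F' A A' : ℕ → ℕ} (hF : ∀ k < d ^ m, F k ≡ F' k [MOD E])
    (hA : ∀ j < m, A j ≡ A' j [MOD E]) : ev d m F A ≡ ev d m F' A' [MOD E] := by
  simp only [← ZMod.natCast_eq_natCast_iff] at *
  simp only [ev]
  push_cast
  exact sum_congr rfl fun k hk => by
    rw [hF k (mem_range.1 hk), prod_congr rfl fun j hj => by rw [hA j (mem_range.1 hj)]]

/-- An upper bound for the values of polynomials whose coefficients are at most `B ^ (m + 1)` at
points whose coordinates are at most `B`. -/
def evBound (d m B : ℕ) : ℕ := d ^ m * B ^ (m + 1 + d * m)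

theorem mon_le {d m i B : ℕ} {A : ℕ → ℕ} (hd : 0 < d) (hB : 1 ≤ B) (hA : ∀ j < m, A j ≤ B) :
    mon d m i A ≤ B ^ (d * m) := by
  calc mon d m i A ≤ ∏ j ∈ range m, B ^ d := prod_le_prod' fun j hj =>
        (Nat.pow_le_pow_left (hA j (mem_range.1 hj)) _).trans
          (Nat.pow_le_pow_right hB (dig_lt hd _ _).le)
    _ = B ^ (d * m) := by simp [pow_mul]

theorem ev_le {d m B C : ℕ} {F A : ℕ → ℕ} (hd : 0 < d) (hB : 1 ≤ B)
    (hF : ∀ k < d ^ m, F k ≤ C) (hA : ∀ j < m, A j ≤ B) :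
    ev d m F A ≤ d ^ m * (C * B ^ (d * m)) := by
  calc ev d m F A ≤ ∑ k ∈ range (d ^ m), C * B ^ (d * m) :=
        sum_le_sum fun k hk => Nat.mul_le_mul (hF k (mem_range.1 hk)) (mon_le hd hB hA)
    _ = d ^ m * (C * B ^ (d * m)) := by simp

theorem ev_le_evBound {d m B : ℕ} {F A : ℕ → ℕ} (hd : 0 < d) (hB : 1 ≤ B)
    (hF : ∀ k < d ^ m, F k ≤ B ^ (m + 1)) (hA : ∀ j < m, A j ≤ B) :
    ev d m F A ≤ evBound d m B := by
  rw [evBound, pow_add B]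
  exact ev_le hd hB hF hA

theorem mon_add_mul_self {d m i v : ℕ} (y : ℕ → ℕ) (hi : i < d ^ m) (hv : v < d) :
    mon d (m + 1) (i + d ^ m * v) y = mon d m i y * y m ^ v := by
  rw [mon, prod_range_succ, dig_add_mul_self hi hv]
  congr 1
  exact prod_congr rfl fun j hj => by rw [dig_add_mul_of_lt _ _ (mem_range.1 hj)]

theorem tayCoef_add_mul_self {d m i k u v : ℕ} (hi : i < d ^ m) (hk : k < d ^ m) (hu : u < d)
    (hv : v < d) :
    tayCoef d (m + 1) (i + d ^ m * v) (k + d ^ m * u) = tayCoef d m i k * tayDig d u v := by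
  rw [tayCoef, prod_range_succ, dig_add_mul_self hi hv, dig_add_mul_self hk hu]
  congr 1
  exact prod_congr rfl fun j hj => by
    rw [dig_add_mul_of_lt _ _ (mem_range.1 hj), dig_add_mul_of_lt _ _ (mem_range.1 hj)]

/-- Taylor expansion in one variable. -/
theorem sum_pow_add (d : ℕ) (a y : ℕ) (g : ℕ → ℕ) :
    ∑ w ∈ range d, g w * (a + y) ^ w =
      ∑ v ∈ range d, y ^ v * ∑ u ∈ range d, a ^ u * (tayDig d u v * g (u + v)) := by
  have h1 : ∀ u v, tayDig d u v * g (u + v) =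
      ∑ w ∈ range d, if u + v = w then (w.choose v) * g w else 0 := by
    intro u v
    rw [sum_ite_eq]
    simp [tayDig]
  simp only [h1, mul_sum]
  rw [sum_congr rfl fun v _ => sum_comm, sum_comm]
  refine sum_congr rfl fun w hw => ?_
  have hw := mem_range.1 hw
  rw [add_comm, (Commute.all y a).add_pow', mul_sum,
    Finset.Nat.sum_antidiagonal_eq_sum_range_succ
      (fun i j => g w * (w.choose i • (y ^ i * a ^ j)))]
  have hsub : range w.succ ⊆ range d := range_subset_range.2 hw
  rw [← sum_subset hsub]
  · refine sum_congr rfl fun v hv => ?_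
    have hv := mem_range.1 hv
    rw [sum_eq_single (w - v)]
    · rw [if_pos (by omega)]; simp only [smul_eq_mul]; ring
    · intro u _ hu
      rw [if_neg (by omega)]; simp
    · intro h
      exact absurd (mem_range.2 (by omega)) h
  · intro v _ hv
    simp only [mem_range, not_lt] at hv
    refine sum_eq_zero fun u _ => ?_
    rw [if_neg (by omega)]; simp

/-- Taylor expansion in `m` variables. -/
theorem ev_add (d m : ℕ) (F a y : ℕ → ℕ) :
    ev d m F (fun j => a j + y j) =
      ∑ i ∈ range (d ^ m), mon d m i y * ev d m (hasse d m i F) a := by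
  induction m generalizing F with
  | zero => simp [ev, mon, hasse, tayCoef]
  | succ m ih =>
    rw [ev_succ]
    simp only [ih]
    simp only [sum_mul]
    rw [sum_comm]
    simp only [mul_assoc, ← mul_sum]
    rw [pow_succ, sum_range_mul, sum_comm]
    refine sum_congr rfl fun i hi => ?_
    have hi := mem_range.1 hi
    simp only [sum_pow_add d (a m) (y m)]
    rw [mul_sum]
    refine sum_congr rfl fun v hv => ?_
    have hv := mem_range.1 hv
    rw [mon_add_mul_self y hi hv, ev_succ, mul_assoc]
    congr 2
    refine sum_congr rfl fun u hu => ?_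
    have hu := mem_range.1 hu
    simp only [ev, sum_mul, mul_sum]
    refine sum_congr rfl fun k hk => ?_
    have hk := mem_range.1 hk
    simp only [hasse, tayCoef_add_mul_self hi hk hu hv]
    have : k + d ^ m * u + (i + d ^ m * v) = k + i + d ^ m * (u + v) := by ring
    rw [this]
    ring

theorem pow_digSum_dvd_mon {d m i q : ℕ} {y : ℕ → ℕ} (hy : ∀ j < m, q ∣ y j) :
    q ^ digSum d m i ∣ mon d m i y := by
  rw [digSum, ← prod_pow_eq_pow_sum]
  exact prod_dvd_prod_of_dvd _ _ fun j hj => pow_dvd_pow_of_dvd (hy j (mem_range.1 hj)) _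

/-- Modulo `q ^ (m + 1)`, only the Hasse derivatives of order at most `m` matter in the Taylor
expansion around the residues of the coordinates modulo `q`. -/
theorem sum_hasse_modEq (d m q : ℕ) (F A : ℕ → ℕ) :
    (∑ i ∈ range (d ^ m), if digSum d m i ≤ m then
      mon d m i (fun j => A j - A j % q) *
        ev d m (fun k => hasse d m i F k % q ^ (m + 1)) (fun j => A j % q) else 0) ≡
      ev d m F A [MOD q ^ (m + 1)] := by
  have hA : A = fun j => A j % q + (A j - A j % q) := by
    ext j; have := Nat.mod_le (A j) q; omega
  conv_rhs => rw [hA, ev_add]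
  simp only [← ZMod.natCast_eq_natCast_iff]
  push_cast
  refine sum_congr rfl fun i _ => ?_
  split_ifs with h
  · congr 1
    rw [ZMod.natCast_eq_natCast_iff]
    exact ev_modEq (fun k _ => Nat.mod_modEq _ _) fun _ _ => rfl
  · rw [(ZMod.natCast_eq_zero_iff _ _).2, zero_mul]
    refine (pow_dvd_pow q (by omega : m + 1 ≤ digSum d m i)).trans
      (pow_digSum_dvd_mon fun j _ => ?_)
    exact Nat.dvd_sub_mod _

/-- There are few multi-indices of small order, regardless of `d`. -/
theorem card_digSum_le (d m t : ℕ) :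
    #{i ∈ range (d ^ m) | digSum d m i ≤ t} ≤ 2 ^ (m + t) := by
  induction m generalizing t with
  | zero => simpa using (card_filter_le _ _).trans (by simpa using Nat.one_le_two_pow)
  | succ m ih =>
    rw [card_filter, pow_succ, sum_range_mul]
    have h1 : ∀ u ∈ range d, (∑ k ∈ range (d ^ m),
        if digSum d (m + 1) (k + d ^ m * u) ≤ t then 1 else 0) ≤
        if u ≤ t then 2 ^ (m + (t - u)) else 0 := by
      intro u hu
      have h2 : ∀ k ∈ range (d ^ m), digSum d (m + 1) (k + d ^ m * u) = digSum d m k + u := by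
        intro k hk
        rw [digSum, sum_range_succ, dig_add_mul_self (mem_range.1 hk) (mem_range.1 hu)]
        congr 1
        exact sum_congr rfl fun j hj => by rw [dig_add_mul_of_lt _ _ (mem_range.1 hj)]
      rw [sum_congr rfl fun k hk => by rw [h2 k hk]]
      split_ifs with hut
      · refine le_trans (le_of_eq ?_) (ih (t - u))
        rw [card_filter]
        exact sum_congr rfl fun k _ => by congr 1; simp only [eq_iff_iff]; omega
      · exact le_of_eq (sum_eq_zero fun k _ => if_neg (by omega))
    refine (sum_le_sum h1).trans ?_
    rw [← sum_filter]
    calc ∑ u ∈ range d with u ≤ t, 2 ^ (m + (t - u))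
        ≤ ∑ u ∈ range (t + 1), 2 ^ (m + (t - u)) := by
          refine sum_le_sum_of_subset fun u hu => ?_
          simp only [mem_filter, mem_range] at hu ⊢
          omega
      _ = 2 ^ m * ∑ u ∈ range (t + 1), 2 ^ (t + 1 - 1 - u) := by
          rw [mul_sum]; exact sum_congr rfl fun u _ => by rw [pow_add]; rfl
      _ ≤ 2 ^ (m + 1 + t) := by
          rw [sum_range_reflect (fun u => 2 ^ u), Nat.geomSum_eq le_rfl]
          have : 2 ^ (m + 1 + t) = 2 ^ m * 2 ^ (t + 1) := by ring
          rw [this]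
          exact Nat.mul_le_mul_left _ ((Nat.div_le_self _ _).trans (Nat.sub_le _ _))

/-! ### Chinese remainders, primorials and tables -/

/-- One digit of the Chinese remainder theorem: `v` plus `f` times `W * q ^ j` is the residue of
`x` modulo `W * q ^ (j + 1)`, and `f` is a base `q` digit; it is `0` if and only if `v` is already
correct modulo `q ^ (j + 1)`. -/
theorem crt_digit {x W q j f v : ℕ} (hq : 0 < q) (hc : q.Coprime W) (hf : f < q)
    (h : v + f * (W * q ^ j) = x % (W * q ^ (j + 1))) :
    v % q ^ (j + 1) = x % q ^ (j + 1) ↔ f = 0 := by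
  have h1 : v + f * (W * q ^ j) ≡ x [MOD q ^ (j + 1)] := by
    rw [h]
    exact Nat.mod_mod_of_dvd _ (Dvd.intro_left _ rfl)
  constructor
  · intro hv
    have h2 : q ^ (j + 1) ∣ f * (W * q ^ j) := by
      have : v + f * (W * q ^ j) ≡ v + 0 [MOD q ^ (j + 1)] := h1.trans (Eq.symm hv)
      exact (Nat.modEq_zero_iff_dvd).1 (Nat.ModEq.add_left_cancel' v this)
    have h3 : q ^ j * q ∣ q ^ j * (W * f) := by
      convert h2 using 1 <;> ring
    have h4 := hc.dvd_of_dvd_mul_left (Nat.dvd_of_mul_dvd_mul_left (by positivity) h3)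
    exact Nat.eq_zero_of_dvd_of_lt h4 hf
  · rintro rfl
    rw [zero_mul, add_zero] at h1
    exact h1

theorem primorial_succ_of_prime {q : ℕ} (hq : (q + 1).Prime) :
    primorial (q + 1) = primorial q * (q + 1) := by
  rw [primorial, range_add_one, filter_insert, if_pos hq, prod_insert (by simp), mul_comm]; rfl

theorem primorial_succ_of_not_prime {q : ℕ} (hq : ¬ (q + 1).Prime) :
    primorial (q + 1) = primorial q := by
  rw [primorial, range_add_one, filter_insert, if_neg hq]; rfl

theorem coprime_primorial {q : ℕ} (hq : (q + 1).Prime) : (q + 1).Coprime (primorial q) :=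
  (Nat.Prime.coprime_iff_not_dvd hq).2 fun h => by
    have := hq.dvd_primorial_iff.1 h
    omega

/-- Polynomials evaluated in the first `j` variables at all the points of the grid
`{0, …, B - 1} ^ j`: the low part of the index, below `d ^ (m - j)`, lists the exponents of the
other variables, and the base `B` digits of the high part are the coordinates of the point. -/
def table (d m B : ℕ) (F : ℕ → ℕ) (j idx : ℕ) : ℕ :=
  ev d j (fun k => F (k + d ^ j * (idx % d ^ (m - j)))) (dig B (idx / d ^ (m - j)))

theorem table_zero {d m B idx : ℕ} (F : ℕ → ℕ) (h : idx < d ^ m) : table d m B F 0 idx = F idx := by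
  simp [table, ev_zero, Nat.mod_eq_of_lt h]

theorem table_self (d m B : ℕ) (F : ℕ → ℕ) (idx : ℕ) :
    table d m B F m idx = ev d m F (dig B idx) := by
  simp [table, Nat.mod_one]

/-- The next variable, whose exponent is the lowest digit of the index, is replaced by all the
numbers `h` less than `B`. -/
theorem table_succ {d m B j idx : ℕ} (F : ℕ → ℕ) (hd : 0 < d) (hj : j < m)
    (h : idx < d ^ (m - j - 1) * B ^ j * B) :
    table d m B F (j + 1) idx = ∑ u ∈ range d,
      table d m B F j (u + d * (idx % (d ^ (m - j - 1) * B ^ j))) *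
        (idx / (d ^ (m - j - 1) * B ^ j)) ^ u := by
  have hB : 0 < B := by
    rcases Nat.eq_zero_or_pos B with rfl | hB
    · simp at h
    · exact hB
  obtain ⟨e, rfl⟩ : ∃ e, m = j + 1 + e := ⟨m - j - 1, by omega⟩
  have e1 : j + 1 + e - j - 1 = e := by omega
  have e2 : j + 1 + e - (j + 1) = e := by omega
  have e3 : j + 1 + e - j = e + 1 := by omega
  rw [e1] at h ⊢
  have hde : 0 < d ^ e := by positivity
  -- `k` is the index of the remaining exponents, `G` the point, and `g` its new coordinate
  obtain ⟨k, hk, G, hG, g, hg, rfl⟩ : ∃ k < d ^ e, ∃ G < B ^ j, ∃ g < B,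
      idx = k + d ^ e * (G + B ^ j * g) := by
    refine ⟨idx % d ^ e, Nat.mod_lt _ hde, idx / d ^ e % B ^ j, Nat.mod_lt _ (by positivity),
      idx / d ^ e / B ^ j, ?_, ?_⟩
    · rw [Nat.div_div_eq_div_mul, Nat.div_lt_iff_lt_mul (by positivity), mul_comm]
      exact h
    · rw [Nat.mod_add_div, Nat.mod_add_div]
  have hy : k + d ^ e * G < d ^ e * B ^ j := by
    calc k + d ^ e * G < d ^ e * (G + 1) := by rw [mul_add_one]; omega
      _ ≤ _ := Nat.mul_le_mul_left _ hG
  have e4 : k + d ^ e * (G + B ^ j * g) = k + d ^ e * G + d ^ e * B ^ j * g := by ring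
  have e5 : (k + d ^ e * (G + B ^ j * g)) % (d ^ e * B ^ j) = k + d ^ e * G := by
    rw [e4, Nat.add_mul_mod_self_left, Nat.mod_eq_of_lt hy]
  have e6 : (k + d ^ e * (G + B ^ j * g)) / (d ^ e * B ^ j) = g := by
    rw [e4, Nat.add_mul_div_left _ _ (by positivity), Nat.div_eq_of_lt hy, zero_add]
  rw [e5, e6, table, ev_succ, e2, Nat.add_mul_mod_self_left, Nat.mod_eq_of_lt hk,
    Nat.add_mul_div_left _ _ hde, Nat.div_eq_of_lt hk, zero_add]
  refine sum_congr rfl fun u hu => ?_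
  have hu := mem_range.1 hu
  have e7 : u + d * (k + d ^ e * G) = u + d * k + d ^ (e + 1) * G := by ring
  have h8 : u + d * k < d ^ (e + 1) := by
    calc u + d * k < d * (k + 1) := by rw [mul_add_one]; omega
      _ ≤ d * d ^ e := Nat.mul_le_mul_left _ hk
      _ = _ := by ring
  rw [dig_add_mul_self hG hg, table, e3, e7, Nat.add_mul_mod_self_left, Nat.mod_eq_of_lt h8,
    Nat.add_mul_div_left _ _ (by positivity), Nat.div_eq_of_lt h8, zero_add]
  congr 1
  refine ev_congr (fun k' _ => ?_) fun t ht => dig_add_mul_of_lt _ _ ht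
  congr 1
  ring

/-- Evaluation over `ℤ/rℤ` reduces to evaluation of natural number polynomials at natural number
points. -/
theorem eval_val {r m d : ℕ} (hr : 0 < r) (f : MvPolynomial (Fin m) (ZMod r))
    (hf : ∀ i, f.degreeOf i < d) (a : Fin m → ZMod r) {F A : ℕ → ℕ}
    (hF : ∀ k < d ^ m, F k = (f.coeff (exponent d m k)).val)
    (hA : ∀ j : Fin m, A j = (a j).val) :
    (MvPolynomial.eval a f).val = ev d m F A % r := by
  have : NeZero r := ⟨hr.ne'⟩
  have key : MvPolynomial.eval a f = ((ev d m F A : ℕ) : ZMod r) := by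
    rw [MvPolynomial.eval_eq', ev]
    push_cast
    let g : (Fin m →₀ ℕ) → ZMod r := fun e => f.coeff e * ∏ i, a i ^ e i
    have h1 : ∀ k ∈ range (d ^ m), ((F k : ZMod r) * ∏ j ∈ range m, (A j : ZMod r) ^ dig d k j) =
        g (exponent d m k) := by
      intro k hk
      rw [hF k (mem_range.1 hk), ZMod.natCast_zmod_val, prod_range]
      simp only [g, hA, ZMod.natCast_zmod_val]
      rfl
    rw [sum_congr rfl h1, sum_range (fun k => g (exponent d m k)),
      ← finFunctionFinEquiv.sum_comp]
    have h2 : ∀ e : Fin m → Fin d, exponent d m (finFunctionFinEquiv e) =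
        Finsupp.equivFunOnFinite.symm fun i => (e i : ℕ) := by
      intro e
      refine congrArg _ (funext fun i => ?_)
      have := congrArg (fun z => (z i : ℕ)) (finFunctionFinEquiv.symm_apply_apply e)
      simpa [finFunctionFinEquiv] using this
    simp only [h2]
    have hinj : Function.Injective fun e : Fin m → Fin d =>
        (Finsupp.equivFunOnFinite.symm fun i => (e i : ℕ) : Fin m →₀ ℕ) := by
      intro e e' h
      ext i
      exact congrArg (fun z : Fin m →₀ ℕ => z i) h
    rw [← sum_image (f := g) (s := univ) (g := fun e : Fin m → Fin d =>
        (Finsupp.equivFunOnFinite.symm fun i => (e i : ℕ) : Fin m →₀ ℕ)) (hinj.injOn)]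
    refine sum_subset (fun e he => ?_) fun e _ he => ?_
    · rw [mem_image]
      refine ⟨fun i => ⟨e i, lt_of_le_of_lt (MvPolynomial.degreeOf_le_iff.1 le_rfl e he) (hf i)⟩,
        mem_univ _, ?_⟩
      ext i
      rfl
    · simp only [MvPolynomial.notMem_support_iff.1 he, zero_mul]
  rw [key, ZMod.val_natCast]

end MultipointEval

/-! ### The arithmetic subroutines -/

namespace RAM

open MultipointEval RAM.Expr Finset

infixr:60 " ;; " => Prog.seq

theorem Prog.Fr.seq {P R : Prog} {s s' s'' : Store} (h : P.Fr s s') (h' : R.Fr s' s'') :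
    (P ;; R).Fr s s'' :=
  (h.mono (fun _ => Or.inl) fun _ => Or.inl).trans (h'.mono (fun _ => Or.inr) fun _ => Or.inr)

variable {U n N m d o : ℕ} {s : Store} {Q : Store → Prop}

/-- Register `x` receives the power of register `b` with exponent `e`; register `c` counts. -/
def powP (x b : ℕ) (e : Expr) (c : ℕ) : Prog :=
  .set x 1 ;; forP c e (.set x (reg x * reg b))

theorem powP_spec {x b c : ℕ} {e : Expr} (hxb : x ≠ b) (hxc : c ≠ x) (hbc : c ≠ b)
    (he : ∀ s', (powP x b e c).Fr s s' → e.val s' = n) (hb : 1 ≤ s.reg b) (hn : n ≤ U)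
    (hU : s.reg b ^ n ≤ U) :
    WP U (powP x b e c) s (fun s' => s'.reg x = s.reg b ^ n) (n * 3 + 3) := by
  have hU' : ∀ k ≤ n, s.reg b ^ k ≤ U := fun k hk => (Nat.pow_le_pow_right hb hk).trans hU
  refine WP.le (WP.set_seq (by simpa using hU' 0 (Nat.zero_le _))
    (WP.for (fun k s' => s'.reg x = s.reg b ^ k) n 1 (by simpa using hxc) hn ?_ ?_ ?_ ?_ ?_))
    (by omega)
  · intro s' hf
    refine he s' (Prog.Fr.seq (s' := s.setReg x 1) ⟨fun y hy => ?_, fun _ _ => rfl⟩ hf)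
    rw [setReg_reg, if_neg (by simpa using hy)]
  · intro k s' v h
    simpa [hxc.symm] using h
  · simp
  · intro k s' hk hs hf hi h
    have h1 : s'.reg b = s.reg b := by
      rw [hf.1 b (by simp; tauto), setReg_reg, if_neg hxb.symm]
    have h2 : s'.reg x * s'.reg b = s.reg b ^ (k + 1) := by rw [h, h1, pow_succ]
    refine WP.set ?_ ?_
    · simpa [h2] using hU' (k + 1) hk
    · simpa using h2
  · intro s' _ _ h
    exact h

/-- Register `o + 17` receives the digit sum of register `o + 16`. -/
def digSumP (o : ℕ) : Prog :=
  .set (o + 17) 0 ;; .set (o + 19) (reg (o + 16)) ;;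
  forP (o + 18) (reg 1)
    (.set (o + 17) (reg (o + 17) + reg (o + 19) % reg 2) ;;
     .set (o + 19) (reg (o + 19) / reg 2))

theorem digSumP_spec (h1 : s.reg 1 = m) (h2 : s.reg 2 = d) (hd : 0 < d) (hm : m * d ≤ U) :
    WP U (digSumP o) s (fun s' => s'.reg (o + 17) = digSum d m (s.reg (o + 16))) (m * 4 + 4) := by
  have hmU : m ≤ U := (Nat.le_mul_of_pos_right m hd).trans hm
  refine WP.of_bd fun hs => WP.le (WP.set_seq (by simp) (WP.set_seq (by simpa using hs.1 _)
    (WP.for (fun k s' => s'.reg (o + 17) = digSum d k (s.reg (o + 16)) ∧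
      s'.reg (o + 19) = s.reg (o + 16) / d ^ k) m 2 (by simp) hmU ?_ ?_ ?_ ?_ ?_)))
    (by omega)
  · intro s' hf
    simpa [h1] using hf.1 1 (by simp)
  · intro k s' v h
    simpa using h
  · simp [digSum]
  · rintro k s' hk hs hf hi ⟨ha, hb⟩
    have e2 : s'.reg 2 = d := by simpa [h2] using hf.1 2 (by simp)
    have h3 : s'.reg (o + 17) + s'.reg (o + 19) % s'.reg 2 = digSum d (k + 1) (s.reg (o + 16)) := by
      rw [ha, hb, e2, digSum, digSum, sum_range_succ, dig]
    have h4 : digSum d (k + 1) (s.reg (o + 16)) ≤ U := by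
      calc digSum d (k + 1) (s.reg (o + 16)) ≤ ∑ j ∈ range (k + 1), d :=
            sum_le_sum fun j _ => (dig_lt hd _ _).le
        _ ≤ m * d := by simpa using Nat.mul_le_mul_right d hk
        _ ≤ U := hm
    refine WP.set_seq (by simpa [h3] using h4) (WP.set ?_ ?_)
    · simpa using (Nat.div_le_self _ _).trans (hs.1 _)
    · simp [← h3, hb, e2, Nat.div_div_eq_div_mul, pow_succ]
  · rintro s' _ _ ⟨h, -⟩
    exact h

/-- Register `o + 24` receives the binomial coefficient of `u + v` over `v`, where `u` and `v` are
the contents of registers `o + 22` and `o + 23`. -/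
def binomP (o : ℕ) : Prog :=
  .set (o + 24) 1 ;;
  forP (o + 25) (reg (o + 23))
    (.set (o + 24) (reg (o + 24) * (reg (o + 22) + reg (o + 25) + 1) / (reg (o + 25) + 1)))

theorem binomP_spec (hd : s.reg (o + 22) + s.reg (o + 23) < d) (hU : 2 ^ d ≤ U) :
    WP U (binomP o) s (fun s' => s'.reg (o + 24) =
      (s.reg (o + 22) + s.reg (o + 23)).choose (s.reg (o + 23))) (d * 3 + 3) := by
  have hdU : d ≤ U := Nat.lt_two_pow_self.le.trans hU
  refine WP.le (WP.set_seq (by simpa using Nat.one_le_two_pow.trans hU)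
    (WP.for (fun k s' => s'.reg (o + 24) = (s.reg (o + 22) + k).choose k)
      (s.reg (o + 23)) 1 (by simp) (by omega) ?_ ?_ ?_ ?_ ?_))
    (by omega)
  · intro s' hf
    simpa using hf.1 (o + 23) (by simp)
  · intro k s' v h
    simpa using h
  · simp
  · rintro k s' hk hs hf hi ha
    have e2 : s'.reg (o + 22) = s.reg (o + 22) := by simpa using hf.1 (o + 22) (by simp)
    have h3 : s'.reg (o + 24) * (s'.reg (o + 22) + s'.reg (o + 25) + 1) / (s'.reg (o + 25) + 1) =
        (s.reg (o + 22) + (k + 1)).choose (k + 1) := by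
      rw [ha, e2, hi]
      refine Nat.div_eq_of_eq_mul_left (by omega) ?_
      rw [mul_comm, ← add_assoc]
      exact Nat.add_one_mul_choose_eq _ _
    have h4 : (s.reg (o + 22) + (k + 1)).choose (k + 1) ≤ U :=
      (Nat.choose_le_two_pow _ _).trans
        ((Nat.pow_le_pow_right (by norm_num) (by omega)).trans hU)
    exact WP.set (by simpa [h3] using h4) (by simpa using h3)
  · rintro s' _ _ h
    exact h

/-- Register `o + 21` is multiplied, modulo register `o + 15`, by `tayDig d u v`, where `u` and `v`
are the contents of registers `o + 22` and `o + 23`. -/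
def tayDigP (o : ℕ) : Prog :=
  .cond (reg 2 - (reg (o + 22) + reg (o + 23)))
    (binomP o ;; .set (o + 21) (reg (o + 21) * reg (o + 24) % reg (o + 15)))
    (.set (o + 21) 0)

theorem tayDigP_spec (h2 : s.reg 2 = d) (hU : 2 ^ d ≤ U) (hE : 0 < s.reg (o + 15)) :
    WP U (tayDigP o) s (fun s' => s'.reg (o + 21) ≡
      s.reg (o + 21) * tayDig d (s.reg (o + 22)) (s.reg (o + 23)) [MOD s.reg (o + 15)])
      (d * 3 + 5) := by
  refine WP.le (n := 1 + (d * 3 + 3 + 1)) (WP.cond (fun hne => ?_) fun he => ?_) (by omega)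
  · simp only [val_sub, val_add, val_reg, h2] at hne
    refine WP.seq (binomP_spec (d := d) (by omega) hU) fun s' hs' hf h' => ?_
    have f21 : s'.reg (o + 21) = s.reg (o + 21) := hf.1 (o + 21) (by simp [binomP])
    have f15 : s'.reg (o + 15) = s.reg (o + 15) := hf.1 (o + 15) (by simp [binomP])
    refine WP.set ?_ ?_
    · simpa [f15] using (Nat.mod_lt _ hE).le.trans (by simpa [f15] using hs'.1 (o + 15))
    · simp only [val_mod, val_mul, val_reg, setReg_reg, if_true, f21, f15, h', tayDig]
      rw [if_pos (by omega)]
      exact Nat.mod_modEq _ _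
  · simp only [val_sub, val_add, val_reg, h2] at he
    refine WP.le (WP.set (by simp) ?_) (by omega : 1 ≤ _)
    rw [tayDig, if_neg (by omega), mul_zero]
    simpa using Nat.ModEq.refl _

/-- Register `o + 21` receives, modulo register `o + 15`, the number `tayCoef d m i k`, where `i`
and `k` are the contents of registers `o + 16` and `o + 26`. -/
def tayCoefP (o : ℕ) : Prog :=
  .set (o + 21) 1 ;; .set (o + 19) (reg (o + 26)) ;; .set (o + 20) (reg (o + 16)) ;;
  forP (o + 18) (reg 1)
    (.set (o + 22) (reg (o + 19) % reg 2) ;; .set (o + 23) (reg (o + 20) % reg 2) ;;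
     tayDigP o ;;
     .set (o + 19) (reg (o + 19) / reg 2) ;; .set (o + 20) (reg (o + 20) / reg 2))

theorem tayCoefP_spec (h1 : s.reg 1 = m) (h2 : s.reg 2 = d) (hm : m ≤ U)
    (hU : 2 ^ d ≤ U) (hE : 0 < s.reg (o + 15)) :
    WP U (tayCoefP o) s (fun s' => s'.reg (o + 21) ≡
      tayCoef d m (s.reg (o + 16)) (s.reg (o + 26)) [MOD s.reg (o + 15)])
      (m * (d * 3 + 11) + 5) := by
  refine WP.of_bd fun hs => WP.le (WP.set_seq (by simpa using Nat.one_le_two_pow.trans hU)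
    (WP.set_seq (by simpa using hs.1 _) (WP.set_seq (by simpa using hs.1 _)
    (WP.for (fun k s' => s'.reg (o + 21) ≡
        tayCoef d k (s.reg (o + 16)) (s.reg (o + 26)) [MOD s.reg (o + 15)] ∧
      s'.reg (o + 19) = s.reg (o + 26) / d ^ k ∧ s'.reg (o + 20) = s.reg (o + 16) / d ^ k)
      m (d * 3 + 9) (by simp [tayDigP, binomP]) hm ?_ ?_ ?_ ?_ ?_))))
    (by ring_nf; omega)
  · intro s' hf
    simpa [h1] using hf.1 1 (by simp [tayDigP, binomP])
  · intro k s' v h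
    simpa using h
  · simpa [tayCoef] using Nat.ModEq.refl _
  · rintro k s' hk hs hf hi ⟨ha, hb, hc⟩
    have e2 : s'.reg 2 = d := by simpa [h2] using hf.1 2 (by simp [tayDigP, binomP])
    have e15 : s'.reg (o + 15) = s.reg (o + 15) := by
      simpa using hf.1 (o + 15) (by simp [tayDigP, binomP])
    refine WP.le (n := 1 + (1 + (d * 3 + 5 + (1 + 1)))) (WP.set_seq ?_ (WP.set_seq ?_
      (WP.seq (tayDigP_spec (d := d) (by simpa using e2) hU ?_) ?_))) (by omega)
    · simpa using (Nat.mod_le _ _).trans (hs.1 _)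
    · simpa using (Nat.mod_le _ _).trans (hs.1 _)
    · simpa [e15] using hE
    · intro s'' hs'' hf'' h''
      have f2 : s''.reg 2 = d := by simpa [e2] using hf''.1 2 (by simp [tayDigP, binomP])
      have f19 : s''.reg (o + 19) = s'.reg (o + 19) := by
        simpa using hf''.1 (o + 19) (by simp [tayDigP, binomP])
      have f20 : s''.reg (o + 20) = s'.reg (o + 20) := by
        simpa using hf''.1 (o + 20) (by simp [tayDigP, binomP])
      simp only [val_reg, val_mod, setReg_reg] at h''
      simp [hb, hc, e2, e15] at h''
      refine WP.set_seq ?_ (WP.set ?_ ⟨?_, ?_⟩)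
      · simpa using (Nat.div_le_self _ _).trans (hs''.1 _)
      · simpa using (Nat.div_le_self _ _).trans (hs''.1 _)
      · simp only [setReg_reg]
        simp
        refine h''.trans ?_
        rw [tayCoef, prod_range_succ]
        exact Nat.ModEq.mul_right _ ha
      · simp [f2, f19, f20, hb, hc, Nat.div_div_eq_div_mul, pow_succ]
  · rintro s' _ _ ⟨h, -⟩
    exact h

/-! ### Taylor expansion modulo a prime power -/

/-- Bank `o + 50` receives, modulo register `o + 15`, the coefficients of the Hasse derivative,
with the multi-index in register `o + 16`, of the polynomial in bank `o`. -/
def hasseP (o : ℕ) : Prog :=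
  forP (o + 26) (reg 4)
    (tayCoefP o ;;
     .write (o + 50) (reg (o + 26))
       (reg (o + 21) * read o (reg (o + 26) + reg (o + 16)) % reg (o + 15)))

theorem hasseP_spec (h1 : s.reg 1 = m) (h2 : s.reg 2 = d) (h4 : s.reg 4 = d ^ m) (hm : m ≤ U)
    (hU : 2 ^ d ≤ U) (hE : 0 < s.reg (o + 15)) :
    WP U (hasseP o) s (fun s' => ∀ k < d ^ m, s'.mem (o + 50) k =
      hasse d m (s.reg (o + 16)) (s.mem o) k % s.reg (o + 15))
      (d ^ m * (m * (d * 3 + 11) + 8) + 2) := by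
  refine WP.of_bd fun hs => WP.le (WP.for (fun k s' => ∀ k' < k, s'.mem (o + 50) k' =
      hasse d m (s.reg (o + 16)) (s.mem o) k' % s.reg (o + 15))
      (d ^ m) (m * (d * 3 + 11) + 5 + 1) (by simp [tayCoefP, tayDigP, binomP])
      (h4 ▸ hs.1 4) ?_ ?_ ?_ ?_ ?_) (by ring_nf; omega)
  · intro s' hf
    simpa [h4] using hf.1 4 (by simp [tayCoefP, tayDigP, binomP])
  · intro k s' v h
    simpa using h
  · simp
  · intro k s' hk hs hf hi ha
    have e1 : s'.reg 1 = m := by rw [hf.1 1 (by simp [tayCoefP, tayDigP, binomP]), h1]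
    have e2 : s'.reg 2 = d := by rw [hf.1 2 (by simp [tayCoefP, tayDigP, binomP]), h2]
    have e15 := hf.1 (o + 15) (by simp [tayCoefP, tayDigP, binomP])
    have e16 := hf.1 (o + 16) (by simp [tayCoefP, tayDigP, binomP])
    have em := hf.2 o (by simp [tayCoefP, tayDigP, binomP])
    refine WP.seq (tayCoefP_spec e1 e2 hm hU (e15 ▸ hE)) fun s'' hs'' hf'' h'' => ?_
    have f15 := hf''.1 (o + 15) (by simp [tayCoefP, tayDigP, binomP])
    have f16 := hf''.1 (o + 16) (by simp [tayCoefP, tayDigP, binomP])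
    have f26 := hf''.1 (o + 26) (by simp [tayCoefP, tayDigP, binomP])
    have fm := hf''.2 o (by simp [tayCoefP, tayDigP, binomP])
    have fm' := hf''.2 (o + 50) (by simp [tayCoefP, tayDigP, binomP])
    rw [e16, hi, e15] at h''
    refine WP.write ?_ ?_
    · have := hs''.1 (o + 15)
      simp only [val_mod, val_mul, val_reg, val_read, val_add]
      refine le_trans (Nat.mod_lt _ ?_).le this
      rwa [f15, e15]
    · intro k' hk'
      simp only [val_mod, val_mul, val_reg, val_read, val_add, setMem_mem, f15, f16, f26, fm, e15,
        e16, em, hi, true_and, fm']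
      split_ifs with h
      · subst h
        exact Nat.ModEq.mul_right _ h''
      · exact ha k' (by omega)
  · intro s' _ _ h
    exact h

/-- Bank `o + 51` receives the coordinates in bank `o + 1` modulo register `o + 13`. -/
def pointsP (o : ℕ) : Prog :=
  forP (o + 26) (reg 3 * reg 1)
    (.write (o + 51) (reg (o + 26)) (read (o + 1) (reg (o + 26)) % reg (o + 13)))

theorem pointsP_spec (h1 : s.reg 1 = m) (h3 : s.reg 3 = N) (hU : N * m ≤ U) :
    WP U (pointsP o) s (fun s' => ∀ k < N * m, s'.mem (o + 51) k =
      s.mem (o + 1) k % s.reg (o + 13)) (N * m * 3 + 2) := by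
  refine WP.le (WP.for (fun k s' => ∀ k' < k, s'.mem (o + 51) k' =
      s.mem (o + 1) k' % s.reg (o + 13)) (N * m) 1 (by simp) hU ?_ ?_ ?_ ?_ ?_) (by omega)
  · intro s' hf
    rw [val_mul, val_reg, val_reg, hf.1 3 (by simp), hf.1 1 (by simp), h3, h1]
  · intro k s' v h
    simpa using h
  · simp
  · intro k s' hk hs hf hi ha
    have e13 := hf.1 (o + 13) (by simp)
    have em := hf.2 (o + 1) (by simp)
    refine WP.write ?_ ?_
    · exact (Nat.mod_le _ _).trans (hs.2 _ _)
    · intro k' hk'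
      simp only [val_mod, val_reg, val_read, setMem_mem, e13, em, hi, true_and]
      split_ifs with h
      · rw [h]
      · exact ha k' (by omega)
  · intro s' _ _ h
    exact h

/-- The first `N` cells of bank `b` are set to zero. -/
def clearP (o b : ℕ) : Prog := forP (o + 26) (reg 3) (.write b (reg (o + 26)) 0)

theorem clearP_spec {b : ℕ} (h3 : s.reg 3 = N) :
    WP U (clearP o b) s (fun s' => ∀ k < N, s'.mem b k = 0) (N * 3 + 2) := by
  refine WP.of_bd fun hs => WP.le (WP.for (fun k s' => ∀ k' < k, s'.mem b k' = 0) N 1 (by simp)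
    (h3 ▸ hs.1 3) ?_ ?_ ?_ ?_ ?_) (by omega)
  · intro s' hf
    rw [val_reg, hf.1 3 (by simp), h3]
  · intro k s' v h
    simpa using h
  · simp
  · intro k s' hk hs hf hi ha
    refine WP.write (by simp) ?_
    intro k' hk'
    simp only [setMem_mem, val_reg, hi, val_zero, true_and]
    split_ifs with h
    · rfl
    · exact ha k' (by omega)
  · intro s' _ _ h
    exact h

/-- Register `o + 27` is multiplied, modulo register `o + 15`, by the power of register `o + 22`
with exponent the last digit of register `o + 20`. -/
def mulPowP (o : ℕ) : Prog :=
  forP (o + 25) (reg (o + 20) % reg 2) (.set (o + 27) (reg (o + 27) * reg (o + 22) % reg (o + 15)))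

theorem mulPowP_spec (h2 : s.reg 2 = d) (hd : 0 < d) (hE : 0 < s.reg (o + 15)) :
    WP U (mulPowP o) s (fun s' => s'.reg (o + 27) ≡
      s.reg (o + 27) * s.reg (o + 22) ^ (s.reg (o + 20) % d) [MOD s.reg (o + 15)])
      (d * 3 + 2) := by
  have hlt := Nat.mod_lt (s.reg (o + 20)) hd
  refine WP.of_bd fun hs => WP.le (WP.for (fun k s' => s'.reg (o + 27) ≡
      s.reg (o + 27) * s.reg (o + 22) ^ k [MOD s.reg (o + 15)])
      (s.reg (o + 20) % d) 1 (by simp) ((Nat.mod_le _ _).trans (hs.1 _)) ?_ ?_ ?_ ?_ ?_) (by omega)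
  · intro s' hf
    rw [val_mod, val_reg, val_reg, hf.1 (o + 20) (by simp), hf.1 2 (by simp), h2]
  · intro k s' v h
    simpa using h
  · simpa using Nat.ModEq.refl _
  · intro k s' hk hs hf hi ha
    have e15 := hf.1 (o + 15) (by simp)
    have e22 := hf.1 (o + 22) (by simp)
    refine WP.set ?_ ?_
    · simp only [val_mod, val_reg]
      exact (Nat.mod_lt _ (e15 ▸ hE)).le.trans (hs.1 (o + 15))
    · simp only [val_mod, val_reg, val_mul, setReg_reg, if_true, e15, e22]
      refine (Nat.mod_modEq _ _).trans ?_
      rw [pow_succ, ← mul_assoc]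
      exact ha.mul_right _
  · intro s' _ _ h
    exact h

/-- Register `o + 27` is multiplied, modulo register `o + 15`, by the monomial with multi-index in
register `o + 16`, evaluated at the point with number in register `o + 26` rounded down to
multiples of register `o + 13`. -/
def monP (o : ℕ) : Prog :=
  .set (o + 20) (reg (o + 16)) ;;
  forP (o + 18) (reg 1)
    (.set (o + 22) (read (o + 1) (reg (o + 26) * reg 1 + reg (o + 18))) ;;
     .set (o + 22) (reg (o + 22) - reg (o + 22) % reg (o + 13)) ;;
     mulPowP o ;;
     .set (o + 20) (reg (o + 20) / reg 2))

theorem monP_spec (h1 : s.reg 1 = m) (h2 : s.reg 2 = d) (hd : 0 < d) (hE : 0 < s.reg (o + 15)) :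
    WP U (monP o) s (fun s' => s'.reg (o + 27) ≡
      s.reg (o + 27) * mon d m (s.reg (o + 16)) (fun j => s.mem (o + 1) (s.reg (o + 26) * m + j) -
        s.mem (o + 1) (s.reg (o + 26) * m + j) % s.reg (o + 13)) [MOD s.reg (o + 15)])
      (m * (d * 3 + 7) + 3) := by
  refine WP.of_bd fun hs => WP.le (WP.set_seq (by simpa using hs.1 _)
    (WP.for (fun k s' => s'.reg (o + 20) = s.reg (o + 16) / d ^ k ∧ s'.reg (o + 27) ≡
      s.reg (o + 27) * mon d k (s.reg (o + 16)) (fun j => s.mem (o + 1) (s.reg (o + 26) * m + j) -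
        s.mem (o + 1) (s.reg (o + 26) * m + j) % s.reg (o + 13)) [MOD s.reg (o + 15)])
      m (1 + (1 + (d * 3 + 2 + 1))) (by simp [mulPowP]) (h1 ▸ hs.1 1) ?_ ?_ ?_ ?_ ?_))
      (by ring_nf; omega)
  · intro s' hf
    simpa [h1] using hf.1 1 (by simp [mulPowP])
  · intro k s' v h
    simpa using h
  · simpa [mon] using Nat.ModEq.refl _
  · rintro k s' hk hs hf hi ⟨ha, hb⟩
    have e1 : s'.reg 1 = m := by simpa [h1] using hf.1 1 (by simp [mulPowP])
    have e2 : s'.reg 2 = d := by simpa [h2] using hf.1 2 (by simp [mulPowP])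
    have e13 : s'.reg (o + 13) = s.reg (o + 13) := by simpa using hf.1 (o + 13) (by simp [mulPowP])
    have e15 : s'.reg (o + 15) = s.reg (o + 15) := by simpa using hf.1 (o + 15) (by simp [mulPowP])
    have e26 : s'.reg (o + 26) = s.reg (o + 26) := by simpa using hf.1 (o + 26) (by simp [mulPowP])
    have em : s'.mem (o + 1) = s.mem (o + 1) := by simpa using hf.2 (o + 1) (by simp [mulPowP])
    refine WP.set_seq ?_ (WP.set_seq ?_ (WP.seq (mulPowP_spec (d := d) (by simpa using e2) hd
      (by simpa [e15] using hE)) ?_))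
    · simpa using hs.2 _ _
    · simpa using (Nat.sub_le _ _).trans (hs.2 _ _)
    · intro s'' hs'' hf'' h''
      have f2 : s''.reg 2 = d := by simpa [e2] using hf''.1 2 (by simp [mulPowP])
      have f20 : s''.reg (o + 20) = s'.reg (o + 20) := by
        simpa using hf''.1 (o + 20) (by simp [mulPowP])
      simp [e1, e13, e15, e26, em, hi, ha] at h''
      refine WP.set ?_ ⟨?_, ?_⟩
      · simpa using (Nat.div_le_self _ _).trans (hs''.1 _)
      · simp [f2, f20, ha, Nat.div_div_eq_div_mul, pow_succ]
      · simp only [setReg_reg]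
        simp
        refine h''.trans ?_
        rw [mon, prod_range_succ, ← mul_assoc]
        exact Nat.ModEq.mul_right _ hb
  · rintro s' _ _ ⟨-, h⟩
    exact h

/-- The values in bank `o + 52`, multiplied by the monomials that `monP` computes, are added
modulo register `o + 15` to the numbers in bank `o + 3`. -/
def accumP (o : ℕ) : Prog :=
  forP (o + 26) (reg 3)
    (.set (o + 27) (read (o + 52) (reg (o + 26))) ;;
     monP o ;;
     .write (o + 3) (reg (o + 26)) ((read (o + 3) (reg (o + 26)) + reg (o + 27)) % reg (o + 15)))

theorem accumP_spec (h1 : s.reg 1 = m) (h2 : s.reg 2 = d) (h3 : s.reg 3 = N) (hd : 0 < d)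
    (hE : 0 < s.reg (o + 15)) :
    WP U (accumP o) s (fun s' => ∀ n < N, s'.mem (o + 3) n =
      (s.mem (o + 3) n + s.mem (o + 52) n * mon d m (s.reg (o + 16))
        (fun j => s.mem (o + 1) (n * m + j) -
          s.mem (o + 1) (n * m + j) % s.reg (o + 13))) % s.reg (o + 15))
      (N * (m * (d * 3 + 7) + 7) + 2) := by
  refine WP.of_bd fun hs => WP.le (WP.for (fun k s' => (∀ n < k, s'.mem (o + 3) n =
      (s.mem (o + 3) n + s.mem (o + 52) n * mon d m (s.reg (o + 16))
        (fun j => s.mem (o + 1) (n * m + j) -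
          s.mem (o + 1) (n * m + j) % s.reg (o + 13))) % s.reg (o + 15)) ∧
      ∀ n, k ≤ n → s'.mem (o + 3) n = s.mem (o + 3) n)
      N (1 + (m * (d * 3 + 7) + 3 + 1)) (by simp [monP, mulPowP])
      (h3 ▸ hs.1 3) ?_ ?_ ?_ ?_ ?_) (by ring_nf; omega)
  · intro s' hf
    simpa [h3] using hf.1 3 (by simp [monP, mulPowP])
  · intro k s' v h
    simpa using h
  · simp
  · rintro k s' hk hs hf hi ⟨ha, hb⟩
    have e1 : s'.reg 1 = m := by rw [hf.1 1 (by simp [monP, mulPowP]), h1]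
    have e2 : s'.reg 2 = d := by rw [hf.1 2 (by simp [monP, mulPowP]), h2]
    have e13 := hf.1 (o + 13) (by simp [monP, mulPowP])
    have e15 := hf.1 (o + 15) (by simp [monP, mulPowP])
    have e16 := hf.1 (o + 16) (by simp [monP, mulPowP])
    have em := hf.2 (o + 1) (by simp [monP, mulPowP])
    have em' := hf.2 (o + 52) (by simp [monP, mulPowP])
    refine WP.set_seq (by simpa using hs.2 _ _) (WP.seq (monP_spec (m := m) (d := d)
      (by simpa using e1) (by simpa using e2) hd (by simpa [e15] using hE)) ?_)
    intro s'' hs'' hf'' h''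
    have f15 : s''.reg (o + 15) = s.reg (o + 15) := by
      simpa [e15] using hf''.1 (o + 15) (by simp [monP, mulPowP])
    have f26 : s''.reg (o + 26) = k := by
      simpa [hi] using hf''.1 (o + 26) (by simp [monP, mulPowP])
    have fm : s''.mem (o + 3) = s'.mem (o + 3) := by
      simpa using hf''.2 (o + 3) (by simp [monP, mulPowP])
    simp [e13, e15, e16, em, em', hi] at h''
    refine WP.write ?_ ⟨?_, ?_⟩
    · simp only [val_mod, val_reg]
      exact (Nat.mod_lt _ (f15 ▸ hE)).le.trans (hs''.1 (o + 15))
    · intro n hn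
      simp only [val_mod, val_reg, val_read, val_add, setMem_mem, f15, f26, fm, true_and]
      split_ifs with h
      · subst h
        rw [hb n le_rfl]
        exact Nat.ModEq.add_left _ h''
      · exact ha n (by omega)
    · intro n hn
      simp only [val_mod, val_reg, val_read, val_add, setMem_mem, f15, f26, fm, true_and]
      rw [if_neg (by omega), hb n (by omega)]
  · rintro s' _ _ ⟨h, -⟩
    exact h

/-! ### Chinese remaindering -/

/-- One more digit, in base register `o + 13`, of the number in register `o + 27`, which is to
agree with register `o + 22`. Register `o + 28` is the place value of the digit, and register
`o + 29` is the power of the base modulo which the two numbers are compared. -/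
def crtDigitP (o : ℕ) : Prog :=
  .set (o + 29) (reg (o + 29) * reg (o + 13)) ;;
  .loop ((reg (o + 27) % reg (o + 29) - reg (o + 22) % reg (o + 29)) +
      (reg (o + 22) % reg (o + 29) - reg (o + 27) % reg (o + 29)))
    (.set (o + 27) (reg (o + 27) + reg (o + 28))) ;;
  .set (o + 28) (reg (o + 28) * reg (o + 13))

theorem crtDigitP_spec {x W q j : ℕ} (hq : 0 < q) (hW : 0 < W) (hc : q.Coprime W)
    (h13 : s.reg (o + 13) = q) (h29 : s.reg (o + 29) = q ^ j) (h28 : s.reg (o + 28) = W * q ^ j)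
    (h27 : s.reg (o + 27) = x % (W * q ^ j))
    (h22 : s.reg (o + 22) % q ^ (j + 1) = x % q ^ (j + 1)) (hU : W * q ^ (j + 1) ≤ U) :
    WP U (crtDigitP o) s (fun s' => s'.reg (o + 29) = q ^ (j + 1) ∧
      s'.reg (o + 28) = W * q ^ (j + 1) ∧ s'.reg (o + 27) = x % (W * q ^ (j + 1)))
      (q * 2 + 3) := by
  have hU' : q ^ (j + 1) ≤ U := (Nat.le_mul_of_pos_left _ hW).trans hU
  have hWq : W * q ^ (j + 1) = W * q ^ j * q := by ring
  have hf0 : x / (W * q ^ j) % q < q := Nat.mod_lt _ hq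
  refine WP.le (n := 1 + (x / (W * q ^ j) % q * (1 + 1) + 1 + 1)) (WP.set_seq
    (by simpa [h29, h13, ← pow_succ] using hU') (WP.seq (Q₁ := fun s' =>
      s'.reg (o + 27) = x % (W * q ^ (j + 1)))
    (WP.loop (fun f s' => f < q ∧ s'.reg (o + 27) + f * (W * q ^ j) = x % (W * q ^ (j + 1))) 1
      (x / (W * q ^ j) % q) ⟨hf0, ?_⟩ ?_ ?_) ?_)) (by omega)
  · simp only [setReg_reg]
    simp [h27]
    rw [hWq, Nat.mod_mul (x := x) (a := W * q ^ j), mul_comm (W * q ^ j) (x / _ % q)]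
  · rintro f s' hs hf ⟨hfq, hv⟩ hne
    have e29 : s'.reg (o + 29) = q ^ (j + 1) := by
      simpa [h29, h13, ← pow_succ] using hf.1 (o + 29) (by simp)
    have e22 : s'.reg (o + 22) = s.reg (o + 22) := by simpa using hf.1 (o + 22) (by simp)
    have e28 : s'.reg (o + 28) = W * q ^ j := by simpa [h28] using hf.1 (o + 28) (by simp)
    have hf0 : f ≠ 0 := by
      intro h0
      have := (crt_digit hq hc hfq hv).2 h0
      simp [e29, e22, h22, this] at hne
    obtain ⟨f', rfl⟩ : ∃ f', f = f' + 1 := ⟨f - 1, by omega⟩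
    have h1 : s'.reg (o + 27) + W * q ^ j + f' * (W * q ^ j) = x % (W * q ^ (j + 1)) := by
      rw [← hv]; ring
    refine ⟨f', rfl, WP.set ?_ ⟨by omega, ?_⟩⟩
    · simp only [val_add, val_reg, e28]
      have : x % (W * q ^ (j + 1)) < W * q ^ (j + 1) := Nat.mod_lt _ (by positivity)
      omega
    · simpa [e28] using h1
  · rintro f s' hs hf ⟨hfq, hv⟩ he
    have e29 : s'.reg (o + 29) = q ^ (j + 1) := by
      simpa [h29, h13, ← pow_succ] using hf.1 (o + 29) (by simp)
    have e22 : s'.reg (o + 22) = s.reg (o + 22) := by simpa using hf.1 (o + 22) (by simp)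
    simp only [val_add, val_sub, val_mod, val_reg, e29, e22, h22] at he
    have := (crt_digit hq hc hfq hv).1 (by omega)
    simpa [this] using hv
  · intro s' hs hf h
    have e29 : s'.reg (o + 29) = q ^ (j + 1) := by
      simpa [h29, h13, ← pow_succ] using hf.1 (o + 29) (by simp)
    have e28 : s'.reg (o + 28) = W * q ^ j := by simpa [h28] using hf.1 (o + 28) (by simp)
    have e13 : s'.reg (o + 13) = q := by simpa [h13] using hf.1 (o + 13) (by simp)
    refine WP.set ?_ ⟨?_, ?_, ?_⟩
    · simpa [e28, e13, hWq] using hU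
    · simpa using e29
    · simp [e28, e13, hWq]
    · simpa using h

/-- The residues in bank `o + 2` modulo register `o + 12` are combined with the residues in bank
`o + 3` modulo the power of register `o + 13` with exponent `m + 1`. -/
def crtP (o : ℕ) : Prog :=
  forP (o + 26) (reg 3)
    (.set (o + 27) (read (o + 2) (reg (o + 26))) ;; .set (o + 28) (reg (o + 12)) ;;
     .set (o + 29) 1 ;; .set (o + 22) (read (o + 3) (reg (o + 26))) ;;
     forP (o + 18) (reg 1 + 1) (crtDigitP o) ;;
     .write (o + 2) (reg (o + 26)) (reg (o + 27)))

theorem crtP_spec {x : ℕ → ℕ} {W q : ℕ} (hq : 0 < q) (hW : 0 < W) (hc : q.Coprime W)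
    (h1 : s.reg 1 = m) (h3 : s.reg 3 = N) (h12 : s.reg (o + 12) = W) (h13 : s.reg (o + 13) = q)
    (hU : W * q ^ (m + 1) ≤ U) (hm : m + 1 ≤ U)
    (hV : ∀ n < N, s.mem (o + 2) n = x n % W)
    (hA : ∀ n < N, s.mem (o + 3) n = x n % q ^ (m + 1)) :
    WP U (crtP o) s (fun s' => ∀ n < N, s'.mem (o + 2) n = x n % (W * q ^ (m + 1)))
      (N * ((m + 1) * (q * 2 + 5) + 9) + 2) := by
  have hU' : ∀ j < m + 1, W * q ^ (j + 1) ≤ U := fun j hj =>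
    (Nat.mul_le_mul_left _ (Nat.pow_le_pow_right hq hj)).trans hU
  refine WP.of_bd fun hs => WP.le (WP.for (fun k s' =>
      (∀ n < k, s'.mem (o + 2) n = x n % (W * q ^ (m + 1))) ∧
      ∀ n, k ≤ n → s'.mem (o + 2) n = s.mem (o + 2) n)
      N (1 + (1 + (1 + (1 + ((m + 1) * (q * 2 + 3 + 2) + 2 + 1))))) (by simp [crtDigitP])
      (h3 ▸ hs.1 3) ?_ ?_ ?_ ?_ ?_) (by ring_nf; omega)
  · intro s' hf
    simpa [h3] using hf.1 3 (by simp [crtDigitP])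
  · intro k s' v h
    simpa using h
  · simp
  · rintro k s' hk hs hf hi ⟨ha, hb⟩
    have e1 : s'.reg 1 = m := by rw [hf.1 1 (by simp [crtDigitP]), h1]
    have e12 : s'.reg (o + 12) = W := by rw [hf.1 (o + 12) (by simp [crtDigitP]), h12]
    have e13 : s'.reg (o + 13) = q := by rw [hf.1 (o + 13) (by simp [crtDigitP]), h13]
    have em := hf.2 (o + 3) (by simp [crtDigitP])
    refine WP.set_seq (by simpa using hs.2 _ _) (WP.set_seq (by simpa using hs.1 _)
      (WP.set_seq (by simp; omega) (WP.set_seq (by simpa using hs.2 _ _)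
      (WP.seq (Q₁ := fun s'' => s''.reg (o + 27) = x k % (W * q ^ (m + 1)))
      (WP.for (fun j s'' => s''.reg (o + 29) = q ^ j ∧ s''.reg (o + 28) = W * q ^ j ∧
        s''.reg (o + 27) = x k % (W * q ^ j)) (m + 1) _ (by simp [crtDigitP]) hm
        ?_ ?_ ?_ ?_ ?_) ?_))))
    · intro s'' hf''
      simpa [e1] using hf''.1 1 (by simp [crtDigitP])
    · intro j s'' v h
      simpa using h
    · simp only [setReg_reg]
      simp [e12, hi, hb k le_rfl, hV k hk]
    · rintro j s'' hj hs'' hf'' hj' ⟨g29, g28, g27⟩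
      have g13 : s''.reg (o + 13) = q := by
        simpa [e13] using hf''.1 (o + 13) (by simp [crtDigitP])
      have g22 : s''.reg (o + 22) = x k % q ^ (m + 1) := by
        simpa [hi, em, hA k hk] using hf''.1 (o + 22) (by simp [crtDigitP])
      exact crtDigitP_spec hq hW hc g13 g29 g28 g27
        (by rw [g22]; exact Nat.mod_mod_of_dvd _ (pow_dvd_pow _ hj)) (hU' j hj)
    · rintro s'' _ _ ⟨-, -, h⟩
      exact h
    · intro s'' hs'' hf'' h''
      have f26 : s''.reg (o + 26) = k := by
        simpa [hi] using hf''.1 (o + 26) (by simp [crtDigitP])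
      have fm : s''.mem (o + 2) = s'.mem (o + 2) := by
        simpa using hf''.2 (o + 2) (by simp [crtDigitP])
      refine WP.write (hs''.1 _) ⟨?_, ?_⟩
      · intro n hn
        simp only [val_reg, setMem_mem, f26, fm, true_and]
        split_ifs with h
        · subst h
          exact h''
        · exact ha n (by omega)
      · intro n hn
        simp only [val_reg, setMem_mem, f26, fm, true_and]
        rw [if_neg (by omega), hb n (by omega)]
  · rintro s' _ _ ⟨h, -⟩
    exact h

/-- Register `o + 14` receives the least prime factor of register `o + 13`. -/
def minFacP (o : ℕ) : Prog :=
  .set (o + 14) 2 ;;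
  .loop (reg (o + 13) % reg (o + 14)) (.set (o + 14) (reg (o + 14) + 1))

theorem minFacP_spec {q : ℕ} (hq : 2 ≤ q) (h13 : s.reg (o + 13) = q) :
    WP U (minFacP o) s (fun s' => s'.reg (o + 14) = q.minFac) (q * 2 + 2) := by
  have hp := Nat.minFac_prime (n := q) (by omega)
  have hle : q.minFac ≤ q := Nat.minFac_le (by omega)
  refine WP.of_bd fun hs => ?_
  have hqU : q ≤ U := h13 ▸ hs.1 (o + 13)
  refine WP.le (WP.set_seq (by simpa using hq.trans hqU)
    (WP.loop (fun f s' => 2 ≤ s'.reg (o + 14) ∧ s'.reg (o + 14) + f = q.minFac) 1 (q.minFac - 2)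
    ?_ ?_ ?_)) (by omega)
  · have := hp.two_le
    simp; omega
  · rintro f s' hs' hf ⟨ha, hb⟩ hne
    have e13 : s'.reg (o + 13) = q := by simpa [h13] using hf.1 (o + 13) (by simp)
    simp only [val_mod, val_reg, e13] at hne
    have hf0 : f ≠ 0 := by
      rintro rfl
      rw [add_zero] at hb
      exact hne (Nat.mod_eq_zero_of_dvd (hb ▸ Nat.minFac_dvd q))
    refine ⟨f - 1, by omega, WP.set ?_ ⟨?_, ?_⟩⟩
    · simp only [val_add, val_reg, val_one]; omega
    · simp; omega
    · simp; omega
  · rintro f s' hs' hf ⟨ha, hb⟩ he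
    have e13 : s'.reg (o + 13) = q := by simpa [h13] using hf.1 (o + 13) (by simp)
    simp only [val_mod, val_reg, e13] at he
    have := Nat.minFac_le_of_dvd ha (Nat.dvd_of_mod_eq_zero he)
    omega

/-! ### Reduction to smaller coordinates -/

/-- `sub` evaluates polynomials with natural number coefficients less than `B ^ (m + 1)` at `N`
points with coordinates less than `B`, in at most `n` steps. The coefficients are in bank `o`, the
points in bank `o + 1`, the number `B` in register `o + 10`, and the values go to bank `o + 2`. -/
def Solver (sub : Prog) (o U m d N B n : ℕ) : Prop :=
  ∀ s : Store, s.reg 1 = m → s.reg 2 = d → s.reg 3 = N → s.reg 4 = d ^ m → s.reg (o + 10) = B →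
    (∀ k < d ^ m, s.mem o k < B ^ (m + 1)) →
    (∀ n < N, ∀ j < m, s.mem (o + 1) (n * m + j) < B) →
    WP U sub s (fun s' => ∀ n < N, s'.mem (o + 2) n =
      ev d m (s.mem o) fun j => s.mem (o + 1) (n * m + j)) n

/-- The program `sub` writes only to registers and banks that lie beyond the input of a solver
with offset `o`. -/
def Local (sub : Prog) (o : ℕ) : Prop :=
  (∀ x, sub.wr x → o + 11 ≤ x) ∧ ∀ b, sub.wb b → o + 2 ≤ b

/-- The sum of `sum_hasse_modEq`: bank `o + 3` receives the values of the polynomial modulo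
register `o + 15`. The values of the Hasse derivatives are computed by `sub`. -/
def sumP (o : ℕ) (sub : Prog) : Prog :=
  forP (o + 16) (reg 4)
    (digSumP o ;;
     .cond (reg 1 + 1 - reg (o + 17))
       (hasseP o ;; .set (o + 60) (reg (o + 13)) ;; sub ;; accumP o) .skip)

theorem sumP_wr {sub : Prog} (hl : Local sub (o + 50)) {x : ℕ} (h : (sumP o sub).wr x) :
    o + 16 ≤ x := by
  by_cases hx : sub.wr x
  · have := hl.1 x hx
    omega
  · simp [sumP, digSumP, hasseP, accumP, monP, mulPowP, tayCoefP, tayDigP, binomP, hx] at h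
    omega

theorem sumP_wb {sub : Prog} (hl : Local sub (o + 50)) {b : ℕ} (h : (sumP o sub).wb b) :
    b = o + 3 ∨ b = o + 50 ∨ o + 52 ≤ b := by
  by_cases hx : sub.wb b
  · have := hl.2 b hx
    omega
  · simp [sumP, digSumP, hasseP, accumP, monP, mulPowP, tayCoefP, tayDigP, binomP, hx] at h
    omega

/-- The number of steps of one iteration of `sumP` in which `sub` is run. -/
def termTicks (m d N K : ℕ) : ℕ :=
  d ^ m * (m * (d * 3 + 11) + 8) + 2 + (1 + (K + (N * (m * (d * 3 + 7) + 7) + 2)))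

/-- Most terms of the sum cost only the computation of a digit sum; at most `4 ^ m` of them need
`sub`. -/
theorem sumP_spec {sub : Prog} {q K : ℕ} (hl : Local sub (o + 50))
    (hsub : Solver sub (o + 50) U m d N q K)
    (h1 : s.reg 1 = m) (h2 : s.reg 2 = d) (h3 : s.reg 3 = N) (h4 : s.reg 4 = d ^ m)
    (h13 : s.reg (o + 13) = q) (h15 : s.reg (o + 15) = q ^ (m + 1)) (hq : 0 < q) (hd : 0 < d)
    (hmd : m * d ≤ U) (hU : 2 ^ d ≤ U)
    (hP : ∀ k < N * m, s.mem (o + 51) k = s.mem (o + 1) k % q)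
    (hA : ∀ n < N, s.mem (o + 3) n = 0) :
    WP U (sumP o sub) s (fun s' => ∀ n < N, s'.mem (o + 3) n =
      ev d m (s.mem o) (fun j => s.mem (o + 1) (n * m + j)) % q ^ (m + 1))
      (d ^ m * (4 * m + 8) + 4 ^ m * termTicks m d N K + 2) := by
  have hE : 0 < q ^ (m + 1) := by positivity
  have hmU : m ≤ U := (Nat.le_mul_of_pos_right m hd).trans hmd
  have hidx : ∀ n < N, ∀ j < m, n * m + j < N * m := fun n hn j hj => by nlinarith
  have hwr := fun x (h : (sumP o sub).wr x) => sumP_wr hl h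
  have hwb := fun x (h : (sumP o sub).wb x) => sumP_wb hl h
  refine WP.of_bd fun hs => WP.le (WP.for_sum (fun i s' => ∀ n < N, s'.mem (o + 3) n =
      (∑ i' ∈ range i, if digSum d m i' ≤ m then
        mon d m i' (fun j => s.mem (o + 1) (n * m + j) - s.mem (o + 1) (n * m + j) % q) *
        ev d m (fun k => hasse d m i' (s.mem o) k % q ^ (m + 1))
          (fun j => s.mem (o + 1) (n * m + j) % q) else 0) % q ^ (m + 1))
      (d ^ m) (fun i => (m * 4 + 4) + (1 + if digSum d m i ≤ m then termTicks m d N K else 1))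
      ?_ (h4 ▸ hs.1 4) ?_ ?_ ?_ ?_ ?_) ?_
  · have hx : ¬ sub.wr (o + 16) := fun h => by have := hl.1 _ h; omega
    simp [digSumP, hasseP, accumP, monP, mulPowP, tayCoefP, tayDigP, binomP, hx]
  · intro s' hf
    rw [val_reg, ← h4]
    exact hf.1 4 fun h => by have := hwr _ h; omega
  · intro k s' v h
    simpa using h
  · intro n hn
    simp [hA n hn]
  · intro i s' hi hs' hf hir ha
    have e1 : s'.reg 1 = m := by rw [hf.1 1 fun h => by have := hwr _ h; omega, h1]
    have e2 : s'.reg 2 = d := by rw [hf.1 2 fun h => by have := hwr _ h; omega, h2]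
    have e3 : s'.reg 3 = N := by rw [hf.1 3 fun h => by have := hwr _ h; omega, h3]
    have e4 : s'.reg 4 = d ^ m := by rw [hf.1 4 fun h => by have := hwr _ h; omega, h4]
    have e13 : s'.reg (o + 13) = q := by
      rw [hf.1 (o + 13) fun h => by have := hwr _ h; omega, h13]
    have e15 : s'.reg (o + 15) = q ^ (m + 1) := by
      rw [hf.1 (o + 15) fun h => by have := hwr _ h; omega, h15]
    have em0 : s'.mem o = s.mem o := hf.2 o fun h => by have := hwb _ h; omega
    have em1 : s'.mem (o + 1) = s.mem (o + 1) := hf.2 _ fun h => by have := hwb _ h; omega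
    have em51 : s'.mem (o + 51) = s.mem (o + 51) := hf.2 _ fun h => by have := hwb _ h; omega
    refine WP.seq (digSumP_spec e1 e2 hd hmd) fun s₁ hs₁ hf₁ h17 => ?_
    have f1 : s₁.reg 1 = m := by rw [hf₁.1 1 (by simp [digSumP]), e1]
    have f2 : s₁.reg 2 = d := by rw [hf₁.1 2 (by simp [digSumP]), e2]
    have f3 : s₁.reg 3 = N := by rw [hf₁.1 3 (by simp [digSumP]), e3]
    have f4 : s₁.reg 4 = d ^ m := by rw [hf₁.1 4 (by simp [digSumP]), e4]
    have f13 : s₁.reg (o + 13) = q := by rw [hf₁.1 (o + 13) (by simp [digSumP]), e13]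
    have f15 : s₁.reg (o + 15) = q ^ (m + 1) := by rw [hf₁.1 (o + 15) (by simp [digSumP]), e15]
    have f16 : s₁.reg (o + 16) = i := by rw [hf₁.1 (o + 16) (by simp [digSumP]), hir]
    have fm : s₁.mem = s'.mem := funext fun b => hf₁.2 b (by simp [digSumP])
    rw [hir] at h17
    refine WP.cond (fun hne => ?_) fun he => ?_
    · simp only [val_sub, val_add, val_reg, val_one, f1, h17] at hne
      have hle : digSum d m i ≤ m := by omega
      rw [if_pos hle]
      refine WP.seq (hasseP_spec f1 f2 f4 hmU hU (f15 ▸ hE)) fun s₂ hs₂ hf₂ h50 => ?_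
      rw [f15, f16, fm, em0] at h50
      have hwr₂ : ∀ x, (x ≤ 4 ∨ x = o + 13 ∨ x = o + 15 ∨ x = o + 16) → s₂.reg x = s₁.reg x :=
        fun x hx => hf₂.1 x (by simp [hasseP, tayCoefP, tayDigP, binomP]; omega)
      have hwb₂ : ∀ b, b ≠ o + 50 → s₂.mem b = s'.mem b := fun b hb =>
        (hf₂.2 b (by simpa [hasseP, tayCoefP, tayDigP, binomP] using hb)).trans (by rw [fm])
      refine WP.set_seq (by simpa using hs₂.1 _) (WP.seq (hsub _ ?_ ?_ ?_ ?_ ?_ ?_ ?_) ?_)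
      · simp [hwr₂ 1 (by omega), f1]
      · simp [hwr₂ 2 (by omega), f2]
      · simp [hwr₂ 3 (by omega), f3]
      · simp [hwr₂ 4 (by omega), f4]
      · simp [hwr₂ (o + 13) (by omega), f13]
      · intro k hk
        rw [setReg_mem, h50 k hk]
        exact Nat.mod_lt _ hE
      · intro n hn j hj
        rw [setReg_mem, add_assoc, hwb₂ _ (by omega), em51, hP _ (hidx n hn j hj)]
        exact Nat.mod_lt _ hq
      · intro s₃ hs₃ hf₃ h52
        have g : ∀ x, (x ≤ 4 ∨ x = o + 13 ∨ x = o + 15 ∨ x = o + 16) → s₃.reg x = s₁.reg x := by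
          intro x hx
          rw [hf₃.1 x (fun h => by have := hl.1 x h; omega), setReg_reg, if_neg (by omega),
            hwr₂ x hx]
        have gm : ∀ b, b < o + 50 → s₃.mem b = s'.mem b := by
          intro b hb
          rw [hf₃.2 b (fun h => by have := hl.2 b h; omega), setReg_mem, hwb₂ b (by omega)]
        refine WP.mono (accumP_spec (m := m) (d := d) (N := N) ((g 1 (by omega)).trans f1)
          ((g 2 (by omega)).trans f2) ((g 3 (by omega)).trans f3) hd ?_) le_rfl ?_
        · rw [g (o + 15) (by omega), f15]; exact hE
        · intro s₄ _ _ h₄ n hn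
          rw [h₄ n hn, g (o + 13) (by omega), g (o + 15) (by omega), g (o + 16) (by omega),
            gm (o + 1) (by omega), gm (o + 3) (by omega), f13, f15, f16, em1, h52 n hn,
            sum_range_succ, if_pos hle, ha n hn, setReg_mem]
          refine Nat.ModEq.add (Nat.mod_modEq _ _) ?_
          rw [mul_comm]
          refine Nat.ModEq.mul_left _ ?_
          rw [ev_congr h50 fun j hj => ?_]
          rw [add_assoc, hwb₂ _ (by omega), em51, hP _ (hidx n hn j hj)]
    · simp only [val_sub, val_add, val_reg, val_one, f1, h17] at he
      have hle : ¬ digSum d m i ≤ m := by omega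
      rw [if_neg hle]
      refine WP.skip fun n hn => ?_
      rw [fm, ha n hn, sum_range_succ, if_neg hle, add_zero]
  · intro s' _ _ h n hn
    rw [h n hn]
    exact sum_hasse_modEq d m q (s.mem o) fun j => s.mem (o + 1) (n * m + j)
  · have hcard := card_digSum_le d m m
    rw [← two_mul, pow_mul] at hcard
    calc _ ≤ ∑ i ∈ range (d ^ m), ((4 * m + 8) +
            if digSum d m i ≤ m then termTicks m d N K else 0) + 2 := by
          refine Nat.add_le_add_right (sum_le_sum fun i _ => ?_) 2
          split_ifs <;> omega
      _ = d ^ m * (4 * m + 8) +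
            #{i ∈ range (d ^ m) | digSum d m i ≤ m} * termTicks m d N K + 2 := by
          rw [sum_add_distrib, ← sum_filter]; simp
      _ ≤ _ := by gcongr; exact hcard

/-- The values modulo a power of the prime in register `o + 13` are computed and combined with the
values known so far. -/
def roundP (o : ℕ) (sub : Prog) : Prog :=
  powP (o + 15) (o + 13) (reg 1 + 1) (o + 18) ;; pointsP o ;; clearP o (o + 3) ;; sumP o sub ;;
  crtP o ;; .set (o + 12) (reg (o + 12) * reg (o + 15))

theorem roundP_wr {sub : Prog} (hl : Local sub (o + 50)) {x : ℕ} (h : (roundP o sub).wr x) :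
    x = o + 12 ∨ o + 15 ≤ x := by
  by_cases hx : (sumP o sub).wr x
  · have := sumP_wr hl hx
    omega
  · simp [roundP, powP, pointsP, clearP, crtP, crtDigitP, hx] at h
    omega

theorem roundP_wb {sub : Prog} (hl : Local sub (o + 50)) {b : ℕ} (h : (roundP o sub).wb b) :
    b = o + 2 ∨ b = o + 3 ∨ o + 50 ≤ b := by
  by_cases hx : (sumP o sub).wb b
  · have := sumP_wb hl hx
    omega
  · simp [roundP, powP, pointsP, clearP, crtP, crtDigitP, hx] at h
    omega

/-- The number of steps of `roundP` for primes up to `G`. -/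
def roundTicks (m d N G K : ℕ) : ℕ :=
  ((m + 1) * 3 + 3) + ((N * m * 3 + 2) + ((N * 3 + 2) +
    ((d ^ m * (4 * m + 8) + 4 ^ m * termTicks m d N K + 2) +
      ((N * ((m + 1) * (G * 2 + 5) + 9) + 2) + 1))))

theorem roundP_spec {sub : Prog} {W q G K : ℕ} (hl : Local sub (o + 50))
    (hsub : Solver sub (o + 50) U m d N q K)
    (h1 : s.reg 1 = m) (h2 : s.reg 2 = d) (h3 : s.reg 3 = N) (h4 : s.reg 4 = d ^ m)
    (h12 : s.reg (o + 12) = W) (h13 : s.reg (o + 13) = q) (hq : 0 < q) (hqG : q ≤ G) (hW : 0 < W)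
    (hc : q.Coprime W) (hd : 0 < d) (hmd : m * d ≤ U) (hU : 2 ^ d ≤ U) (hm : m + 1 ≤ U)
    (hN : N * m ≤ U) (hWU : W * q ^ (m + 1) ≤ U)
    (hV : ∀ n < N, s.mem (o + 2) n =
      ev d m (s.mem o) (fun j => s.mem (o + 1) (n * m + j)) % W) :
    WP U (roundP o sub) s (fun s' => s'.reg (o + 12) = W * q ^ (m + 1) ∧ ∀ n < N,
      s'.mem (o + 2) n =
        ev d m (s.mem o) (fun j => s.mem (o + 1) (n * m + j)) % (W * q ^ (m + 1)))
      (roundTicks m d N G K) := by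
  refine WP.seq (powP_spec (n := m + 1) (by omega) (by omega) (by omega) ?_
    (by rwa [h13]) hm (by rw [h13]; exact (Nat.le_mul_of_pos_left _ hW).trans hWU))
    fun s₁ hs₁ hf₁ h15 => ?_
  · intro s' hf
    rw [val_add, val_reg, val_one, hf.1 1 (by simp [powP]), h1]
  rw [h13] at h15
  have a : ∀ x, (x ≤ 4 ∨ x = o + 12 ∨ x = o + 13) → s₁.reg x = s.reg x := fun x hx =>
    hf₁.1 x (by simp [powP]; omega)
  have am : ∀ b, s₁.mem b = s.mem b := fun b => hf₁.2 b (by simp [powP])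
  refine WP.seq (pointsP_spec (m := m) (N := N) (by rw [a 1 (by omega), h1])
    (by rw [a 3 (by omega), h3]) hN) fun s₂ hs₂ hf₂ h51 => ?_
  rw [am, a (o + 13) (by omega), h13] at h51
  have b : ∀ x, (x ≤ 4 ∨ x = o + 12 ∨ x = o + 13 ∨ x = o + 15) → s₂.reg x = s₁.reg x := fun x hx =>
    hf₂.1 x (by simp [pointsP]; omega)
  have bm : ∀ b, b ≠ o + 51 → s₂.mem b = s.mem b := fun b hb =>
    (hf₂.2 b (by simpa [pointsP] using hb)).trans (am b)
  refine WP.seq (clearP_spec (N := N) (by rw [b 3 (by omega), a 3 (by omega), h3]))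
    fun s₃ hs₃ hf₃ hz => ?_
  have c : ∀ x, (x ≤ 4 ∨ x = o + 12 ∨ x = o + 13 ∨ x = o + 15) → s₃.reg x = s₁.reg x := fun x hx =>
    (hf₃.1 x (by simp [clearP]; omega)).trans (b x hx)
  have cm : ∀ b, b ≠ o + 3 → s₃.mem b = s₂.mem b := fun b hb =>
    (hf₃.2 b (by simpa [clearP] using hb))
  have c13 : s₃.reg (o + 13) = q := by rw [c _ (by omega), a _ (by omega), h13]
  have c1 : s₃.reg 1 = m := by rw [c _ (by omega), a _ (by omega), h1]
  have c3 : s₃.reg 3 = N := by rw [c _ (by omega), a _ (by omega), h3]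
  have c15 : s₃.reg (o + 15) = q ^ (m + 1) := by rw [c _ (by omega), h15]
  have cm1 : s₃.mem (o + 1) = s.mem (o + 1) := by rw [cm _ (by omega), bm _ (by omega)]
  have cm0 : s₃.mem o = s.mem o := by rw [cm _ (by omega), bm _ (by omega)]
  have cm2 : s₃.mem (o + 2) = s.mem (o + 2) := by rw [cm _ (by omega), bm _ (by omega)]
  refine WP.seq (sumP_spec hl hsub c1
    (by rw [c _ (by omega), a _ (by omega), h2]) c3
    (by rw [c _ (by omega), a _ (by omega), h4]) c13 c15 hq hd hmd hU ?_ hz)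
    fun s₄ hs₄ hf₄ hA => ?_
  · rw [cm _ (by omega), cm1]
    exact h51
  rw [cm0, cm1] at hA
  have e : ∀ x, x < o + 16 → s₄.reg x = s₃.reg x := fun x hx =>
    hf₄.1 x fun h => by have := sumP_wr hl h; omega
  have em2 : s₄.mem (o + 2) = s.mem (o + 2) := by
    rw [hf₄.2 (o + 2) fun h => by have := sumP_wb hl h; omega, cm2]
  have e12 : s₄.reg (o + 12) = W := by
    rw [e _ (by omega), c _ (by omega), a _ (by omega), h12]
  refine WP.seq (WP.le (crtP_spec (x := fun n => ev d m (s.mem o) fun j => s.mem (o + 1) (n * m + j))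
    hq hW hc (m := m) (N := N) ?_ ?_ e12 ?_ hWU hm ?_ hA)
    (by gcongr : _ ≤ N * ((m + 1) * (G * 2 + 5) + 9) + 2)) fun s₅ hs₅ hf₅ h5 => ?_
  · rw [e _ (by omega), c1]
  · rw [e _ (by omega), c3]
  · rw [e _ (by omega), c13]
  · rw [em2]; exact hV
  have f12 : s₅.reg (o + 12) = W := by rw [hf₅.1 _ (by simp [crtP, crtDigitP]), e12]
  have f15 : s₅.reg (o + 15) = q ^ (m + 1) := by
    rw [hf₅.1 _ (by simp [crtP, crtDigitP]), e _ (by omega), c15]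
  exact WP.set (by simpa [f12, f15] using hWU) ⟨by simp [f12, f15], h5⟩

/-- Evaluation by reduction to smaller coordinates: `sub` evaluates polynomials modulo powers of
the primes `2, 3, 5, …`, and the values are combined until their residues determine them. -/
def levelP (o : ℕ) (sub : Prog) : Prog :=
  powP (o + 11) (o + 10) (reg 1 + 1 + reg 2 * reg 1) (o + 18) ;;
  .set (o + 11) (reg 4 * reg (o + 11)) ;; .set (o + 12) 1 ;; .set (o + 13) 1 ;;
  clearP o (o + 2) ;;
  .loop (reg (o + 11) + 1 - reg (o + 12))
    (.set (o + 13) (reg (o + 13) + 1) ;; minFacP o ;;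
     .cond (reg (o + 13) - reg (o + 14)) .skip (roundP o sub))

theorem levelP_local {sub : Prog} (hl : Local sub (o + 50)) : Local (levelP o sub) o := by
  constructor
  · intro x h
    by_cases hx : (roundP o sub).wr x
    · have := roundP_wr hl hx
      omega
    · simp [levelP, powP, clearP, minFacP, hx] at h
      omega
  · intro x h
    by_cases hx : (roundP o sub).wb x
    · have := roundP_wb hl hx
      omega
    · simp [levelP, powP, clearP, minFacP, hx] at h
      omega

/-- The number of steps of `levelP` if primes up to `G` suffice. -/
def levelTicks (m d N G K : ℕ) : ℕ :=
  (m + 1 + d * m) * 3 + N * 3 + 12 + G * (G * 2 + 6 + roundTicks m d N G K)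

/-- A round of reduction: a solver for coordinates less than `B` is obtained from solvers for
coordinates less than `q`, for the primes `q` that are needed until a power of their product
exceeds the values. -/
theorem levelP_spec {sub : Prog} {B G K : ℕ} (hl : Local sub (o + 50))
    (hsub : ∀ q, 0 < q → q ≤ G → Solver sub (o + 50) U m d N q K) (hB : 0 < B) (hd : 0 < d)
    (hG : ∀ x, primorial x ^ (m + 1) ≤ evBound d m B → x + 1 ≤ G)
    (hGU : evBound d m B * G ^ (m + 1) ≤ U) (hU : 2 ^ d ≤ U) (hm : m + 1 + d * m ≤ U)
    (hN : N * m ≤ U) :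
    Solver (levelP o sub) o U m d N B (levelTicks m d N G K) := by
  intro s h1 h2 h3 h4 h10 hF hA
  have hM1 : 1 ≤ evBound d m B := Nat.mul_pos (by positivity) (by positivity)
  have hG2 : 2 ≤ G := by simpa using hG 1 (by simpa using hM1)
  have hMU : evBound d m B ≤ U := (Nat.le_mul_of_pos_right _ (by positivity)).trans hGU
  have hBM : B ^ (m + 1 + d * m) ≤ evBound d m B := Nat.le_mul_of_pos_left _ (by positivity)
  have hval : ∀ n < N, ev d m (s.mem o) (fun j => s.mem (o + 1) (n * m + j)) ≤ evBound d m B :=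
    fun n hn => ev_le_evBound hd hB (fun k hk => (hF k hk).le) fun j hj => (hA n hn j hj).le
  refine WP.le (n := ((m + 1 + d * m) * 3 + 3) + (1 + (1 + (1 + ((N * 3 + 2) +
    ((G - 1) * ((1 + ((G * 2 + 2) + (1 + roundTicks m d N G K))) + 1) + 1))))))
    (WP.seq (powP_spec (n := m + 1 + d * m) (by omega) (by omega) (by omega) ?_
      (by rwa [h10]) hm (by rw [h10]; exact hBM.trans hMU)) fun s₁ hs₁ hf₁ h11 => ?_) ?_
  · intro s' hf
    simp only [val_add, val_mul, val_reg, val_one]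
    rw [hf.1 1 (by simp [powP]), hf.1 2 (by simp [powP]), h1, h2]
  · rw [h10] at h11
    have a : ∀ x, x ≤ 4 → s₁.reg x = s.reg x := fun x hx => hf₁.1 x (by simp [powP]; omega)
    have am : ∀ b, s₁.mem b = s.mem b := fun b => hf₁.2 b (by simp [powP])
    have hMval : s₁.reg 4 * s₁.reg (o + 11) = evBound d m B := by
      rw [a 4 le_rfl, h4, h11, evBound]
    refine WP.set_seq (by simpa [hMval] using hMU) (WP.set_seq (by simpa using hM1.trans hMU)
      (WP.set_seq (by simpa using hM1.trans hMU) (WP.seq (clearP_spec (N := N)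
        (by simp [a 3 (by omega), h3])) fun s₂ hs₂ hf₂ hz => ?_)))
    have b : ∀ x, x ≤ 4 → s₂.reg x = s.reg x := by
      intro x hx
      rw [hf₂.1 x (by simp [clearP]; omega)]
      simp only [setReg_reg]
      rw [if_neg (by omega), if_neg (by omega), if_neg (by omega), a x hx]
    have b11 : s₂.reg (o + 11) = evBound d m B := by
      rw [hf₂.1 (o + 11) (by simp [clearP])]
      simpa using hMval
    have b12 : s₂.reg (o + 12) = 1 := by
      rw [hf₂.1 (o + 12) (by simp [clearP])]
      simp
    have b13 : s₂.reg (o + 13) = 1 := by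
      rw [hf₂.1 (o + 13) (by simp [clearP])]
      simp
    have bm : ∀ b, b ≠ o + 2 → s₂.mem b = s.mem b := by
      intro b hb
      rw [hf₂.2 b (by simpa [clearP] using hb)]
      exact am b
    -- after the numbers up to `q` have been dealt with, the values are known modulo a power of the
    -- primorial of `q`
    refine WP.loop (fun f s' => ∃ q, s'.reg (o + 13) = q ∧ q + f = G ∧ 0 < q ∧
      s'.reg (o + 12) = primorial q ^ (m + 1) ∧ ∀ n < N, s'.mem (o + 2) n =
        ev d m (s.mem o) (fun j => s.mem (o + 1) (n * m + j)) % primorial q ^ (m + 1))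
      _ (G - 1) ⟨1, b13, by omega, one_pos, by simp [b12], fun n hn => ?_⟩ ?_ ?_
    · rw [hz n hn, primorial_one, one_pow, Nat.mod_one]
    · rintro f s' hs' hf' ⟨q, h13, hqf, hq0, h12, hV⟩ hne
      have hfr : ∀ x, x ≤ 4 ∨ x = o + 11 → s'.reg x = s₂.reg x := by
        intro x hx
        refine hf'.1 x fun h => ?_
        by_cases hx' : (roundP o sub).wr x
        · have := roundP_wr hl hx'
          omega
        · simp [minFacP, hx'] at h
          omega
      have hfm : ∀ b, b ≤ o + 1 → s'.mem b = s.mem b := by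
        intro b hb
        rw [hf'.2 b fun h => ?_, bm b (by omega)]
        by_cases hx' : (roundP o sub).wb b
        · have := roundP_wb hl hx'
          omega
        · simp [minFacP, hx'] at h
      simp only [val_add, val_sub, val_reg, val_one, hfr (o + 11) (by omega), b11, h12] at hne
      have hle : primorial q ^ (m + 1) ≤ evBound d m B := by omega
      have hqG := hG q hle
      have hqU : q + 1 ≤ U := by
        calc q + 1 ≤ G := hqG
          _ ≤ G ^ (m + 1) := Nat.le_self_pow (by omega) _
          _ ≤ U := (Nat.le_mul_of_pos_left _ hM1).trans hGU
      refine ⟨f - 1, by omega, WP.set_seq (by simpa [h13] using hqU)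
        (WP.seq (WP.le (minFacP_spec (q := q + 1) (by omega) (by simp [h13])) (by omega))
        fun s₃ hs₃ hf₃ h14 => ?_)⟩
      have c13 : s₃.reg (o + 13) = q + 1 := by
        rw [hf₃.1 (o + 13) (by simp [minFacP])]
        simp [h13]
      have c : ∀ x, x ≤ 4 ∨ x = o + 12 → s₃.reg x = s'.reg x := by
        intro x hx
        rw [hf₃.1 x (by simp [minFacP]; omega)]
        simp only [setReg_reg]
        rw [if_neg (by omega)]
      have cm : ∀ b, s₃.mem b = s'.mem b := fun b => hf₃.2 b (by simp [minFacP])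
      refine WP.cond (fun hne => ?_) fun he => ?_
      · simp only [val_sub, val_reg, c13, h14] at hne
        have hnp : ¬ (q + 1).Prime := fun hp => by rw [hp.minFac_eq] at hne; omega
        refine WP.le (WP.skip ⟨q + 1, c13, by omega, by omega, ?_, ?_⟩)
          (by unfold roundTicks; omega)
        · rw [c _ (by omega), h12, primorial_succ_of_not_prime hnp]
        · rw [cm, primorial_succ_of_not_prime hnp]
          exact hV
      · simp only [val_sub, val_reg, c13, h14] at he
        have hmf : (q + 1).minFac = q + 1 :=
          le_antisymm (Nat.minFac_le (by omega)) (by omega)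
        have hp : (q + 1).Prime := hmf ▸ Nat.minFac_prime (by omega)
        have hmul : primorial (q + 1) ^ (m + 1) = primorial q ^ (m + 1) * (q + 1) ^ (m + 1) := by
          rw [primorial_succ_of_prime hp, mul_pow]
        refine WP.mono (roundP_spec (m := m) (d := d) (N := N) (G := G) (q := q + 1)
          (W := primorial q ^ (m + 1)) hl (hsub (q + 1) (by omega) hqG) ?_ ?_ ?_ ?_ ?_ c13
          (by omega) hqG (Nat.pow_pos (primorial_pos q))
          ((coprime_primorial hp).pow_right (m + 1)) hd (by rw [mul_comm]; omega) hU
          (by omega) hN ?_ ?_) le_rfl ?_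
        · rw [c _ (by omega), hfr _ (by omega), b _ (by omega), h1]
        · rw [c _ (by omega), hfr _ (by omega), b _ (by omega), h2]
        · rw [c _ (by omega), hfr _ (by omega), b _ (by omega), h3]
        · rw [c _ (by omega), hfr _ (by omega), b _ (by omega), h4]
        · rw [c _ (by omega), h12]
        · exact (Nat.mul_le_mul hle (Nat.pow_le_pow_left hqG _)).trans hGU
        · rw [cm, cm, cm, hfm o (by omega), hfm (o + 1) le_rfl]
          exact hV
        · rintro s₄ hs₄ hf₄ ⟨g12, gV⟩
          refine ⟨q + 1, ?_, by omega, by omega, by rw [g12, hmul], ?_⟩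
          · rw [hf₄.1 _ fun h => by have := roundP_wr hl h; omega, c13]
          · rw [hmul]
            rwa [cm, cm, hfm o (by omega), hfm (o + 1) le_rfl] at gV
    · rintro f s' hs' hf' ⟨q, h13, hqf, hq0, h12, hV⟩ he n hn
      have h11' : s'.reg (o + 11) = evBound d m B := by
        rw [hf'.1 (o + 11) fun h => ?_, b11]
        by_cases hx' : (roundP o sub).wr (o + 11)
        · have := roundP_wr hl hx'
          omega
        · simp [minFacP, hx'] at h
      simp only [val_add, val_sub, val_reg, val_one, h11', h12] at he
      rw [hV n hn, Nat.mod_eq_of_lt]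
      have := hval n hn
      omega
  · have : (G - 1) * (1 + (G * 2 + 2 + (1 + roundTicks m d N G K)) + 1) ≤
        G * (G * 2 + 6 + roundTicks m d N G K) :=
      Nat.mul_le_mul (Nat.sub_le _ _) (by omega)
    unfold levelTicks
    omega

/-! ### Evaluation at all points of a grid -/

/-- As many cells as register `x` says are copied from bank `a` to bank `b`. -/
def copyP (b a x c : ℕ) : Prog := forP c (reg x) (.write b (reg c) (read a (reg c)))

theorem copyP_spec {b a x c : ℕ} (hab : a ≠ b) (hxc : x ≠ c) :
    WP U (copyP b a x c) s (fun s' => ∀ k < s.reg x, s'.mem b k = s.mem a k)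
      (s.reg x * 3 + 2) := by
  refine WP.of_bd fun hs => WP.le (WP.for (fun k s' => ∀ k' < k, s'.mem b k' = s.mem a k')
      (s.reg x) 1 (by simp) (hs.1 x) ?_ ?_ ?_ ?_ ?_) (by omega)
  · intro s' hf
    exact hf.1 x (by simpa using hxc)
  · intro k s' v h
    simpa using h
  · simp
  · intro k s' hk hs hf hi ha
    have em := hf.2 a (by simpa using hab)
    refine WP.write (hs.2 _ _) ?_
    intro k' hk'
    simp only [val_reg, val_read, setMem_mem, em, hi, true_and]
    split_ifs with h
    · rw [h]
    · exact ha k' (by omega)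
  · intro s' _ _ h
    exact h

/-- Cell number `o + 18` of bank `o + 4` receives the next table entry: the sum over the lowest
digit `u` of the index of the old table, multiplied by the power with exponent `u` of the new
coordinate, which is the quotient of the new index by register `o + 17`. -/
def entryP (o : ℕ) : Prog :=
  .set (o + 20) (reg (o + 18) % reg (o + 17)) ;; .set (o + 21) (reg (o + 18) / reg (o + 17)) ;;
  .set (o + 22) 0 ;; .set (o + 23) 1 ;;
  forP (o + 19) (reg 2)
    (.set (o + 22) (reg (o + 22) + reg (o + 23) *
        read (o + 3) (reg (o + 19) + reg 2 * reg (o + 20))) ;;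
     .set (o + 23) (reg (o + 23) * reg (o + 21))) ;;
  .write (o + 4) (reg (o + 18)) (reg (o + 22))

theorem entryP_spec {i Y v : ℕ} (h2 : s.reg 2 = d) (h17 : s.reg (o + 17) = Y)
    (h18 : s.reg (o + 18) = i)
    (hv : ∑ u ∈ range d, s.mem (o + 3) (u + d * (i % Y)) * (i / Y) ^ u = v) (hvU : v ≤ U)
    (hU : ∀ u ≤ d, (i / Y) ^ u ≤ U) :
    WP U (entryP o) s (fun s' => ∀ i', s'.mem (o + 4) i' =
      if i' = i then v else s.mem (o + 4) i') (d * 4 + 7) := by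
  refine WP.of_bd fun hs => WP.le (n := 1 + (1 + (1 + (1 + (d * (2 + 2) + 2 + 1)))))
    (WP.set_seq ?_ (WP.set_seq ?_ (WP.set_seq ?_ (WP.set_seq ?_
    (WP.seq (Q₁ := fun s' => s'.reg (o + 22) = v)
    (WP.for (fun t s' => s'.reg (o + 22) =
        ∑ u ∈ range t, s.mem (o + 3) (u + d * (i % Y)) * (i / Y) ^ u ∧
      s'.reg (o + 23) = (i / Y) ^ t) d (1 + 1) (by simp) (h2 ▸ hs.1 2) ?_ ?_ ?_ ?_ ?_) ?_))))) (by omega)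
  · simpa using (Nat.mod_le _ _).trans (hs.1 _)
  · simpa using (Nat.div_le_self _ _).trans (hs.1 _)
  · simp
  · simpa using hU 0 (Nat.zero_le _)
  · intro s' hf
    simpa [h2] using hf.1 2 (by simp)
  · intro k s' v h
    simpa using h
  · simp
  · rintro t s' ht hs' hf hi ⟨ha, hb⟩
    have e2 : s'.reg 2 = d := by simpa [h2] using hf.1 2 (by simp)
    have e20 : s'.reg (o + 20) = i % Y := by simpa [h17, h18] using hf.1 (o + 20) (by simp)
    have e21 : s'.reg (o + 21) = i / Y := by simpa [h17, h18] using hf.1 (o + 21) (by simp)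
    have em : s'.mem (o + 3) = s.mem (o + 3) := by simpa using hf.2 (o + 3) (by simp)
    have hnew : s'.reg (o + 22) + s'.reg (o + 23) *
        s'.mem (o + 3) (s'.reg (o + 19) + s'.reg 2 * s'.reg (o + 20)) =
        ∑ u ∈ range (t + 1), s.mem (o + 3) (u + d * (i % Y)) * (i / Y) ^ u := by
      rw [ha, hb, hi, e2, e20, em, sum_range_succ, mul_comm ((i / Y) ^ t)]
    refine WP.set_seq ?_ (WP.set ?_ (And.intro ?_ ?_))
    · simp only [val_add, val_mul, val_reg, val_read, hnew]
      refine le_trans ?_ hvU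
      rw [← hv]
      exact sum_le_sum_of_subset (range_subset_range.2 ht)
    · simpa [hb, e21, ← pow_succ] using hU (t + 1) ht
    · simpa using hnew
    · simp [hb, e21, pow_succ]
  · rintro s' _ _ ⟨h, -⟩
    exact h.trans hv
  · intro s' hs' hf h
    have e18 : s'.reg (o + 18) = i := by simpa [h18] using hf.1 (o + 18) (by simp)
    have em : s'.mem (o + 4) = s.mem (o + 4) := by simpa using hf.2 (o + 4) (by simp)
    refine WP.write (hs'.1 _) fun i' => ?_
    simp [e18, em, h]

/-- One more variable is replaced by all numbers less than register `o + 10`. Register `o + 15`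
holds the size of the table. -/
def tableStepP (o : ℕ) : Prog :=
  .set (o + 17) (reg (o + 15) / reg 2) ;; .set (o + 15) (reg (o + 17) * reg (o + 10)) ;;
  forP (o + 18) (reg (o + 15)) (entryP o) ;;
  copyP (o + 3) (o + 4) (o + 15) (o + 18)

theorem tableStepP_spec {j B S : ℕ} {F : ℕ → ℕ} (hd : 0 < d) (hB : 0 < B) (hj : j < m)
    (hF : ∀ k < d ^ m, F k < B ^ (m + 1)) (hU : evBound d m B ≤ U)
    (h2 : s.reg 2 = d) (h10 : s.reg (o + 10) = B) (h15 : s.reg (o + 15) = d ^ (m - j) * B ^ j)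
    (hT : ∀ i < d ^ (m - j) * B ^ j, s.mem (o + 3) i = table d m B F j i)
    (hS : d ^ (m - (j + 1)) * B ^ (j + 1) ≤ S) :
    WP U (tableStepP o) s (fun s' => s'.reg (o + 15) = d ^ (m - (j + 1)) * B ^ (j + 1) ∧
      ∀ i < d ^ (m - (j + 1)) * B ^ (j + 1), s'.mem (o + 3) i = table d m B F (j + 1) i)
      (S * (d * 4 + 12) + 6) := by
  obtain ⟨Y, hY⟩ : ∃ Y, Y = d ^ (m - j - 1) * B ^ j := ⟨_, rfl⟩
  have hY0 : 0 < Y := hY ▸ by positivity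
  have hm1 : m - j = m - j - 1 + 1 := by omega
  have e1 : d ^ (m - j) * B ^ j = d * Y := by
    rw [hY]
    conv_lhs => rw [hm1, pow_succ]
    ring
  have e2 : d ^ (m - (j + 1)) * B ^ (j + 1) = Y * B := by
    rw [hY, Nat.sub_sub]; ring
  rw [e1] at h15 hT
  rw [e2] at hS ⊢
  have hpow : ∀ a ≤ m, ∀ b ≤ m + 1 + d * m, d ^ a * B ^ b ≤ U := fun a ha b hb =>
    (Nat.mul_le_mul (Nat.pow_le_pow_right hd ha) (Nat.pow_le_pow_right hB hb)).trans hU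
  have hYB : Y * B ≤ U := by
    rw [← e2]
    exact hpow _ (by omega) _ (by omega)
  have hYU : Y ≤ U := (Nat.le_mul_of_pos_right _ hB).trans hYB
  have htab : ∀ i, table d m B F (j + 1) i ≤ U := by
    intro i
    have hdm : d ^ (m - (j + 1)) * d ^ (j + 1) = d ^ m := by rw [← pow_add]; congr 1; omega
    refine (ev_le (C := B ^ (m + 1)) hd hB (fun k hk => (hF _ ?_).le)
      fun t _ => (dig_lt hB _ _).le).trans ?_
    · have hr : i % d ^ (m - (j + 1)) < d ^ (m - (j + 1)) := Nat.mod_lt _ (by positivity)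
      calc k + d ^ (j + 1) * (i % d ^ (m - (j + 1))) <
          d ^ (j + 1) * (i % d ^ (m - (j + 1)) + 1) := by rw [mul_add_one]; omega
        _ ≤ d ^ (j + 1) * d ^ (m - (j + 1)) := Nat.mul_le_mul_left _ hr
        _ = d ^ m := by rw [mul_comm, hdm]
    · rw [← pow_add]
      refine hpow _ hj _ ?_
      have : d * (j + 1) ≤ d * m := Nat.mul_le_mul_left _ hj
      omega
  refine WP.le (n := 1 + (1 + (Y * B * (d * 4 + 7 + 2) + 2 + (Y * B * 3 + 2))))
    (WP.set_seq ?_ (WP.set_seq ?_ (WP.seq (Q₁ := fun s' => ∀ i < Y * B,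
      s'.mem (o + 4) i = table d m B F (j + 1) i)
    (WP.for (fun k s' => ∀ i < k, s'.mem (o + 4) i = table d m B F (j + 1) i) (Y * B)
      (d * 4 + 7) (by simp [entryP]) hYB ?_ ?_ ?_ ?_ ?_) ?_))) ?_
  · simpa [h15, h2, Nat.mul_div_cancel_left _ hd] using hYU
  · simpa [h15, h2, h10, Nat.mul_div_cancel_left _ hd] using hYB
  · intro s' hf
    rw [val_reg, hf.1 (o + 15) (by simp [entryP])]
    simp [h15, h2, h10, Nat.mul_div_cancel_left _ hd]
  · intro k s' v h
    simpa using h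
  · simp
  · intro i s' hi hs' hf hir ha
    have e2 : s'.reg 2 = d := by simpa [h2] using hf.1 2 (by simp [entryP])
    have e17 : s'.reg (o + 17) = Y := by
      simpa [h15, h2, Nat.mul_div_cancel_left _ hd] using hf.1 (o + 17) (by simp [entryP])
    have em : s'.mem (o + 3) = s.mem (o + 3) := by simpa using hf.2 (o + 3) (by simp [entryP])
    refine WP.mono (entryP_spec (v := table d m B F (j + 1) i) e2 e17 hir ?_ (htab i) ?_) le_rfl ?_
    · rw [em, table_succ F hd hj (by rwa [← hY]), ← hY]
      refine sum_congr rfl fun u hu => ?_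
      rw [hT]
      have hu := mem_range.1 hu
      have hr : i % Y < Y := Nat.mod_lt _ hY0
      calc u + d * (i % Y) < d * (i % Y + 1) := by rw [mul_add_one]; omega
        _ ≤ d * Y := Nat.mul_le_mul_left _ hr
    · intro u hu
      have h1 : i / Y ≤ B := (Nat.div_lt_of_lt_mul hi).le
      have h3 : d * 1 ≤ d * m := Nat.mul_le_mul_left _ (by omega)
      calc (i / Y) ^ u ≤ B ^ u := Nat.pow_le_pow_left h1 _
        _ = d ^ 0 * B ^ u := by simp
        _ ≤ U := hpow _ (Nat.zero_le _) _ (by omega)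
    · intro s'' _ _ h i' hi'
      rw [h]
      split_ifs with h'
      · rw [h']
      · exact ha i' (by omega)
  · intro s' _ _ h
    exact h
  · intro s' hs' hf h
    have e15 : s'.reg (o + 15) = Y * B := by
      rw [hf.1 (o + 15) (by simp [entryP])]
      simp [h15, h2, h10, Nat.mul_div_cancel_left _ hd]
    refine WP.mono (copyP_spec (by omega) (by omega)) (by rw [e15]) fun s'' hs'' hf'' h'' => ?_
    have f15 : s''.reg (o + 15) = Y * B := by
      rw [hf''.1 (o + 15) (by simp [copyP]), e15]
    refine ⟨f15, fun i hi => ?_⟩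
    rw [h'' i (by rwa [e15]), h i hi]
  · nlinarith [Nat.mul_le_mul_right (d * 4 + 12) hS]

/-- The values at the given points are read off the table. Register `o + 20` receives the index of
the point, whose base `B` digits are the coordinates, and register `o + 21` is the place value of
the digit. -/
def lookupP (o : ℕ) : Prog :=
  forP (o + 26) (reg 3)
    (.set (o + 20) 0 ;; .set (o + 21) 1 ;;
     forP (o + 18) (reg 1)
      (.set (o + 20) (reg (o + 20) + reg (o + 21) *
          read (o + 1) (reg (o + 26) * reg 1 + reg (o + 18))) ;;
       .set (o + 21) (reg (o + 21) * reg (o + 10))) ;;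
     .write (o + 2) (reg (o + 26)) (read (o + 3) (reg (o + 20))))

theorem lookupP_spec {B : ℕ} {T : ℕ → ℕ} (h1 : s.reg 1 = m) (h3 : s.reg 3 = N)
    (h10 : s.reg (o + 10) = B) (hB : 0 < B) (hU : B ^ m ≤ U)
    (hT : ∀ i < B ^ m, s.mem (o + 3) i = T i)
    (hA : ∀ n < N, ∀ j < m, s.mem (o + 1) (n * m + j) < B) :
    WP U (lookupP o) s (fun s' => ∀ n < N, ∃ i < B ^ m,
      (∀ j < m, dig B i j = s.mem (o + 1) (n * m + j)) ∧ s'.mem (o + 2) n = T i)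
      (N * (m * 4 + 7) + 2) := by
  have hU' : ∀ k ≤ m, B ^ k ≤ U := fun k hk => (Nat.pow_le_pow_right hB hk).trans hU
  refine WP.of_bd fun hs => WP.le (n := N * (1 + (1 + (m * (2 + 2) + 2 + 1)) + 2) + 2)
    (WP.for (fun k s' => ∀ n < k, ∃ i < B ^ m,
      (∀ j < m, dig B i j = s.mem (o + 1) (n * m + j)) ∧ s'.mem (o + 2) n = T i)
      N _ (by simp) (h3 ▸ hs.1 3) ?_ ?_ ?_ ?_ ?_) (by ring_nf; omega)
  · intro s' hf
    simpa [h3] using hf.1 3 (by simp)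
  · intro k s' v h
    simpa using h
  · simp
  · intro n s' hn hs' hf hir ha
    have e1 : s'.reg 1 = m := by simpa [h1] using hf.1 1 (by simp)
    have e10 : s'.reg (o + 10) = B := by simpa [h10] using hf.1 (o + 10) (by simp)
    have em1 : s'.mem (o + 1) = s.mem (o + 1) := by simpa using hf.2 (o + 1) (by simp)
    have em3 : s'.mem (o + 3) = s.mem (o + 3) := by simpa using hf.2 (o + 3) (by simp)
    refine WP.set_seq (by simp) (WP.set_seq (by simpa using hU' 0 (Nat.zero_le _))
      (WP.seq (Q₁ := fun s'' => s''.reg (o + 20) < B ^ m ∧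
        ∀ j < m, dig B (s''.reg (o + 20)) j = s.mem (o + 1) (n * m + j))
      (WP.for (fun t s'' => s''.reg (o + 21) = B ^ t ∧ s''.reg (o + 20) < B ^ t ∧
        ∀ j < t, dig B (s''.reg (o + 20)) j = s.mem (o + 1) (n * m + j)) m (1 + 1) (by simp)
        (h1 ▸ hs.1 1) ?_ ?_ ?_ ?_ ?_) ?_))
    · intro s'' hf''
      simpa [e1] using hf''.1 1 (by simp)
    · intro k s'' v h
      simpa using h
    · simp
    · rintro t s'' ht hs'' hf'' hit ⟨ha, hb, hc⟩
      have f1 : s''.reg 1 = m := by simpa [e1] using hf''.1 1 (by simp)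
      have f10 : s''.reg (o + 10) = B := by simpa [e10] using hf''.1 (o + 10) (by simp)
      have f26 : s''.reg (o + 26) = n := by simpa [hir] using hf''.1 (o + 26) (by simp)
      have fm : s''.mem (o + 1) = s.mem (o + 1) := by simpa [em1] using hf''.2 (o + 1) (by simp)
      have hAt := hA n hn t ht
      have hlt : s''.reg (o + 20) + B ^ t * s.mem (o + 1) (n * m + t) < B ^ (t + 1) := by
        calc s''.reg (o + 20) + B ^ t * s.mem (o + 1) (n * m + t) <
            B ^ t * (s.mem (o + 1) (n * m + t) + 1) := by rw [mul_add_one]; omega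
          _ ≤ B ^ t * B := Nat.mul_le_mul_left _ hAt
          _ = _ := by rw [pow_succ]
      refine WP.set_seq ?_ (WP.set ?_ (And.intro ?_ (And.intro ?_ ?_)))
      · simpa [ha, f26, f1, hit, fm] using hlt.le.trans (hU' (t + 1) ht)
      · simpa [ha, f10, ← pow_succ] using hU' (t + 1) ht
      · simp [ha, f10, pow_succ]
      · simpa [ha, f26, f1, hit, fm] using hlt
      · intro j hj
        simp [ha, f26, f1, hit, fm]
        rcases Nat.lt_succ_iff_lt_or_eq.1 hj with hj | rfl
        · rw [dig_add_mul_of_lt _ _ hj, hc j hj]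
        · rw [dig_add_mul_self hb hAt]
    · rintro s'' _ _ ⟨-, h⟩
      exact h
    · rintro s'' hs'' hf'' ⟨h20, hdig⟩
      have f26 : s''.reg (o + 26) = n := by simpa [hir] using hf''.1 (o + 26) (by simp)
      have fm3 : s''.mem (o + 3) = s.mem (o + 3) := by simpa [em3] using hf''.2 (o + 3) (by simp)
      have fm2 : s''.mem (o + 2) = s'.mem (o + 2) := by simpa using hf''.2 (o + 2) (by simp)
      refine WP.write (hs''.2 _ _) fun n' hn' => ?_
      by_cases h : n' = n
      · subst h
        refine ⟨_, h20, hdig, ?_⟩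
        simp [f26, fm3, hT _ h20]
      · obtain ⟨i, hi, h5, h6⟩ := ha n' (by omega)
        refine ⟨i, hi, h5, ?_⟩
        simp [f26, fm2, h, h6]
  · intro s' _ _ h
    exact h

/-- Evaluation by computing the values at all points with coordinates less than register
`o + 10`. -/
def gridP (o : ℕ) : Prog :=
  copyP (o + 3) o 4 (o + 26) ;; .set (o + 15) (reg 4) ;;
  forP (o + 16) (reg 1) (tableStepP o) ;; lookupP o

theorem gridP_local (o : ℕ) : Local (gridP o) o := by
  constructor
  · intro x h
    simp [gridP, copyP, tableStepP, entryP, lookupP] at h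
    omega
  · intro x h
    simp [gridP, copyP, tableStepP, entryP, lookupP] at h
    omega

/-- The number of steps of `gridP` if the tables have at most `S` entries. -/
def gridTicks (m d N S : ℕ) : ℕ :=
  S * 3 + 5 + (m * (S * (d * 4 + 12) + 8) + 2 + (N * (m * 4 + 7) + 2))

theorem gridP_spec {B S : ℕ} (hd : 0 < d) (hB : 0 < B) (hU : evBound d m B ≤ U)
    (hS : ∀ j ≤ m, d ^ (m - j) * B ^ j ≤ S) :
    Solver (gridP o) o U m d N B (gridTicks m d N S) := by
  intro s h1 h2 h3 h4 h10 hF hA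
  have hBU : B ^ m ≤ U := by
    refine le_trans ?_ hU
    calc B ^ m = 1 * B ^ m := by simp
      _ ≤ _ := Nat.mul_le_mul (Nat.one_le_pow _ _ hd) (Nat.pow_le_pow_right hB (by omega))
  refine WP.of_bd fun hs => WP.le (n := (d ^ m * 3 + 2) + (1 + (m * (S * (d * 4 + 12) + 6 + 2) + 2 +
    (N * (m * 4 + 7) + 2)))) (WP.seq (WP.le (copyP_spec (by omega) (by omega)) (by rw [h4]))
    fun s₁ hs₁ hf₁ hc => WP.set_seq (by simpa using hs₁.1 _) (WP.seq (Q₁ := fun s' =>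
      ∀ i < B ^ m, s'.mem (o + 3) i = table d m B (s.mem o) m i)
    (WP.for (fun j s' => s'.reg (o + 15) = d ^ (m - j) * B ^ j ∧ ∀ i < d ^ (m - j) * B ^ j,
      s'.mem (o + 3) i = table d m B (s.mem o) j i) m _
      (by simp [tableStepP, entryP, copyP]) (h1 ▸ hs.1 1) ?_ ?_ ?_ ?_ ?_) ?_)) ?_
  · intro s' hf
    rw [val_reg, hf.1 1 (by simp [tableStepP, entryP, copyP])]
    simpa [h1] using hf₁.1 1 (by simp [copyP])
  · intro k s' v h
    simpa using h
  · have e4 : s₁.reg 4 = d ^ m := by rw [hf₁.1 4 (by simp [copyP]), h4]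
    refine ⟨by simp [e4], fun i hi => ?_⟩
    have hi : i < d ^ m := by simpa using hi
    rw [table_zero _ hi, setReg_mem, hc i (by rwa [h4])]
  · rintro j s' hj hs' hf hij ⟨h15, hT⟩
    refine tableStepP_spec hd hB hj hF hU ?_ ?_ h15 hT (hS _ hj)
    · rw [hf.1 2 (by simp [tableStepP, entryP, copyP])]
      simpa [h2] using hf₁.1 2 (by simp [copyP])
    · rw [hf.1 (o + 10) (by simp [tableStepP, entryP, copyP])]
      simpa [h10] using hf₁.1 (o + 10) (by simp [copyP])
  · rintro s' _ _ ⟨-, h⟩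
    simpa using h
  · intro s₂ hs₂ hf₂ hT
    have e : ∀ x, x ≤ 4 ∨ x = o + 10 → s₂.reg x = s.reg x := by
      intro x hx
      rw [hf₂.1 x (by simp [tableStepP, entryP, copyP]; omega), setReg_reg, if_neg (by omega),
        hf₁.1 x (by simp [copyP]; omega)]
    have em : s₂.mem (o + 1) = s.mem (o + 1) := by
      rw [hf₂.2 _ (by simp [tableStepP, entryP, copyP]), setReg_mem,
        hf₁.2 _ (by simp [copyP])]
    refine WP.mono (lookupP_spec (T := table d m B (s.mem o) m) (by rw [e _ (by omega), h1])
      (by rw [e _ (by omega), h3]) (by rw [e _ (by omega), h10]) hB hBU hT (by rwa [em])) le_rfl ?_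
    intro s₃ _ _ h n hn
    obtain ⟨i, hi, hdig, hv⟩ := h n hn
    rw [hv, table_self]
    refine ev_congr (fun _ _ => rfl) fun j hj => ?_
    rw [hdig j hj, em]
  · have := hS 0 (Nat.zero_le _)
    simp at this
    unfold gridTicks
    nlinarith

/-! ### The algorithm -/

/-- Evaluation of polynomials with natural number coefficients by `c` rounds of reduction to
smaller coordinates. -/
def evalP : ℕ → ℕ → Prog
  | 0, o => gridP o
  | c + 1, o => levelP o (evalP c (o + 50))

theorem evalP_local (c o : ℕ) : Local (evalP c o) o := by
  induction c generalizing o with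
  | zero => exact gridP_local o
  | succ c ih => exact levelP_local (ih (o + 50))

/-- The number of steps of `evalP c`, where `G j` is a bound for the coordinates when `j` rounds of
reduction remain, and `S` is a bound for the size of the final tables. -/
def evalTicks (m d N S : ℕ) (G : ℕ → ℕ) : ℕ → ℕ
  | 0 => gridTicks m d N S
  | c + 1 => levelTicks m d N (G c) (evalTicks m d N S G c)

theorem evBound_mono {B B' : ℕ} (h : B ≤ B') : evBound d m B ≤ evBound d m B' :=
  Nat.mul_le_mul_left _ (Nat.pow_le_pow_left h _)

/-- In `hG` the number `G j` bounds the primes that are needed for the reduction of coordinates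
less than `B ≤ G (j + 1)`. -/
theorem evalP_spec {S X c B : ℕ} {G : ℕ → ℕ} (hd : 0 < d) (hU : 2 ^ d ≤ U)
    (hm : m + 1 + d * m ≤ U) (hN : N * m ≤ U) (hS : ∀ j ≤ m, d ^ (m - j) * G 0 ^ j ≤ S)
    (hX : ∀ j ≤ c, G j ≤ X) (hX1 : 1 ≤ X) (hXU : evBound d m X * X ^ (m + 1) ≤ U)
    (hG : ∀ j < c, ∀ B, 0 < B → B ≤ G (j + 1) → ∀ x,
      primorial x ^ (m + 1) ≤ evBound d m B → x + 1 ≤ G j)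
    (hB : 0 < B) (hBG : B ≤ G c) :
    Solver (evalP c o) o U m d N B (evalTicks m d N S G c) := by
  induction c generalizing o B with
  | zero =>
    refine gridP_spec hd hB ?_ fun j hj => ?_
    · exact (evBound_mono (hBG.trans (hX 0 le_rfl))).trans
        ((Nat.le_mul_of_pos_right _ (by positivity)).trans hXU)
    · exact (Nat.mul_le_mul_left _ (Nat.pow_le_pow_left hBG _)).trans (hS j hj)
  | succ c ih =>
    refine levelP_spec (evalP_local c _) (fun q hq hqG => ih (fun j hj => hX j (by omega))
      (fun j hj => hG j (by omega)) hq hqG) hB hd (hG c (by omega) B hB hBG) ?_ hU hm hN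
    exact (Nat.mul_le_mul (evBound_mono (hBG.trans (hX _ le_rfl)))
      (Nat.pow_le_pow_left (hX c (by omega)) _)).trans hXU

/-- Multipoint evaluation over `ℤ/rℤ`: the residues are evaluated as natural numbers, and the
values are reduced modulo `r`. -/
def mainP (c : ℕ) : Prog :=
  powP 4 2 (reg 1) 5 ;; .set 10 (reg 0) ;; evalP c 0 ;;
  forP 26 (reg 3) (.write 2 (reg 26) (read 2 (reg 26) % reg 0))

theorem mainP_spec {c r K : ℕ} (hr : 0 < r) (hd : 0 < d) (hN : N ≤ U) (hm : m ≤ U)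
    (hdm : d ^ m ≤ U) (hev : Solver (evalP c 0) 0 U m d N r K)
    (f : MvPolynomial (Fin m) (ZMod r)) (a : Fin N → Fin m → ZMod r)
    (hf : ∀ i, f.degreeOf i < d) :
    WP U (mainP c) (input r m d N f a)
      (fun s' => ∀ i : Fin N, s'.mem 2 i = (MvPolynomial.eval (a i) f).val)
      (m * 3 + N * 3 + K + 6) := by
  have : NeZero r := ⟨hr.ne'⟩
  have hl := evalP_local c 0
  have hF : ∀ k < d ^ m, (input r m d N f a).mem 0 k = (f.coeff (exponent d m k)).val :=
    fun k hk => by simp [input, hk]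
  have hA : ∀ i : Fin N, ∀ j : Fin m, (input r m d N f a).mem 1 (i * m + j) = (a i j).val := by
    intro i j
    have h1 : (i : ℕ) * m + j < N * m := by nlinarith [i.2, j.2]
    have h2 : finProdFinEquiv.symm ⟨(i : ℕ) * m + j, h1⟩ = (i, j) := by
      rw [Equiv.symm_apply_eq]
      ext
      simp [finProdFinEquiv]
      ring
    simp only [input, dif_pos h1, h2]
  refine WP.le (n := (m * 3 + 3) + (1 + (K + (N * (1 + 2) + 2)))) (WP.seq (powP_spec (n := m)
    (by omega) (by omega) (by omega) (fun s' hf' => ?_) hd hm hdm) fun s₁ hs₁ hf₁ h4 =>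
    WP.set_seq (hs₁.1 _) (WP.seq (hev _ ?_ ?_ ?_ ?_ ?_ ?_ ?_) fun s₂ hs₂ hf₂ h2 => ?_)) (by omega)
  · rw [val_reg, hf'.1 1 (by simp [powP])]; rfl
  · simpa [input] using hf₁.1 1 (by simp [powP])
  · simpa [input] using hf₁.1 2 (by simp [powP])
  · simpa [input] using hf₁.1 3 (by simp [powP])
  · simpa [input] using h4
  · simpa [input] using hf₁.1 0 (by simp [powP])
  · intro k hk
    rw [setReg_mem, hf₁.2 0 (by simp [powP]), hF k hk]
    exact (ZMod.val_lt _).trans_le (Nat.le_self_pow (by omega) _)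
  · intro i hi j hj
    rw [setReg_mem, zero_add, hf₁.2 1 (by simp [powP])]
    exact (hA ⟨i, hi⟩ ⟨j, hj⟩).trans_lt (ZMod.val_lt _)
  · have e : ∀ x, x ≤ 3 → s₂.reg x = (input r m d N f a).reg x := by
      intro x hx
      rw [hf₂.1 x fun h => by have := hl.1 x h; omega, setReg_reg, if_neg (by omega),
        hf₁.1 x (by simp [powP]; omega)]
    have hV : ∀ i : Fin N, s₂.mem 2 i % r = (MvPolynomial.eval (a i) f).val := by
      intro i
      rw [eval_val hr f hf (a i) (F := (input r m d N f a).mem 0)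
        (A := fun j => (input r m d N f a).mem 1 (i * m + j)) hF (hA i), h2 i i.2, setReg_mem,
        zero_add, hf₁.2 0 (by simp [powP]), hf₁.2 1 (by simp [powP])]
    refine WP.for (fun k s' => (∀ n < k, s'.mem 2 n = s₂.mem 2 n % r) ∧
      ∀ n, k ≤ n → s'.mem 2 n = s₂.mem 2 n) N 1 (by simp) hN ?_ ?_ ?_ ?_ ?_
    · intro s' hf'
      rw [val_reg, hf'.1 3 (by simp), e 3 le_rfl]; rfl
    · intro k s' v h
      simpa using h
    · simp
    · rintro k s' hk hs' hf' hik ⟨ha, hb⟩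
      have e0 : s'.reg 0 = r := by rw [hf'.1 0 (by simp), e 0 (by omega)]; rfl
      refine WP.write ((Nat.mod_le _ _).trans (hs'.2 _ _)) ⟨?_, ?_⟩
      · intro n hn
        simp only [val_mod, val_reg, val_read, setMem_mem, hik, e0, true_and]
        split_ifs with h
        · rw [h, hb k le_rfl]
        · exact ha n (by omega)
      · intro n hn
        simp only [val_mod, val_reg, val_read, setMem_mem, hik, true_and]
        rw [if_neg (by omega), hb n (by omega)]
    · rintro s' _ _ ⟨h, -⟩ i
      rw [h i i.2, hV i]

theorem input_bd {r : ℕ} (hr : 0 < r) (hN : N ≤ U) (hm : m ≤ U) (hrU : r ≤ U) (hdU : d ≤ U)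
    (f : MvPolynomial (Fin m) (ZMod r)) (a : Fin N → Fin m → ZMod r) :
    (input r m d N f a).Bd U := by
  have : NeZero r := ⟨hr.ne'⟩
  have hv : ∀ x : ZMod r, x.val ≤ U := fun x => (ZMod.val_lt x).le.trans hrU
  constructor
  · intro x
    simp only [input]
    split <;> first | assumption | exact Nat.zero_le _
  · intro b k
    simp only [input]
    split
    · split_ifs
      exacts [hv _, Nat.zero_le _]
    · split_ifs
      exacts [hv _, Nat.zero_le _]
    · exact Nat.zero_le _

/-! ### Bounds for the moduli and for the number of steps -/

/-- Chebyshev's lower bound for the product of the primes. -/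
theorem exists_le_log_primorial : ∃ K : ℕ, ∀ x, x ≤ K * (Nat.log 2 (primorial x) + 1) := by
  have hlim : Tendsto (fun n : ℕ => (Real.log (n + 1) + 2 * √n * Real.log n) / n) atTop (𝓝 0) := by
    have h1 : Tendsto (fun x : ℝ => Real.log (x + 1) / x) atTop (𝓝 0) := by
      have h : (fun x : ℝ => Real.log (x + 1)) =o[atTop] fun x => x := by
        refine (Real.isLittleO_log_id_atTop.comp_tendsto
          (tendsto_atTop_add_const_right _ 1 tendsto_id)).trans_isBigO ?_
        refine Asymptotics.IsBigO.of_bound 2 ?_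
        filter_upwards [eventually_ge_atTop 1] with x hx
        simp only [Function.comp, id, Real.norm_eq_abs]
        rw [abs_of_nonneg (by linarith), abs_of_nonneg (by linarith)]
        linarith
      exact h.tendsto_div_nhds_zero
    have h2 : Tendsto (fun x : ℝ => 2 * (Real.log x / x ^ (1 / 2 : ℝ))) atTop (𝓝 0) := by
      simpa using (isLittleO_log_rpow_atTop
        (by norm_num : (0 : ℝ) < 1 / 2)).tendsto_div_nhds_zero.const_mul 2
    have h3 := (h1.add h2).comp tendsto_natCast_atTop_atTop
    simp only [add_zero] at h3
    refine h3.congr' ?_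
    filter_upwards [eventually_gt_atTop 0] with n hn
    have hn' : (0 : ℝ) < n := by exact_mod_cast hn
    simp only [Function.comp, ← Real.sqrt_eq_rpow]
    have hs : (0 : ℝ) < √n := Real.sqrt_pos.2 hn'
    have hsq := Real.mul_self_sqrt hn'.le
    field_simp
    linear_combination (-2 * Real.log n) * hsq
  have hl2 := Real.log_pos one_lt_two
  obtain ⟨n₀, hn₀⟩ := eventually_atTop.1 (hlim.eventually (gt_mem_nhds (half_pos hl2)))
  refine ⟨n₀ + 2, fun x => ?_⟩
  rcases lt_or_ge x (n₀ + 1) with hx | hx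
  · nlinarith [Nat.zero_le (Nat.log 2 (primorial x))]
  have hx0 : (0 : ℝ) < x := by exact_mod_cast (by omega : 0 < x)
  have h1 := hn₀ x (by omega)
  rw [div_lt_iff₀ hx0] at h1
  have h2 := Chebyshev.theta_ge x
  rw [Chebyshev.theta_eq_log_primorial, Nat.floor_natCast] at h2
  have h3 : (primorial x : ℝ) < 2 ^ (Nat.log 2 (primorial x) + 1) := by
    exact_mod_cast Nat.lt_pow_succ_log_self one_lt_two _
  have h4 := Real.log_lt_log (by exact_mod_cast primorial_pos x) h3
  rw [Real.log_pow] at h4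
  have h5 : (x : ℝ) < 2 * (Nat.log 2 (primorial x) + 1 : ℕ) := by
    have : (x : ℝ) * (Real.log 2 / 2) < (Nat.log 2 (primorial x) + 1 : ℕ) * Real.log 2 := by
      linarith
    nlinarith
  have h6 : x < 2 * (Nat.log 2 (primorial x) + 1) := by exact_mod_cast h5
  nlinarith [Nat.zero_le (n₀ * (Nat.log 2 (primorial x) + 1))]

/-- All the primes that a round of reduction needs are at most a constant times
`d * (Nat.log 2 B + 1)`. -/
theorem exists_prime_bound : ∃ K : ℕ, 1 ≤ K ∧ ∀ d m B x : ℕ, 0 < d →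
    primorial x ^ (m + 1) ≤ evBound d m B → x + 1 ≤ K * d * (Nat.log 2 B + 1) := by
  obtain ⟨K, hK⟩ := exists_le_log_primorial
  refine ⟨4 * K + 1, by omega, fun d m B x hd h => ?_⟩
  have h1 := hK x
  generalize hL : Nat.log 2 (primorial x) = L at *
  generalize hb : Nat.log 2 B + 1 = b at *
  have hb1 : 1 ≤ b := by omega
  have hBb : B ≤ 2 ^ b := hb ▸ (Nat.lt_pow_succ_log_self one_lt_two B).le
  have h2 : 2 ^ (L * (m + 1)) ≤ 2 ^ (d * m + b * (m + 1 + d * m)) := by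
    calc 2 ^ (L * (m + 1)) = (2 ^ L) ^ (m + 1) := pow_mul _ _ _
      _ ≤ primorial x ^ (m + 1) :=
        Nat.pow_le_pow_left (hL ▸ Nat.pow_log_le_self 2 (primorial_pos x).ne') _
      _ ≤ d ^ m * B ^ (m + 1 + d * m) := h
      _ ≤ (2 ^ d) ^ m * (2 ^ b) ^ (m + 1 + d * m) :=
        Nat.mul_le_mul (Nat.pow_le_pow_left Nat.lt_two_pow_self.le _) (Nat.pow_le_pow_left hBb _)
      _ = _ := by rw [← pow_mul, ← pow_mul, ← pow_add]
  have h3 := (Nat.pow_le_pow_iff_right one_lt_two).1 h2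
  have hdb : d ≤ d * b := Nat.le_mul_of_pos_right _ hb1
  have hbd : b ≤ d * b := Nat.le_mul_of_pos_left _ hd
  have h4 : L ≤ 3 * (d * b) := by
    by_contra hlt
    push Not at hlt
    have : (3 * (d * b) + 1) * (m + 1) ≤ L * (m + 1) := Nat.mul_le_mul_right _ hlt
    have h5 : d * m ≤ d * b * m := Nat.mul_le_mul_right _ hdb
    have h6 : b * m ≤ d * b * m := Nat.mul_le_mul_right _ hbd
    nlinarith
  have h7 : 1 ≤ d * b := Nat.mul_pos hd hb1
  have h8 : K * (L + 1) ≤ K * (4 * (d * b)) := Nat.mul_le_mul_left _ (by omega)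
  nlinarith

/-- Bounds for the coordinates after `k` rounds of reduction: each coordinate bound is `K * d`
times the length of the preceding one. -/
def coordBound (K d r : ℕ) : ℕ → ℕ
  | 0 => r
  | k + 1 => K * d * (Nat.log 2 (coordBound K d r k) + 1)

theorem log_coordBound_le (K d r : ℕ) (hK : 1 ≤ K) {Z : ℕ} (hZ : 2 ≤ Z) (hd : d ≤ Z)
    (hr : Nat.size r + 1 ≤ Z) (k : ℕ) :
    Nat.log 2 (coordBound K d r k) + 1 ≤ (K + 5) * Z := by
  induction k with
  | zero =>
    have h1 : r < 2 ^ (Z - 1) := Nat.size_le.1 (by omega)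
    have h2 : Nat.log 2 r ≤ Z - 1 := by
      rcases Nat.eq_zero_or_pos r with rfl | hr
      · simp
      · exact (Nat.log_lt_of_lt_pow hr.ne' h1).le
    have : coordBound K d r 0 = r := rfl
    have hle : Z ≤ (K + 5) * Z := Nat.le_mul_of_pos_left _ (by omega)
    rw [this]
    omega
  | succ k ih =>
    have h1 : coordBound K d r (k + 1) ≤ 2 ^ (K + Z + (K + 5 + Z)) := by
      calc coordBound K d r (k + 1) ≤ K * Z * ((K + 5) * Z) :=
            Nat.mul_le_mul (Nat.mul_le_mul_left _ hd) ih
        _ ≤ 2 ^ K * 2 ^ Z * (2 ^ (K + 5) * 2 ^ Z) := by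
          gcongr <;> exact Nat.lt_two_pow_self.le
        _ = _ := by rw [← pow_add, ← pow_add, ← pow_add]
    have h2 : Nat.log 2 (coordBound K d r (k + 1)) ≤ K + Z + (K + 5 + Z) :=
      (Nat.log_mono_right h1).trans (by rw [Nat.log_pow one_lt_two])
    obtain ⟨y, rfl⟩ : ∃ y, Z = y + 2 := ⟨Z - 2, by omega⟩
    nlinarith [Nat.zero_le (K * y)]

theorem gridTicks_le {z S : ℕ} (hz : 1 ≤ z) (hm : m ≤ z) (hd : d ≤ z) (hS : 1 ≤ S) :
    gridTicks m d N S ≤ 40 * z ^ 2 * (S + N) := by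
  have h1 : m * (S * (d * 4 + 12) + 8) ≤ z * (S * (z * 4 + 12) + 8) := by gcongr
  have h2 : N * (m * 4 + 7) ≤ N * (z * 4 + 7) := by gcongr
  obtain ⟨y, rfl⟩ : ∃ y, z = y + 1 := ⟨z - 1, by omega⟩
  obtain ⟨T, rfl⟩ : ∃ T, S = T + 1 := ⟨S - 1, by omega⟩
  unfold gridTicks
  ring_nf at h1 h2 ⊢
  nlinarith [Nat.zero_le (T * y), Nat.zero_le (T * y ^ 2), Nat.zero_le (N * y),
    Nat.zero_le (N * y ^ 2)]

theorem termTicks_le {z K : ℕ} (hz : 1 ≤ z) (hm : m ≤ z) (hd : d ≤ z) (hD : 1 ≤ d ^ m) :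
    termTicks m d N K ≤ 27 * z ^ 2 * (d ^ m + N + K) := by
  unfold termTicks
  generalize d ^ m = D at *
  have h1 : D * (m * (d * 3 + 11) + 8) ≤ D * (22 * z ^ 2) :=
    Nat.mul_le_mul_left _ (by nlinarith [Nat.mul_le_mul hm hd])
  have h2 : N * (m * (d * 3 + 7) + 7) ≤ N * (17 * z ^ 2) :=
    Nat.mul_le_mul_left _ (by nlinarith [Nat.mul_le_mul hm hd])
  have h3 : 1 ≤ z ^ 2 := Nat.one_le_pow _ _ hz
  generalize z ^ 2 = q at *
  have h4 : 1 ≤ q * D := Nat.mul_pos h3 hD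
  have h5 : K ≤ q * K := Nat.le_mul_of_pos_left _ h3
  nlinarith [Nat.zero_le (N * q)]

theorem levelTicks_le {z G K : ℕ} (hm : m + 1 ≤ z) (hd : d ≤ z) (hG : G ≤ z) (hD : 1 ≤ d ^ m) :
    levelTicks m d N G K ≤ 110 * z ^ 3 * 4 ^ m * (d ^ m + N + K) := by
  have hz : 1 ≤ z := by omega
  obtain ⟨Q, hQ⟩ : ∃ Q, Q = 4 ^ m * (z ^ 2 * (d ^ m + N + K)) := ⟨_, rfl⟩
  have h4 : 1 ≤ 4 ^ m := Nat.one_le_pow _ _ (by norm_num)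
  have hq : 1 ≤ z ^ 2 := Nat.one_le_pow _ _ hz
  have hQ1 : z ^ 2 * (d ^ m + N + K) ≤ Q := hQ ▸ Nat.le_mul_of_pos_left _ h4
  have hQq : z ^ 2 ≤ Q := (Nat.le_mul_of_pos_right _ (by omega)).trans hQ1
  have hQN : z ^ 2 * N ≤ Q := (Nat.mul_le_mul_left _ (by omega)).trans hQ1
  have hQD : z ^ 2 * d ^ m ≤ Q := (Nat.mul_le_mul_left _ (by omega)).trans hQ1
  have hzq : z ≤ z ^ 2 := Nat.le_self_pow (by norm_num) z
  have hN : N ≤ z ^ 2 * N := Nat.le_mul_of_pos_left _ hq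
  have ht : 4 ^ m * termTicks m d N K ≤ 27 * Q := by
    calc 4 ^ m * termTicks m d N K ≤ 4 ^ m * (27 * z ^ 2 * (d ^ m + N + K)) :=
          Nat.mul_le_mul_left _ (termTicks_le hz (by omega) hd hD)
      _ = 27 * Q := by rw [hQ]; ring
  have h1 : N * m ≤ z ^ 2 * N := by rw [mul_comm]; exact Nat.mul_le_mul_right _ (by omega)
  have h2 : d ^ m * (4 * m + 8) ≤ 12 * (z ^ 2 * d ^ m) := by
    rw [mul_comm, ← mul_assoc]; exact Nat.mul_le_mul_right _ (by omega)
  have h3 : N * ((m + 1) * (G * 2 + 5) + 9) ≤ 16 * (z ^ 2 * N) := by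
    rw [mul_comm, ← mul_assoc]
    refine Nat.mul_le_mul_right _ ?_
    have : (m + 1) * (G * 2 + 5) ≤ z * (z * 2 + 5) := by gcongr
    nlinarith
  have hr : roundTicks m d N G K ≤ 80 * Q := by
    unfold roundTicks
    omega
  have h5 : G * (G * 2 + 6 + roundTicks m d N G K) ≤ z * (88 * Q) :=
    Nat.mul_le_mul hG (by omega)
  have h6 : Q ≤ z * Q := Nat.le_mul_of_pos_left _ hz
  have h7 : d * m ≤ z ^ 2 := by rw [sq]; exact Nat.mul_le_mul hd (by omega)
  calc levelTicks m d N G K ≤ 110 * (z * Q) := by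
        unfold levelTicks
        have : z * (88 * Q) = 88 * (z * Q) := by ring
        omega
    _ = _ := by rw [hQ]; ring

theorem evalTicks_le {z S c : ℕ} {G : ℕ → ℕ} (hm : m + 1 ≤ z) (hd : d ≤ z)
    (hG : ∀ j < c, G j ≤ z) (hD : 1 ≤ d ^ m) (hS : d ^ m ≤ S) :
    evalTicks m d N S G c ≤ 40 * 220 ^ c * z ^ (3 * c + 2) * 4 ^ (c * m) * (S + N) := by
  have hz : 1 ≤ z := by omega
  induction c with
  | zero =>
    simp only [evalTicks, pow_zero, mul_zero, zero_mul, zero_add, mul_one]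
    exact gridTicks_le hz (by omega) hd (by omega)
  | succ c ih =>
    have ih := ih fun j hj => hG j (by omega)
    refine (levelTicks_le hm hd (hG c (by omega)) hD).trans ?_
    generalize evalTicks m d N S G c = K at *
    have h1 : S + N ≤ 40 * 220 ^ c * z ^ (3 * c + 2) * 4 ^ (c * m) * (S + N) :=
      Nat.le_mul_of_pos_left _ (by positivity)
    calc 110 * z ^ 3 * 4 ^ m * (d ^ m + N + K) ≤ 110 * z ^ 3 * 4 ^ m *
          (2 * (40 * 220 ^ c * z ^ (3 * c + 2) * 4 ^ (c * m) * (S + N))) :=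
          Nat.mul_le_mul_left _ (by omega)
      _ = _ := by ring

/-- The cost of the algorithm is, up to a polynomial in `m`, `d` and the length of `r`, the number
of derivatives times the size of the tables, times the square of the length of `N`. -/
theorem exists_solves_mainP (c : ℕ) : ∃ K C k : ℕ, 1 ≤ K ∧
    ∀ (r m d N : ℕ) (f : MvPolynomial (Fin m) (ZMod r)) (a : Fin N → Fin m → ZMod r),
      0 < r → 0 < d → (∀ i, f.degreeOf i < d) →
      Solves (mainP c) r m d N f a ((C * (m + d + Nat.size r + 2) ^ k * 4 ^ (c * m) *
        (max d (coordBound K d r c) ^ m + N) * (Nat.size N + 1) ^ 2 : ℕ) : ℝ) := by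
  obtain ⟨K, hK1, hK⟩ := exists_prime_bound
  refine ⟨K, (mainP c).wt * (40 * 220 ^ c + 12) * (K * (K + 5) + 1) ^ (3 * c + 2) *
    (12 * (K + 5)) ^ 2, 2 * (3 * c + 2) + 6, hK1, fun r m d N f a hr hd hf => ?_⟩
  obtain ⟨Z, hZ⟩ : ∃ Z, Z = m + d + Nat.size r + 2 := ⟨_, rfl⟩
  rw [← hZ]
  have hlog := log_coordBound_le K d r hK1 (Z := Z) (by omega) (by omega) (by omega)
  have hrlt : r < 2 ^ Nat.size r := Nat.lt_size_self r
  have hNlt : N < 2 ^ Nat.size N := Nat.lt_size_self N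
  -- `z` bounds `m`, `d` and the primes in all the rounds
  obtain ⟨z, hz⟩ : ∃ z, z = (K * (K + 5) + 1) * Z ^ 2 := ⟨_, rfl⟩
  have hZZ : Z ≤ Z ^ 2 := Nat.le_self_pow (by norm_num) Z
  have hZ3 : Z ^ 2 ≤ Z ^ 3 := Nat.pow_le_pow_right (by omega) (by norm_num)
  have hzZ : Z ^ 2 ≤ z := hz ▸ Nat.le_mul_of_pos_left _ (by omega)
  have hX : ∀ k, coordBound K d r k ≤ 2 ^ ((K + 5) * Z) := fun k =>
    (Nat.lt_pow_succ_log_self one_lt_two _).le.trans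
      (Nat.pow_le_pow_right (by norm_num) (hlog k))
  obtain ⟨S, hS⟩ : ∃ S, S = max d (coordBound K d r c) ^ m := ⟨_, rfl⟩
  rw [← hS]
  -- all numbers that occur are at most `2 ^ E`
  obtain ⟨E, hE⟩ : ∃ E, E = 10 * (K + 5) * Z ^ 3 + Nat.size N := ⟨_, rfl⟩
  have hE0 : 10 * Z ^ 3 + Nat.size N ≤ E := by rw [hE]; nlinarith [Nat.zero_le (K * Z ^ 3)]
  have hpow : ∀ e, e ≤ 10 * Z ^ 3 + Nat.size N → 2 ^ e ≤ 2 ^ E := fun e he =>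
    Nat.pow_le_pow_right (by norm_num) (he.trans hE0)
  have hdm : d * m ≤ Z ^ 2 := by rw [sq]; exact Nat.mul_le_mul (by omega) (by omega)
  have hDm : d ^ m ≤ 2 ^ (d * m) := by
    rw [pow_mul]; exact Nat.pow_le_pow_left Nat.lt_two_pow_self.le _
  have hle : ∀ n, n ≤ 10 * Z ^ 3 + Nat.size N → n ≤ 2 ^ E := fun n hn =>
    Nat.lt_two_pow_self.le.trans (hpow n hn)
  have hNU : N ≤ 2 ^ E := hNlt.le.trans (hpow _ (by omega))
  have hNm : N * m ≤ 2 ^ E := by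
    calc N * m ≤ 2 ^ Nat.size N * 2 ^ m := Nat.mul_le_mul hNlt.le Nat.lt_two_pow_self.le
      _ = 2 ^ (Nat.size N + m) := (pow_add _ _ _).symm
      _ ≤ 2 ^ E := hpow _ (by omega)
  have hXU : evBound d m (2 ^ ((K + 5) * Z)) * (2 ^ ((K + 5) * Z)) ^ (m + 1) ≤ 2 ^ E := by
    calc evBound d m (2 ^ ((K + 5) * Z)) * (2 ^ ((K + 5) * Z)) ^ (m + 1)
        ≤ 2 ^ (d * m) * (2 ^ ((K + 5) * Z)) ^ (m + 1 + d * m) * (2 ^ ((K + 5) * Z)) ^ (m + 1) :=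
          Nat.mul_le_mul_right _ (Nat.mul_le_mul_right _ hDm)
      _ = 2 ^ (d * m + (K + 5) * Z * (m + 1 + d * m + (m + 1))) := by
          rw [mul_assoc, ← pow_add, ← pow_mul, ← pow_add]
      _ ≤ 2 ^ E := by
          refine Nat.pow_le_pow_right (by norm_num) ?_
          have h1 : (K + 5) * Z * (m + 1 + d * m + (m + 1)) ≤ (K + 5) * Z * (3 * Z ^ 2) :=
            Nat.mul_le_mul_left _ (by omega)
          have h2 : (K + 5) * Z * (3 * Z ^ 2) = 3 * ((K + 5) * Z ^ 3) := by ring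
          have h3 : Z ^ 3 ≤ (K + 5) * Z ^ 3 := Nat.le_mul_of_pos_left _ (by omega)
          have h4 : E = 10 * ((K + 5) * Z ^ 3) + Nat.size N := by rw [hE]; ring
          omega
  have hev := evalP_spec (o := 0) (U := 2 ^ E) (N := N) (m := m) (d := d) (S := S) (B := r)
    (X := 2 ^ ((K + 5) * Z)) (c := c) (G := fun j => coordBound K d r (c - j)) hd
    (hpow _ (by omega)) (hle _ (by omega)) hNm
    (fun j hj => by
      rw [hS, Nat.sub_zero]
      calc d ^ (m - j) * coordBound K d r c ^ j ≤
          max d (coordBound K d r c) ^ (m - j) * max d (coordBound K d r c) ^ j :=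
            Nat.mul_le_mul (Nat.pow_le_pow_left (le_max_left _ _) _)
              (Nat.pow_le_pow_left (le_max_right _ _) _)
        _ = _ := by rw [← pow_add]; congr 1; omega)
    (fun j _ => hX _) Nat.one_le_two_pow hXU
    (fun j hj B hB hBj x hx => by
      have e : c - j = (c - (j + 1)) + 1 := by omega
      rw [e]
      refine (hK d m B x hd hx).trans (Nat.mul_le_mul_left _ ?_)
      exact Nat.add_le_add_right (Nat.log_mono_right hBj) 1)
    hr (by simp [coordBound])
  have hticks := evalTicks_le (m := m) (d := d) (N := N) (z := z) (S := S) (c := c)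
    (G := fun j => coordBound K d r (c - j)) (by omega) (by omega)
    (fun j hj => by
      have e : c - j = (c - (j + 1)) + 1 := by omega
      rw [e, hz]
      calc coordBound K d r (c - (j + 1) + 1) ≤ K * Z * ((K + 5) * Z) :=
            Nat.mul_le_mul (Nat.mul_le_mul_left _ (by omega)) (hlog _)
        _ = K * (K + 5) * Z ^ 2 := by ring
        _ ≤ _ := Nat.mul_le_mul_right _ (by omega))
    (Nat.one_le_pow _ _ hd) (by rw [hS]; exact Nat.pow_le_pow_left (le_max_left _ _) _)
  obtain ⟨s', t, h1, h2, -, h4⟩ := mainP_spec hr hd hNU (hle m (by omega))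
    (hDm.trans (hpow _ (by omega))) hev f a hf
    (input_bd hr hNU (hle m (by omega)) (hrlt.le.trans (hpow _ (by omega))) (hle d (by omega)) f a)
  refine ⟨s', t, h1, ?_, h4⟩
  refine Nat.cast_le.2 (h2.trans ?_)
  have hS1 : 1 ≤ S := hS ▸ Nat.one_le_pow _ _ (by omega)
  generalize evalTicks m d N S (fun j => coordBound K d r (c - j)) c = T at *
  obtain ⟨V, hV⟩ : ∃ V, V = z ^ (3 * c + 2) * 4 ^ (c * m) * (S + N) := ⟨_, rfl⟩
  have hzV : z * (S + N) ≤ V := by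
    rw [hV]
    refine Nat.mul_le_mul_right _ ?_
    calc z ≤ z ^ (3 * c + 2) := Nat.le_self_pow (by omega) _
      _ ≤ _ := Nat.le_mul_of_pos_right _ (by positivity)
  have hzV1 : z ≤ V := (Nat.le_mul_of_pos_right _ (by omega)).trans hzV
  have hNV : N ≤ V := by
    have : S + N ≤ z * (S + N) := Nat.le_mul_of_pos_left _ (by omega)
    omega
  have hT : T ≤ 40 * 220 ^ c * V := by rw [hV]; exact hticks.trans (le_of_eq (by ring))
  have hA : m * 3 + N * 3 + T + 6 ≤ (40 * 220 ^ c + 12) * V := by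
    have : (40 * 220 ^ c + 12) * V = 40 * 220 ^ c * V + 12 * V := by ring
    omega
  have hsz : Nat.size (2 ^ E) + 1 ≤ 12 * (K + 5) * Z ^ 3 * (Nat.size N + 1) := by
    rw [Nat.size_pow, hE]
    have : 1 ≤ (K + 5) * Z ^ 3 := Nat.mul_pos (by omega) (by omega)
    generalize hw : (K + 5) * Z ^ 3 = w at *
    have e1 : 10 * (K + 5) * Z ^ 3 = 10 * w := by rw [← hw]; ring
    have e2 : 12 * (K + 5) * Z ^ 3 = 12 * w := by rw [← hw]; ring
    rw [e1, e2]
    nlinarith [Nat.zero_le (Nat.size N)]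
  calc (m * 3 + N * 3 + T + 6) * ((mainP c).wt * (Nat.size (2 ^ E) + 1) ^ 2)
      ≤ (40 * 220 ^ c + 12) * V *
        ((mainP c).wt * (12 * (K + 5) * Z ^ 3 * (Nat.size N + 1)) ^ 2) := by gcongr
    _ = _ := by
        have hzpow : z ^ (3 * c + 2) = (K * (K + 5) + 1) ^ (3 * c + 2) * Z ^ (2 * (3 * c + 2)) := by
          rw [hz, mul_pow, ← pow_mul]
        rw [hV, hzpow, pow_add Z]
        generalize (K * (K + 5) + 1) ^ (3 * c + 2) = x₁
        generalize Z ^ (2 * (3 * c + 2)) = x₂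
        generalize 220 ^ c = x₃
        generalize 4 ^ (c * m) = x₄
        ring

end RAM

namespace MultipointEval
open RAM

/-! ### Asymptotics -/

theorem logb_two_le {x : ℝ} (hx : 1 ≤ x) : Real.logb 2 x ≤ 2 * x := by
  have h1 := Real.log_le_sub_one_of_pos (show 0 < x by linarith)
  have h2 := Real.log_two_gt_d9
  rw [Real.logb, div_le_iff₀ (by linarith)]
  nlinarith

theorem logb_two_add_one_le (x : ℝ) (hx : 0 ≤ x) :
    Real.logb 2 (x + 1) ≤ max 0 (Real.logb 2 x) + 1 := by
  rcases le_total 1 x with h | h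
  · calc Real.logb 2 (x + 1) ≤ Real.logb 2 (x * 2) :=
          Real.logb_le_logb_of_le one_lt_two (by linarith) (by linarith)
      _ = Real.logb 2 x + 1 := by
          rw [Real.logb_mul (by linarith) two_ne_zero, Real.logb_self_eq_one one_lt_two]
      _ ≤ _ := by gcongr; exact le_max_right _ _
  · calc Real.logb 2 (x + 1) ≤ Real.logb 2 2 :=
          Real.logb_le_logb_of_le one_lt_two (by linarith) (by linarith)
      _ = 1 := Real.logb_self_eq_one one_lt_two
      _ ≤ _ := by linarith [le_max_left 0 (Real.logb 2 x)]

theorem iterLog_succ (c : ℕ) (x : ℝ) :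
    iterLog (c + 1) x = max 0 (Real.logb 2 (iterLog c x)) := by
  simp only [iterLog, Function.iterate_succ_apply']

theorem iterLog_nonneg (c : ℕ) {x : ℝ} (hx : 0 ≤ x) : 0 ≤ iterLog c x := by
  cases c with
  | zero => exact hx
  | succ c => rw [iterLog_succ]; exact le_max_left _ _

/-- A round of reduction takes one logarithm, up to a factor that is almost linear in `d`. -/
theorem coordBound_le {K d r : ℕ} (hK : 1 ≤ K) (hd : 1 ≤ d) (hr : 0 < r) (k : ℕ) :
    (coordBound K d r k : ℝ) ≤
      16 * K ^ 2 * d * (Real.logb 2 d + 1) * (iterLog k r + 1) := by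
  have hK' : (1 : ℝ) ≤ K := by exact_mod_cast hK
  have hd' : (1 : ℝ) ≤ d := by exact_mod_cast hd
  have hr' : (0 : ℝ) < r := by exact_mod_cast hr
  obtain ⟨l, hl⟩ : ∃ l, l = Real.logb 2 d + 1 := ⟨_, rfl⟩
  have hl1 : 1 ≤ l := by
    have := Real.logb_nonneg one_lt_two hd'
    linarith
  rw [← hl]
  induction k with
  | zero =>
    simp only [coordBound, iterLog, Function.iterate_zero, id]
    have h1 : (1 : ℝ) ≤ K ^ 2 := one_le_pow₀ hK'
    have h2 : (1 : ℝ) ≤ K ^ 2 * d := one_le_mul_of_one_le_of_one_le h1 hd'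
    have h3 : (1 : ℝ) ≤ K ^ 2 * d * l := one_le_mul_of_one_le_of_one_le h2 hl1
    nlinarith
  | succ k ih =>
    have hR := iterLog_nonneg k hr'.le
    have hR' := iterLog_nonneg (k + 1) hr'.le
    have hpos : 0 < coordBound K d r k := by
      cases k with
      | zero => exact hr
      | succ k => exact Nat.mul_pos (Nat.mul_pos hK hd) (Nat.succ_pos _)
    have h1 : (Nat.log 2 (coordBound K d r k) : ℝ) ≤ 4 + 4 * K + 3 * l + iterLog (k + 1) r + 1 := by
      calc (Nat.log 2 (coordBound K d r k) : ℝ) ≤ Real.logb 2 (coordBound K d r k) := by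
            exact_mod_cast Real.natLog_le_logb _ _
        _ ≤ Real.logb 2 (16 * K ^ 2 * d * l * (iterLog k r + 1)) :=
            Real.logb_le_logb_of_le one_lt_two (by exact_mod_cast hpos) ih
        _ = 4 + 2 * Real.logb 2 K + Real.logb 2 d + Real.logb 2 l +
              Real.logb 2 (iterLog k r + 1) := by
            have h16 : Real.logb 2 16 = 4 := by
              rw [show (16 : ℝ) = 2 ^ (4 : ℕ) by norm_num, Real.logb_pow,
                Real.logb_self_eq_one one_lt_two]
              norm_num
            rw [Real.logb_mul (by positivity) (by positivity),
              Real.logb_mul (by positivity) (by positivity),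
              Real.logb_mul (by positivity) (by positivity),
              Real.logb_mul (by positivity) (by positivity), Real.logb_pow, h16]
            norm_num
        _ ≤ _ := by
            have a1 := logb_two_le hK'
            have a2 := logb_two_le hl1
            have a3 := logb_two_add_one_le _ hR
            rw [← iterLog_succ] at a3
            linarith
    simp only [coordBound]
    push_cast
    have h2 : (K * d : ℝ) * (Nat.log 2 (coordBound K d r k) + 1) ≤
        K * d * (16 * K * l * (iterLog (k + 1) r + 1)) := by
      refine mul_le_mul_of_nonneg_left ?_ (by positivity)
      have h3 : 1 ≤ K * l := one_le_mul_of_one_le_of_one_le hK' hl1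
      have h4 : (K : ℝ) ≤ K * l := le_mul_of_one_le_right (by linarith) hl1
      have h5 : l ≤ K * l := le_mul_of_one_le_left (by linarith) hK'
      have h6 : iterLog (k + 1) r ≤ K * l * iterLog (k + 1) r := le_mul_of_one_le_left hR' h3
      nlinarith
    calc _ ≤ _ := h2
      _ = _ := by ring

theorem tendsto_log_natCast : Tendsto (fun d : ℕ => Real.log d) atTop atTop :=
  Real.tendsto_log_atTop.comp tendsto_natCast_atTop_atTop

/-- Factors that are logarithmic in `d` are of the form `d ^ o(1)`. -/
theorem tendsto_log_logb_div_log (A : ℝ) (hA : 1 ≤ A) :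
    Tendsto (fun d : ℕ => Real.log (A * (Real.logb 2 d + 1)) / Real.log d) atTop (𝓝 0) := by
  have hl2 := Real.log_pos one_lt_two
  have h : (fun y : ℝ => Real.log (A * (y / Real.log 2 + 1))) =o[atTop] fun y => y := by
    have ht : Tendsto (fun y : ℝ => A * (y / Real.log 2 + 1)) atTop atTop :=
      (tendsto_atTop_add_const_right _ 1 (tendsto_id.atTop_div_const hl2)).const_mul_atTop
        (by linarith)
    refine (Real.isLittleO_log_id_atTop.comp_tendsto ht).trans_isBigO ?_
    refine Asymptotics.IsBigO.of_bound (A * (1 / Real.log 2 + 1)) ?_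
    filter_upwards [eventually_ge_atTop 1] with y hy
    have hy0 : 0 ≤ y / Real.log 2 := by positivity
    simp only [Function.comp, id, Real.norm_eq_abs]
    rw [abs_of_nonneg (by positivity), abs_of_nonneg (by linarith)]
    calc A * (y / Real.log 2 + 1) ≤ A * (y / Real.log 2 + y) := by gcongr
      _ = _ := by ring
  exact h.tendsto_div_nhds_zero.comp tendsto_log_natCast

theorem size_le_log {N : ℕ} {X : ℝ} (hX : 1 ≤ X) (hN : (N : ℝ) ≤ X) :
    (Nat.size N : ℝ) ≤ 2 * Real.log X + 1 := by
  have hlX := Real.log_nonneg hX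
  rcases Nat.eq_zero_or_pos (Nat.size N) with h0 | h0
  · rw [h0]; push_cast; linarith
  · have h1 : 2 ^ (Nat.size N - 1) ≤ N := Nat.lt_size.1 (by omega)
    have h2 : (2 : ℝ) ^ (Nat.size N - 1) ≤ X := le_trans (by exact_mod_cast h1) hN
    have h3 := Real.log_le_log (by positivity) h2
    rw [Real.log_pow, Nat.cast_sub h0] at h3
    have h4 := Real.log_two_gt_d9
    push_cast at h3
    have h5 : (1 : ℝ) ≤ Nat.size N := by exact_mod_cast h0
    nlinarith

theorem Solves.mono {P : Prog} {r m d N : ℕ} {f : MvPolynomial (Fin m) (ZMod r)}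
    {a : Fin N → Fin m → ZMod r} {T T' : ℝ} (h : Solves P r m d N f a T) (hT : T ≤ T') :
    Solves P r m d N f a T' := by
  obtain ⟨s, t, h1, h2, h3⟩ := h
  exact ⟨s, t, h1, h2.trans hT, h3⟩

end MultipointEval

open MultipointEval RAM

/-! ### Multipoint evaluation in almost linear time -/

theorem mainTheorem3 (c : ℕ) :
    ∃ (P : RAM.Prog) (Q : MvPolynomial (Fin 3) ℝ),
      ∀ ε : ℕ → ℝ, Tendsto ε atTop (𝓝 0) →
        ∃ δ : ℕ → ℝ, Tendsto δ atTop (𝓝 0) ∧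
          ∀ᶠ d : ℕ in atTop, ∀ m N r : ℕ, 0 < r →
            MultipointEval.iterLog c (r : ℝ) ≤ (d : ℝ) ^ (ε d) →
              ∀ (f : MvPolynomial (Fin m) (ZMod r)) (a : Fin N → Fin m → ZMod r),
                (∀ i : Fin m, f.degreeOf i < d) →
                  MultipointEval.Solves P r m d N f a
                    (((d : ℝ) ^ m + (N : ℝ)) ^ (1 + δ d) *
                      MvPolynomial.eval ![(m : ℝ), (d : ℝ), Real.logb 2 (r : ℝ)] Q) := by
  obtain ⟨K, C, k, hK, H⟩ := exists_solves_mainP c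
  refine ⟨mainP c, MvPolynomial.C (32 * (C : ℝ) * 3 ^ k) * (1 + MvPolynomial.X 0 + MvPolynomial.X 1 +
    MvPolynomial.X 2) ^ (k + 2), fun ε hε => ?_⟩
  have hK' : (1 : ℝ) ≤ K := by exact_mod_cast hK
  have hA : (1 : ℝ) ≤ 32 * K ^ 2 := by nlinarith
  obtain ⟨η, hη⟩ : ∃ η : ℕ → ℝ, η = fun d : ℕ =>
    |ε d| + Real.log (32 * K ^ 2 * (Real.logb 2 d + 1)) / Real.log d := ⟨_, rfl⟩
  obtain ⟨γ, hγ⟩ : ∃ γ : ℕ → ℝ, γ = fun d : ℕ =>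
    Real.log ((4 : ℝ) ^ c) / Real.log (d : ℝ) := ⟨_, rfl⟩
  refine ⟨fun d => η d + γ d + 2 * (1 / d), ?_, ?_⟩
  · have h1 : Tendsto η atTop (𝓝 0) := by
      rw [hη]
      simpa using hε.abs.add (tendsto_log_logb_div_log _ hA)
    have h2 : Tendsto γ atTop (𝓝 0) := hγ ▸ tendsto_log_natCast.const_div_atTop _
    have h3 : Tendsto (fun d : ℕ => 2 * (1 / d : ℝ)) atTop (𝓝 0) := by
      simpa using (tendsto_one_div_atTop_nhds_zero_nat (𝕜 := ℝ)).const_mul 2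
    simpa using (h1.add h2).add h3
  filter_upwards [eventually_ge_atTop 2] with d hd m N r hr hlog f a hf
  refine (H r m d N f a hr (by omega) hf).mono ?_
  -- the exponents `η`, `γ` and `2 / d` account for the tables, the derivatives and the length of `N`
  have hd' : (2 : ℝ) ≤ d := by exact_mod_cast hd
  have hd0 : (0 : ℝ) < d := by linarith
  have hd1 : (1 : ℝ) ≤ d := by linarith
  have hld : 0 < Real.log d := Real.log_pos (by linarith)
  have hr1 : (1 : ℝ) ≤ r := by exact_mod_cast hr
  have hlr := Real.logb_nonneg one_lt_two hr1
  have hld2 := Real.logb_nonneg one_lt_two hd1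
  have hη0 : 0 ≤ η d := by
    rw [hη]
    have : 0 ≤ Real.log (32 * K ^ 2 * (Real.logb 2 d + 1)) :=
      Real.log_nonneg (one_le_mul_of_one_le_of_one_le hA (by linarith))
    positivity
  have hγ0 : 0 ≤ γ d := by
    rw [hγ]
    have : 0 ≤ Real.log ((4 : ℝ) ^ c) := Real.log_nonneg (one_le_pow₀ (by norm_num))
    positivity
  obtain ⟨X, hX⟩ : ∃ X : ℝ, X = (d : ℝ) ^ m + N := ⟨_, rfl⟩
  have hdm1 : (1 : ℝ) ≤ (d : ℝ) ^ m := one_le_pow₀ hd1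
  have hN0 : (0 : ℝ) ≤ N := Nat.cast_nonneg _
  have hdX : (d : ℝ) ^ m ≤ X := by linarith
  have hNX : (N : ℝ) ≤ X := by linarith
  have hX1 : 1 ≤ X := by linarith
  have hX0 : 0 < X := by linarith
  rw [← hX]
  -- the size of the tables
  have hS : ((max d (coordBound K d r c) : ℕ) : ℝ) ^ m ≤ X ^ (1 + η d) := by
    have h1 : ((max d (coordBound K d r c) : ℕ) : ℝ) ≤ (d : ℝ) ^ (1 + η d) := by
      have h2 : (d : ℝ) ^ ε d + 1 ≤ 2 * (d : ℝ) ^ |ε d| := by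
        have := Real.rpow_le_rpow_of_exponent_le hd1 (le_abs_self (ε d))
        have := Real.one_le_rpow hd1 (abs_nonneg (ε d))
        linarith
      have h3 : (d : ℝ) ^ (1 + η d) = 32 * K ^ 2 * d * (Real.logb 2 d + 1) * d ^ |ε d| := by
        rw [hη, Real.rpow_add hd0, Real.rpow_one, Real.rpow_add hd0,
          Real.rpow_def_of_pos hd0 (Real.log _ / _), mul_div_cancel₀ _ hld.ne',
          Real.exp_log (by positivity)]
        ring
      have h4 : 16 * K ^ 2 * d * (Real.logb 2 d + 1) * (iterLog c r + 1) ≤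
          (d : ℝ) ^ (1 + η d) := by
        calc 16 * K ^ 2 * d * (Real.logb 2 d + 1) * (iterLog c r + 1) ≤
            16 * K ^ 2 * d * (Real.logb 2 d + 1) * (2 * (d : ℝ) ^ |ε d|) := by
              gcongr
              linarith
          _ = _ := by rw [h3]; ring
      rw [Nat.cast_max]
      refine max_le ?_ ((coordBound_le hK (by omega) hr c).trans h4)
      calc (d : ℝ) = (d : ℝ) ^ (1 : ℝ) := (Real.rpow_one _).symm
        _ ≤ _ := Real.rpow_le_rpow_of_exponent_le hd1 (by linarith)
    calc ((max d (coordBound K d r c) : ℕ) : ℝ) ^ m ≤ ((d : ℝ) ^ (1 + η d)) ^ m := by gcongr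
      _ = ((d : ℝ) ^ m) ^ (1 + η d) := by
          rw [← Real.rpow_natCast, ← Real.rpow_mul hd0.le, mul_comm, Real.rpow_mul hd0.le,
            Real.rpow_natCast]
      _ ≤ _ := Real.rpow_le_rpow (by positivity) hdX (by linarith)
  have hN : (N : ℝ) ≤ X ^ (1 + η d) := by
    calc (N : ℝ) ≤ X ^ (1 : ℝ) := by rwa [Real.rpow_one]
      _ ≤ _ := Real.rpow_le_rpow_of_exponent_le hX1 (by linarith)
  -- the number of Hasse derivatives
  have h4 : (4 : ℝ) ^ (c * m) ≤ X ^ γ d := by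
    have h1 : (d : ℝ) ^ γ d = 4 ^ c := by
      rw [hγ, Real.rpow_def_of_pos hd0, mul_div_cancel₀ _ hld.ne', Real.exp_log (by positivity)]
    calc (4 : ℝ) ^ (c * m) = ((d : ℝ) ^ γ d) ^ m := by rw [h1, pow_mul]
      _ = ((d : ℝ) ^ m) ^ γ d := by
          rw [← Real.rpow_natCast, ← Real.rpow_mul hd0.le, mul_comm, Real.rpow_mul hd0.le,
            Real.rpow_natCast]
      _ ≤ _ := Real.rpow_le_rpow (by positivity) hdX hγ0
  -- the length of `N` is at most `X ^ (1 / d)` up to a factor linear in `d`, since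
  -- `log X ≤ d * X ^ (1 / d)`
  have hsize : ((Nat.size N : ℝ) + 1) ≤ 4 * d * X ^ (1 / d : ℝ) := by
    have h1 := size_le_log hX1 hNX
    have h2 := Real.log_le_rpow_div hX0.le (show (0 : ℝ) < 1 / d by positivity)
    have h3 : X ^ (1 / d : ℝ) / (1 / d) = d * X ^ (1 / d : ℝ) := by field_simp
    have h5 : (1 : ℝ) ≤ X ^ (1 / d : ℝ) := Real.one_le_rpow hX1 (by positivity)
    have h6 : (1 : ℝ) ≤ d * X ^ (1 / d : ℝ) := one_le_mul_of_one_le_of_one_le hd1 h5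
    rw [h3] at h2
    linarith
  have hZ : ((m + d + Nat.size r + 2 : ℕ) : ℝ) ≤ 3 * (1 + m + d + Real.logb 2 r) := by
    have h1 : 2 ^ (Nat.size r - 1) ≤ r := Nat.lt_size.1 (by have := Nat.size_pos.2 hr; omega)
    have h2 : ((Nat.size r - 1 : ℕ) : ℝ) ≤ Real.logb 2 r := by
      rw [Real.le_logb_iff_rpow_le one_lt_two (by linarith), Real.rpow_natCast]
      exact_mod_cast h1
    rw [Nat.cast_sub (Nat.size_pos.2 hr)] at h2
    have := Nat.cast_nonneg (α := ℝ) m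
    push_cast at h2 ⊢
    linarith
  obtain ⟨Y, hY⟩ : ∃ Y : ℝ, Y = 1 + m + d + Real.logb 2 r := ⟨_, rfl⟩
  have hm0 : (0 : ℝ) ≤ m := Nat.cast_nonneg _
  have hdY : (d : ℝ) ≤ Y := by linarith
  have hY0 : 0 ≤ Y := by linarith
  rw [← hY] at hZ
  have heval : MvPolynomial.eval ![(m : ℝ), (d : ℝ), Real.logb 2 (r : ℝ)]
      (MvPolynomial.C (32 * (C : ℝ) * 3 ^ k) * (1 + MvPolynomial.X 0 + MvPolynomial.X 1 +
        MvPolynomial.X 2) ^ (k + 2)) = 32 * C * 3 ^ k * Y ^ (k + 2) := by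
    simp [hY]
  rw [heval]
  have hsplit : X ^ (1 + (η d + γ d + 2 * (1 / d))) =
      X ^ (1 + η d) * X ^ γ d * (X ^ (1 / d : ℝ)) ^ 2 := by
    rw [← Real.rpow_natCast (X ^ (1 / d : ℝ)), ← Real.rpow_mul hX0.le, ← Real.rpow_add hX0,
      ← Real.rpow_add hX0]
    congr 1
    push_cast
    ring
  rw [hsplit]
  have hCast : (((C * (m + d + Nat.size r + 2) ^ k * 4 ^ (c * m) *
      (max d (coordBound K d r c) ^ m + N) * (Nat.size N + 1) ^ 2 : ℕ)) : ℝ) =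
      C * ((m + d + Nat.size r + 2 : ℕ) : ℝ) ^ k * 4 ^ (c * m) *
      (((max d (coordBound K d r c) : ℕ) : ℝ) ^ m + N) * (Nat.size N + 1) ^ 2 := by
    push_cast
    ring
  rw [hCast]
  calc C * ((m + d + Nat.size r + 2 : ℕ) : ℝ) ^ k * 4 ^ (c * m) *
      (((max d (coordBound K d r c) : ℕ) : ℝ) ^ m + N) * (Nat.size N + 1) ^ 2
      ≤ C * (3 * Y) ^ k * X ^ γ d * (X ^ (1 + η d) + X ^ (1 + η d)) *
        (4 * d * X ^ (1 / d : ℝ)) ^ 2 := by gcongr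
    _ = 32 * C * 3 ^ k * (Y ^ k * d ^ 2) *
        (X ^ (1 + η d) * X ^ γ d * (X ^ (1 / d : ℝ)) ^ 2) := by rw [mul_pow 3 Y]; ring
    _ ≤ 32 * C * 3 ^ k * (Y ^ k * Y ^ 2) *
        (X ^ (1 + η d) * X ^ γ d * (X ^ (1 / d : ℝ)) ^ 2) := by gcongr
    _ = _ := by ring
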